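/- **Setting.** Let $\mathbb U$ be the set of finite words on $\{0,1\}$ (empty word $\emptyset$, depth $|u|$ = length of $u$), and let $(E_u)_{u\in\mathbb U}$ be i.i.d. $\mathrm{Exp}(1)$ random variables (lifetimes) on a probability space. The node $u$ appears at time $\tau^{(u)}=\sum_{v} E_v$, the sum being over the strict prefixes $v$ of $u$, and is replaced after its lifetime $E_u$ by its children $u0,u1$. The Yule tree process is $\mathbb T_t=\{u:\tau^{(u)}\le t\}$, $t\ge 0$. For a tree $T$ let $\partial T$ be its set of leaves; put $N_t=\#\partial\mathbb T_t$ and $\tau_n=\inf\{t\ge 0: N_t=n+1\}$. The binary search tree (BST) process is embedded in the Yule tree process: $\mathcal T_n=\mathbb T_{\tau_n}$, $n\ge 0$. For $z>0$ put $$M(t,z)=\sum_{u\in\partial\mathbb T_t}z^{|u|}e^{t(1-2z)},\qquad \mathcal M_n(z)=\frac1{C_n(z)}\sum_{u\in\partial\mathcal T_n}z^{|u|},\qquad C_n(z)=\prod_{k=0}^{n-1}\frac{k+2z}{k+1}.$$ For $w\in\mathbb U$, the subtree issued from $w$ is the Yule tree process with lifetimes $(E_{wv})_{v\in\mathbb U}$;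 write $\xi_w$, $M_w(\infty,z)$, $\mathcal M_{\infty,(w)}(z)$ for the limits as $t\to\infty$, resp. $n\to\infty$, of the quantities $e^{-t}N_t$, $M(t,z)$, $\mathcal M_n(z)$ formed from that process, and drop the index for $w=\emptyset$. Let $c'<c$ be the two solutions in $[0,\infty)$ of $x\log\frac x2-x+2=1$ (with $0\log 0=0$), and $z_c^-=c'/2$, $z_c^+=c/2$. **Theorem.** Let $z\in(z_c^-,z_c^+)$ be real. The process $(\mathcal T_n)_{n\ge0}$ is a BST process, that is, a Markov chain of trees with $\mathcal T_0=\{\emptyset\}$ and a.s. $n+1$ leaves at time $n$, in which, given $\mathcal T_0,\dots,\mathcal T_n$, each leaf $u$ of $\mathcal T_n$ is the one for which $\mathcal T_{n+1}=\mathcal T_n\cup\{u0,u1\}$ with probability $\frac1{n+1}$. For every $w\in\mathbb U$ the limits $\xi_w$, $M_w(\infty,z)$, $\mathcal M_{\infty,(w)}(z)$ exist a.s. and are finite; and $\xi\sim\mathrm{Exp}(1)$. Moreover: 1. (Limit martingale connection) almost surely $$M(\infty,z)=\frac{\xi^{2z-1}}{\Gamma(2z)}\,\mathcal M_\infty(z).$$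 2. a) (Splitting formula for the Yule process) almost surely $$M(\infty,z)=z\,e^{(1-2z)\tau_1}\bigl(M_0(\infty,z)+M_1(\infty,z)\bigr),$$ where $\tau_1$, $M_0(\infty,z)$, $M_1(\infty,z)$ are independent and $M_0(\infty,z)$, $M_1(\infty,z)$ are distributed as $M(\infty,z)$. b) (Splitting formula for the BST) with $U=\xi_0/(\xi_0+\xi_1)$, almost surely $$\mathcal M_\infty(z)=z\Bigl(U^{2z-1}\mathcal M_{\infty,(0)}(z)+(1-U)^{2z-1}\mathcal M_{\infty,(1)}(z)\Bigr),$$ where $U$ is uniformly distributed on $[0,1]$, the variables $U$, $\mathcal M_{\infty,(0)}(z)$, $\mathcal M_{\infty,(1)}(z)$ are independent, and $\mathcal M_{\infty,(0)}(z)$, $\mathcal M_{\infty,(1)}(z)$ are distributed as $\mathcal M_\infty(z)$. -/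

import Mathlib

open MeasureTheory ProbabilityTheory Filter Topology

namespace YuleBST

noncomputable section

/-! ### The critical values -/

/-- The Cramér transform of the Poisson distribution of parameter `lam`
(considered for `x ≥ 0`, with `0 log 0 = 0`). -/
def eta (lam x : ℝ) : ℝ := x * Real.log (x / lam) - x + lam

/-- The smaller nonnegative solution `c' = 0.3733…` of `eta 2 x = 1`. -/
def cLow : ℝ := sInf {x : ℝ | 0 ≤ x ∧ eta 2 x = 1}

/-- The larger nonnegative solution `c = 4.31107…` of `eta 2 x = 1`. -/
def cHigh : ℝ := sSup {x : ℝ | 0 ≤ x ∧ eta 2 x = 1}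

def zcMinus : ℝ := cLow / 2

def zcPlus : ℝ := cHigh / 2

theorem eta_two_eq (x : ℝ) : eta 2 x = 2 * ((x / 2) * Real.log (x / 2)) + (2 - x) := by
  unfold eta; ring

theorem continuous_eta_two : Continuous (eta 2) := by
  have h : eta 2 = fun x => 2 * ((x / 2) * Real.log (x / 2)) + (2 - x) := funext eta_two_eq
  rw [h]
  have := Real.continuous_mul_log.comp (continuous_id.div_const (2 : ℝ))
  exact (continuous_const.mul this).add (continuous_const.sub continuous_id)

theorem eta_two_lt {a b d : ℝ} (ha : 0 ≤ a) (hab : a < b) (hbd : b < d)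
    (h1 : eta 2 a = 1) (h2 : eta 2 d = 1) : eta 2 b < 1 := by
  have hpos : 0 < d - a := by linarith
  have hc := Real.strictConvexOn_mul_log.2
    (show a / 2 ∈ Set.Ici (0 : ℝ) from Set.mem_Ici.2 (by linarith))
    (show d / 2 ∈ Set.Ici (0 : ℝ) from Set.mem_Ici.2 (by linarith))
    (by intro h; linarith)
    (show 0 < (d - b) / (d - a) from div_pos (by linarith) hpos)
    (show 0 < (b - a) / (d - a) from div_pos (by linarith) hpos)
    (by rw [← add_div, div_eq_one_iff_eq hpos.ne']; ring)
  have hd : d - a ≠ 0 := hpos.ne'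
  have hb : ((d - b) / (d - a)) • (a / 2) + ((b - a) / (d - a)) • (d / 2) = b / 2 := by
    simp only [smul_eq_mul]; field_simp; ring
  rw [hb] at hc
  rw [eta_two_eq] at h1 h2 ⊢
  have e1 : a / 2 * Real.log (a / 2) = (a - 1) / 2 := by linarith
  have e2 : d / 2 * Real.log (d / 2) = (d - 1) / 2 := by linarith
  simp only [smul_eq_mul] at hc
  rw [e1, e2] at hc
  have : (d - b) / (d - a) * ((a - 1) / 2) + (b - a) / (d - a) * ((d - 1) / 2)
      = (b - 1) / 2 := by
    field_simp; ring
  linarith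

/-- `cLow < 2 < cHigh` are exactly the two nonnegative solutions of `eta 2 x = 1`. -/
theorem cLow_cHigh_spec :
    0 < cLow ∧ cLow < 2 ∧ 2 < cHigh ∧ {x : ℝ | 0 ≤ x ∧ eta 2 x = 1} = {cLow, cHigh} := by
  have h0 : eta 2 0 = 2 := by simp [eta]
  have h2 : eta 2 2 = 0 := by simp [eta]
  have he : eta 2 (2 * Real.exp 1) = 2 := by
    rw [eta_two_eq, show 2 * Real.exp 1 / 2 = Real.exp 1 by ring, Real.log_exp]; ring
  have hle : (2 : ℝ) ≤ 2 * Real.exp 1 := by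
    have := Real.add_one_le_exp 1; linarith
  obtain ⟨a, ⟨ha0, ha2⟩, ha⟩ : (1 : ℝ) ∈ eta 2 '' Set.Icc 0 2 :=
    intermediate_value_Icc' (by norm_num) continuous_eta_two.continuousOn
      ⟨by rw [h2]; norm_num, by rw [h0]; norm_num⟩
  obtain ⟨b, ⟨hb2, -⟩, hb⟩ : (1 : ℝ) ∈ eta 2 '' Set.Icc 2 (2 * Real.exp 1) :=
    intermediate_value_Icc hle continuous_eta_two.continuousOn
      ⟨by rw [h2]; norm_num, by rw [he]; norm_num⟩
  have ha0' : 0 < a := lt_of_le_of_ne ha0 (by rintro rfl; linarith)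
  have ha2' : a < 2 := lt_of_le_of_ne ha2 (by rintro rfl; linarith)
  have hb2' : 2 < b := lt_of_le_of_ne hb2 (by rintro rfl; linarith)
  have hS : {x : ℝ | 0 ≤ x ∧ eta 2 x = 1} = {a, b} := by
    ext x
    simp only [Set.mem_ofPred_eq, Set.mem_insert_iff, Set.mem_singleton_iff]
    constructor
    · rintro ⟨hx0, hx⟩
      by_contra! hne
      rcases lt_or_gt_of_ne hne.1 with h | h
      · have := eta_two_lt hx0 h (by linarith : a < b) hx hb; linarith
      · rcases lt_or_gt_of_ne hne.2 with h' | h'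
        · have := eta_two_lt ha0 h h' ha hb; linarith
        · have := eta_two_lt ha0 (by linarith : a < b) h' ha hx; linarith
    · rintro (rfl | rfl)
      · exact ⟨ha0, ha⟩
      · exact ⟨by linarith, hb⟩
  have hl : cLow = a := by
    unfold cLow; rw [hS, csInf_pair]; exact min_eq_left (by linarith)
  have hh : cHigh = b := by
    unfold cHigh; rw [hS, csSup_pair]; exact max_eq_right (by linarith)
  rw [hl, hh]
  exact ⟨ha0', ha2', hb2', hS⟩

/-! ### Binary trees -/

/-- Finite words on the alphabet `{0, 1}` (`false` is the letter `0`, `true` the letter `1`).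
The children of `u` are `u ++ [false]` and `u ++ [true]`; the depth of `u` is `u.length`. -/
abbrev Word : Type := List Bool

/-- The leaves of a tree: its nodes without descendants in the tree. -/
def boundary (T : Set Word) : Set Word := {u | u ∈ T ∧ ∀ v : Word, v ≠ [] → u ++ v ∉ T}

/-- The binary search tree process under the random permutation model: the Markov chain on
trees that starts from the tree reduced to its root and in which, given the trees up to time
`n`, each of the `n + 1` leaves of the current tree is the one that receives two children with
probability `1 / (n + 1)`. -/
def IsBSTProcess {Ω : Type*} [MeasurableSpace Ω] (μ : Measure Ω) (T : ℕ → Ω → Set Word) : Prop :=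
  (∀ᵐ ω ∂μ, T 0 ω = {[]}) ∧
  (∀ n : ℕ, ∀ᵐ ω ∂μ, (boundary (T n ω)).ncard = n + 1 ∧
    ∃ u ∈ boundary (T n ω), T (n + 1) ω = T n ω ∪ {u ++ [false], u ++ [true]}) ∧
  ∀ (n : ℕ) (t : ℕ → Set Word), ∀ u ∈ boundary (t n),
    μ {ω | (∀ j ≤ n, T j ω = t j) ∧ T (n + 1) ω = t n ∪ {u ++ [false], u ++ [true]}}
      = μ {ω | ∀ j ≤ n, T j ω = t j} / (n + 1)

/-! ### The Yule tree process

Everything is a function of the family `e` of the lifetimes: `e u` is the time that the fragment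
`I_u` (the individual `u`) lives before it splits into `I_{u0}` and `I_{u1}`. -/

/-- The time at which `u` appears: the sum of the lifetimes of its strict ancestors. -/
def birth (e : Word → ℝ) (u : Word) : ℝ := ∑ k ∈ Finset.range u.length, e (u.take k)

/-- The Yule tree at time `t`: all the nodes that have appeared by time `t`. -/
def tree (e : Word → ℝ) (t : ℝ) : Set Word := {u | birth e u ≤ t}

/-- The number `N_t` of leaves of the Yule tree at time `t`. -/
def numLeaves (e : Word → ℝ) (t : ℝ) : ℕ := (boundary (tree e t)).ncard

/-- The jump times `τ_n = inf {t ≥ 0 : N_t = n + 1}`. -/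
def jumpTime (e : Word → ℝ) (n : ℕ) : ℝ := sInf {t : ℝ | 0 ≤ t ∧ numLeaves e t = n + 1}

/-- The embedded binary search tree: the Yule tree at its `n`-th jump time. -/
def bst (e : Word → ℝ) (n : ℕ) : Set Word := tree e (jumpTime e n)

/-- The lifetimes in the subtree issued from `u`. -/
def shift (u : Word) (e : Word → ℝ) : Word → ℝ := fun v => e (u ++ v)

theorem birth_append (e : Word → ℝ) (u v : Word) :
    birth e (u ++ v) = birth e u + birth (shift u e) v := by
  unfold birth shift
  rw [List.length_append, Finset.sum_range_add]
  congr 1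
  · refine Finset.sum_congr rfl fun k hk => ?_
    rw [List.take_append_of_le_length (Finset.mem_range.1 hk).le]
  · refine Finset.sum_congr rfl fun k _ => ?_
    rw [List.take_length_add_append]

/-- The leaves at time `t` are the individuals alive at time `t`. -/
theorem mem_boundary_tree {e : Word → ℝ} (he : ∀ u, 0 ≤ e u) (t : ℝ) (u : Word) :
    u ∈ boundary (tree e t) ↔ birth e u ≤ t ∧ t < birth e u + e u := by
  have hone : ∀ b : Bool, birth e (u ++ [b]) = birth e u + e u := by
    intro b
    rw [birth_append]; simp [birth, shift]
  constructor
  · rintro ⟨h1, h2⟩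
    refine ⟨h1, ?_⟩
    have := h2 [false] (by simp)
    rw [tree, Set.mem_ofPred_eq, hone, not_le] at this
    exact this
  · rintro ⟨h1, h2⟩
    refine ⟨h1, fun v hv hmem => ?_⟩
    rcases v with _ | ⟨b, w⟩
    · exact hv rfl
    · have h3 : birth e (u ++ b :: w) = birth e (u ++ [b]) + birth (shift (u ++ [b]) e) w := by
        rw [← birth_append]; simp
      have h4 : 0 ≤ birth (shift (u ++ [b]) e) w := Finset.sum_nonneg fun k _ => he _
      have h5 : birth e (u ++ b :: w) ≤ t := hmem
      rw [hone] at h3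
      linarith

/-- The tree process growing from `u`, seen from the time at which `u` appears, is the Yule tree
process of the shifted lifetimes. -/
theorem subtree_eq (e : Word → ℝ) (u : Word) (t : ℝ) :
    {v : Word | u ++ v ∈ tree e (t + birth e u)} = tree (shift u e) t := by
  ext v
  simp only [tree, Set.mem_ofPred_eq, birth_append]
  constructor <;> intro h <;> linarith

/-! ### The martingales and their limits -/

/-- `∑_{u ∈ ∂T} z^{|u|}` for a finite tree `T`. -/
def levelPoly (T : Set Word) (z : ℝ) : ℝ := ∑ᶠ u ∈ boundary T, z ^ u.length

/-- The Yule martingale `M(t, z)`. -/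
def yuleM (z : ℝ) (e : Word → ℝ) (t : ℝ) : ℝ :=
  levelPoly (tree e t) z * Real.exp (t * (1 - 2 * z))

/-- The normalizing constant `C_n(z)`. -/
def bstC (n : ℕ) (z : ℝ) : ℝ := ∏ k ∈ Finset.range n, ((k : ℝ) + 2 * z) / ((k : ℝ) + 1)

/-- The BST martingale `𝓜_n(z)`. -/
def bstM (z : ℝ) (e : Word → ℝ) (n : ℕ) : ℝ := (bstC n z)⁻¹ * levelPoly (bst e n) z

/-- `ξ`, the limit of `exp (-t) N_t`. -/
def xi (e : Word → ℝ) : ℝ := limUnder atTop fun t : ℝ => Real.exp (-t) * (numLeaves e t : ℝ)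

/-- `M(∞, z)`, the limit of `M(t, z)`. -/
def yuleMInf (z : ℝ) (e : Word → ℝ) : ℝ := limUnder atTop fun t : ℝ => yuleM z e t

/-- `𝓜_∞(z)`, the limit of `𝓜_n(z)`. -/
def bstMInf (z : ℝ) (e : Word → ℝ) : ℝ := limUnder atTop fun n : ℕ => bstM z e n

/-- `U = ξ_0 / (ξ_0 + ξ_1)`, where `ξ_0`, `ξ_1` are the variables `ξ` of the two subtrees issued
from the children of the root. -/
def splitU (e : Word → ℝ) : ℝ :=
  xi (shift [false] e) / (xi (shift [false] e) + xi (shift [true] e))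

end

end YuleBST

open YuleBST

namespace YuleBST

/-! ### Exponential clocks -/

/-! The lifetimes have the product law `clockLaw Word`. Everything is proved under that law and
carried to the given probability space at the end. The Yule tree is read as a discrete dynamics
`split` on pairs (leaves, residual lifetimes): the leaf whose clock rings first is replaced by its
children, and the same time elapses on all the clocks of the leaves. By lack of memory, the first of
`#L` clocks to ring is uniform, the time of that ring is exponential of parameter `#L`, the two are
independent, and the other clocks start afresh (`clockLaw_first_ring`). Iterating gives
`clockLaw_history_waitAt`: the sequence of splits is independent of the sequence of waiting times,
and both laws are explicit. When lifetimes are positive and no two individuals split together, which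
is almost sure, this dynamics is the Yule tree observed at its jump times (`describes_leavesAt`).
Hence the embedded trees depend on the splits only, and the times `τ_n` on the waiting times only;
the binary search tree property follows.

Both sequences of limits come from nonnegative martingales. The normalized level polynomial is a
martingale in the splits, and `(n + 1) exp (-τ_n)` is a product of independent factors of mean one.
The explicit law `P(τ_n ≤ t) = (1 - exp (-t)) ^ n` shows that the second limit, which is `ξ`, is
Exp(1) (`hasLaw_waitLimit`). Only almost sure convergence is used, so no uniform integrability
enters.

For `τ_n ≤ t < τ_{n+1}` one has `M(t, z) = ((n + 1) exp (-t)) ^ (2z - 1) * (C_n(z) / (n + 1) ^ (2z -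
1)) * 𝓜_n(z)`, and Euler's formula for `Γ` gives the limit of the middle factor. This is the limit
martingale connection (`tendsto_yuleM`).

The Yule splitting formula is the decomposition of the tree at the first split. At `z = 1` it reads
`ξ = exp (-τ_1) (ξ_0 + ξ_1)`; inserting this in the connection, for the tree and for its two
subtrees, gives the splitting formula for the search tree. For the independence there, the two
subtrees use disjoint clocks, and inside each subtree `ξ` is a function of the waiting times and
`𝓜_∞` of the splits. So `ξ_0, ξ_1, 𝓜_(0), 𝓜_(1)` are independent, and `U` is a function of the first
two (`iIndepFun_splitUVersion`). -/

instance isProbabilityMeasure_expMeasure_natCast_add_one (n : ℕ) :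
    IsProbabilityMeasure (expMeasure ((n : ℝ) + 1)) :=
  isProbabilityMeasure_expMeasure (by positivity)

instance isProbabilityMeasure_expMeasure_one : IsProbabilityMeasure (expMeasure 1) :=
  isProbabilityMeasure_expMeasure one_pos

theorem expMeasure_eq_withDensity (a : ℝ) :
    expMeasure a = volume.withDensity (exponentialPDF a) := rfl

theorem measurable_exponentialPDF (a : ℝ) : Measurable (exponentialPDF a) :=
  (measurable_exponentialPDFReal a).ennreal_ofReal

instance nullSingletonClass_expMeasure (a : ℝ) : NullSingletonClass (expMeasure a) := by
  rw [expMeasure_eq_withDensity]; infer_instance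

theorem expMeasure_apply (a : ℝ) {s : Set ℝ} (hs : MeasurableSet s) :
    expMeasure a s = ∫⁻ y in s, exponentialPDF a y := by
  rw [expMeasure_eq_withDensity, withDensity_apply _ hs]

theorem expMeasure_Iic_zero (a : ℝ) : expMeasure a (Set.Iic 0) = 0 := by
  rw [← Iio_ae_eq_Iic.measure_eq, expMeasure_apply _ measurableSet_Iio]
  exact lintegral_exponentialPDF_of_nonpos le_rfl

theorem ae_pos_expMeasure (a : ℝ) : ∀ᵐ y ∂expMeasure a, 0 < y := by
  rw [ae_iff]; simpa [Set.Iic] using expMeasure_Iic_zero a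

/-- Lack of memory of the exponential law. -/
theorem expMeasure_one_shift {x : ℝ} (hx : 0 ≤ x) {A : Set ℝ} (hA : MeasurableSet A) :
    expMeasure 1 {y | x < y ∧ y - x ∈ A} = ENNReal.ofReal (Real.exp (-x)) * expMeasure 1 A := by
  have hm : MeasurableSet {y : ℝ | x < y ∧ y - x ∈ A} :=
    (measurableSet_lt measurable_const measurable_id).inter
      ((measurable_id.sub_const x) hA)
  -- The set on the left only involves the positive part of `A`, and the rest of `A` is null. With
  -- this reduction, translating by `x` turns the claim into a pointwise identity of densities.
  have hA' : expMeasure 1 A = expMeasure 1 (A ∩ Set.Ioi 0) := by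
    refine measure_congr ?_
    filter_upwards [ae_pos_expMeasure 1] with y hy
    apply propext
    change y ∈ A ↔ y ∈ A ∩ Set.Ioi 0
    exact ⟨fun h => ⟨h, hy⟩, fun h => h.1⟩
  rw [hA', expMeasure_apply _ hm, expMeasure_apply _ (hA.inter measurableSet_Ioi),
    ← lintegral_indicator hm, ← lintegral_indicator (hA.inter measurableSet_Ioi),
    ← lintegral_const_mul' _ _ ENNReal.ofReal_ne_top,
    ← lintegral_add_right_eq_self (μ := volume) _ x]
  refine lintegral_congr fun y => ?_
  by_cases h : y ∈ A ∩ Set.Ioi 0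
  · rw [Set.indicator_of_mem h, Set.indicator_of_mem, exponentialPDF_of_nonneg,
      exponentialPDF_of_nonneg (le_of_lt h.2), ← ENNReal.ofReal_mul (Real.exp_nonneg _)]
    · congr 1
      rw [one_mul, one_mul, one_mul, one_mul, neg_add, Real.exp_add, mul_comm]
    · have := h.2; simp only [Set.mem_Ioi] at this; linarith
    · refine ⟨?_, ?_⟩
      · have := h.2; simp only [Set.mem_Ioi] at this; linarith
      · simpa using h.1
  · rw [Set.indicator_of_notMem h, Set.indicator_of_notMem, mul_zero]
    rintro ⟨h1, h2⟩
    refine h ⟨by simpa using h2, ?_⟩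
    simp only [Set.mem_Ioi]; linarith

/-- Multiplying the Exp(1) density by `exp (-c y)` gives the Exp(c + 1) density up to the factor `1
/ (c + 1)`. When `c` is an integer, the weight is the probability that `c` other clocks are still
running at time `y`. -/
theorem lintegral_exp_neg_mul_expMeasure_of_nonneg {c : ℝ} (hc : 0 ≤ c) {B : Set ℝ}
    (hB : MeasurableSet B) :
    ∫⁻ y in B, ENNReal.ofReal (Real.exp (-(c * y))) ∂expMeasure 1
      = ENNReal.ofReal (c + 1)⁻¹ * expMeasure (c + 1) B := by
  have hme : Measurable fun y : ℝ => ENNReal.ofReal (Real.exp (-(c * y))) := by fun_prop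
  rw [expMeasure_eq_withDensity 1, restrict_withDensity hB,
    lintegral_withDensity_eq_lintegral_mul _ (measurable_exponentialPDF 1) hme,
    expMeasure_apply _ hB, ← lintegral_const_mul' _ _ ENNReal.ofReal_ne_top]
  refine lintegral_congr fun y => ?_
  rcases lt_or_ge y 0 with hy | hy
  · simp [exponentialPDF_of_neg hy]
  · rw [Pi.mul_apply, exponentialPDF_of_nonneg hy, exponentialPDF_of_nonneg hy,
      ← ENNReal.ofReal_mul (by positivity), ← ENNReal.ofReal_mul (by positivity)]
    congr 1
    rw [inv_mul_cancel_left₀ (by positivity), one_mul, one_mul, ← Real.exp_add]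
    congr 1; ring

theorem lintegral_exp_neg_mul_expMeasure (m : ℕ) {B : Set ℝ} (hB : MeasurableSet B) :
    ∫⁻ y in B, ENNReal.ofReal (Real.exp (-(m * y))) ∂expMeasure 1
      = ((m : ENNReal) + 1)⁻¹ * expMeasure ((m : ℝ) + 1) B := by
  have hc : ((m : ENNReal) + 1)⁻¹ = ENNReal.ofReal ((m : ℝ) + 1)⁻¹ := by
    rw [ENNReal.ofReal_inv_of_pos (by positivity), ENNReal.ofReal_add (by positivity) one_pos.le]
    simp
  rw [hc, lintegral_exp_neg_mul_expMeasure_of_nonneg m.cast_nonneg hB]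

/-- The law of a family of independent `Exp(1)` clocks. -/
noncomputable def clockLaw (ι : Type*) : Measure (ι → ℝ) :=
  Measure.infinitePi fun _ : ι => expMeasure 1

instance isProbabilityMeasure_clockLaw (ι : Type*) : IsProbabilityMeasure (clockLaw ι) := by
  unfold clockLaw; infer_instance

section Clocks

variable {ι : Type*}

theorem clockLaw_eval (v : ι) : MeasurePreserving (fun r : ι → ℝ => r v) (clockLaw ι)
    (expMeasure 1) :=
  measurePreserving_eval_infinitePi _ v

/-- Pads a cylinder with trivial constraints, so that its index set contains the clocks about to be
modified. -/
theorem pi_eq_pi_union [DecidableEq ι] (s S : Finset ι) (t : ι → Set ℝ) :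
    (Set.pi (s : Set ι) t) =
      Set.pi ((s ∪ S : Finset ι) : Set ι) (fun w => if w ∈ s then t w else Set.univ) := by
  ext r
  simp only [Set.mem_pi, Finset.mem_coe, Finset.mem_union]
  constructor
  · intro h w _
    split_ifs with hw
    · exact h w hw
    · trivial
  · intro h w hw
    simpa [hw] using h w (Or.inl hw)

theorem prod_expMeasure_union [DecidableEq ι] (s S : Finset ι) (t : ι → Set ℝ) :
    ∏ w ∈ s ∪ S, expMeasure 1 (if w ∈ s then t w else Set.univ) = ∏ w ∈ s, expMeasure 1 (t w) := by
  rw [← Finset.prod_subset Finset.subset_union_left]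
  · exact Finset.prod_congr rfl fun w hw => by simp [hw]
  · intro w _ hw; simp [hw]

/-- Letting time `x` pass on the finitely many clocks in `S`. -/
noncomputable def elapse [DecidableEq ι] (S : Finset ι) (x : ℝ) (r : ι → ℝ) : ι → ℝ :=
  fun w => if w ∈ S then r w - x else r w

theorem measurable_elapse [DecidableEq ι] (S : Finset ι) (x : ℝ) :
    Measurable (elapse S x : (ι → ℝ) → ι → ℝ) := by
  refine measurable_pi_lambda _ fun w => ?_
  unfold elapse
  split_ifs <;> fun_prop

/-- Lack of memory for finitely many clocks in a family of independent exponential clocks. -/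
theorem clockLaw_elapse [DecidableEq ι] (S : Finset ι) {x : ℝ} (hx : 0 ≤ x) {A : Set (ι → ℝ)}
    (hA : MeasurableSet A) :
    clockLaw ι {r | (∀ w ∈ S, x < r w) ∧ elapse S x r ∈ A}
      = ENNReal.ofReal (Real.exp (-(S.card * x))) * clockLaw ι A := by
  set c : ENNReal := ENNReal.ofReal (Real.exp (-x)) ^ S.card with hc
  have hc' : ENNReal.ofReal (Real.exp (-(S.card * x))) = c := by
    rw [hc, ← ENNReal.ofReal_pow (Real.exp_nonneg _), ← Real.exp_nat_mul]; congr 2; ring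
  have hc0 : c ≠ 0 := by
    rw [← hc']; simp [Real.exp_pos]
  have hct : c ≠ ⊤ := by rw [← hc']; exact ENNReal.ofReal_ne_top
  -- `c` is the probability that all the clocks in `S` survive time `x`. The conditional law of the
  -- elapsed clocks given survival is checked on cylinders, one coordinate at a time.
  have key : c⁻¹ • ((clockLaw ι).restrict {r | ∀ w ∈ S, x < r w}).map (elapse S x)
      = clockLaw ι := by
    refine Measure.eq_infinitePi _ fun s t ht => ?_
    rw [Measure.smul_apply, Measure.map_apply (measurable_elapse S x)
      (MeasurableSet.pi (Finset.countable_toSet s) fun w _ => ht w),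
      Measure.restrict_apply (measurable_elapse S x
        (MeasurableSet.pi (Finset.countable_toSet s) fun w _ => ht w))]
    set T : ι → Set ℝ := fun w => if w ∈ s then t w else Set.univ with hT
    have hTm : ∀ w, MeasurableSet (T w) := fun w => by
      simp only [hT]; split_ifs
      · exact ht w
      · exact MeasurableSet.univ
    have hset : elapse S x ⁻¹' (Set.pi (s : Set ι) t) ∩ {r | ∀ w ∈ S, x < r w}
        = Set.pi ((s ∪ S : Finset ι) : Set ι)
          (fun w => if w ∈ S then {y | x < y ∧ y - x ∈ T w} else T w) := by
      rw [pi_eq_pi_union s S t]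
      ext r
      simp only [Set.mem_inter_iff, Set.mem_preimage, Set.mem_pi, Finset.mem_coe,
        Set.mem_ofPred_eq, Finset.mem_union, elapse]
      constructor
      · rintro ⟨h1, h2⟩ w hw
        have h1w := h1 w hw
        by_cases hwS : w ∈ S
        · simp only [hwS, if_true] at h1w ⊢
          exact ⟨h2 w hwS, h1w⟩
        · simpa only [hwS, if_false] using h1w
      · intro h
        refine ⟨fun w hw => ?_, fun w hw => ?_⟩
        · have := h w hw
          by_cases hwS : w ∈ S
          · simp only [hwS, if_true] at this ⊢
            exact this.2
          · simpa only [hwS, if_false] using this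
        · have := h w (Or.inr hw)
          simp only [hw, if_true] at this
          exact this.1
    rw [hset, clockLaw, Measure.infinitePi_pi]
    swap
    · intro w _
      split_ifs
      · exact (measurableSet_lt measurable_const measurable_id).inter
          ((measurable_id.sub_const x) (hTm w))
      · exact hTm w
    have : ∀ w ∈ s ∪ S, expMeasure 1 (if w ∈ S then {y | x < y ∧ y - x ∈ T w} else T w)
        = (if w ∈ S then ENNReal.ofReal (Real.exp (-x)) else 1) * expMeasure 1 (T w) := by
      intro w _
      split_ifs
      · exact expMeasure_one_shift hx (hTm w)
      · rw [one_mul]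
    rw [Finset.prod_congr rfl this, Finset.prod_mul_distrib, prod_expMeasure_union,
      Finset.prod_ite_mem, Finset.inter_eq_right.2 Finset.subset_union_right, Finset.prod_const,
      smul_eq_mul, ← hc, ← mul_assoc, ENNReal.inv_mul_cancel hc0 hct, one_mul]
  have := congrArg (fun ν => c * ν A) key
  simp only [Measure.smul_apply, smul_eq_mul, ← mul_assoc, ENNReal.mul_inv_cancel hc0 hct,
    one_mul] at this
  rw [Measure.map_apply (measurable_elapse S x) hA,
    Measure.restrict_apply (measurable_elapse S x hA)] at this
  rw [hc', ← this]
  congr 1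
  ext r
  simp only [Set.mem_ofPred_eq, Set.mem_inter_iff, Set.mem_preimage]
  exact and_comm

/-- Resampling one clock does not change the law. -/
theorem measurePreserving_update [DecidableEq ι] (v : ι) :
    MeasurePreserving (fun p : ℝ × (ι → ℝ) => Function.update p.2 v p.1)
      ((expMeasure 1).prod (clockLaw ι)) (clockLaw ι) := by
  have hm : Measurable (fun p : ℝ × (ι → ℝ) => Function.update p.2 v p.1) := by
    refine measurable_pi_lambda _ fun w => ?_
    by_cases h : w = v
    · subst h; simpa using measurable_fst
    · simp only [Function.update_of_ne h]; fun_prop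
  refine ⟨hm, ?_⟩
  refine Measure.eq_infinitePi _ fun s t ht => ?_
  rw [Measure.map_apply hm (MeasurableSet.pi (Finset.countable_toSet s) fun w _ => ht w)]
  set T : ι → Set ℝ := fun w => if w ∈ s then t w else Set.univ with hT
  have hTm : ∀ w, MeasurableSet (T w) := fun w => by
    simp only [hT]; split_ifs
    · exact ht w
    · exact MeasurableSet.univ
  have hset : (fun p : ℝ × (ι → ℝ) => Function.update p.2 v p.1) ⁻¹' (Set.pi (s : Set ι) t)
      = T v ×ˢ Set.pi (((s ∪ {v}).erase v : Finset ι) : Set ι) T := by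
    rw [pi_eq_pi_union s {v} t]
    ext p
    simp only [Set.mem_preimage, Set.mem_pi, Finset.mem_coe, Set.mem_prod, Finset.mem_erase]
    constructor
    · intro h
      refine ⟨by simpa only [Function.update_self] using h v (by simp), fun w hw => ?_⟩
      simpa only [Function.update_of_ne hw.1] using h w hw.2
    · rintro ⟨h1, h2⟩ w hw
      by_cases hwv : w = v
      · subst hwv; simpa only [Function.update_self] using h1
      · simpa only [Function.update_of_ne hwv] using h2 w ⟨hwv, hw⟩
  rw [hset, Measure.prod_prod, clockLaw, Measure.infinitePi_pi _ fun w _ => hTm w,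
    Finset.mul_prod_erase (s ∪ {v}) (fun w => expMeasure 1 (T w)) (by simp),
    prod_expMeasure_union]

/-- Fubini after resampling: this is conditioning on the value of the clock `v`. -/
theorem clockLaw_apply_update [DecidableEq ι] (v : ι) {A : Set (ι → ℝ)} (hA : MeasurableSet A) :
    clockLaw ι A = ∫⁻ y, clockLaw ι {r | Function.update r v y ∈ A} ∂expMeasure 1 := by
  conv_lhs => rw [← (measurePreserving_update v).map_eq]
  rw [Measure.map_apply (measurePreserving_update v).measurable hA,
    Measure.prod_apply ((measurePreserving_update v).measurable hA)]
  rfl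

theorem ae_pos_clockLaw [Countable ι] : ∀ᵐ r ∂clockLaw ι, ∀ w, 0 < r w := by
  rw [ae_all_iff]
  exact fun w => (clockLaw_eval w).quasiMeasurePreserving.ae (ae_pos_expMeasure 1)

/-- A clock almost surely differs from a function of the other clocks. -/
theorem ae_ne_of_update_eq [DecidableEq ι] (v : ι) {f g : (ι → ℝ) → ℝ} (hf : Measurable f)
    (hg : Measurable g) (hfu : ∀ r y, f (Function.update r v y) = f r)
    (hgu : ∀ r y, g (Function.update r v y) = g r) :
    ∀ᵐ r ∂clockLaw ι, f r + r v ≠ g r := by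
  have hm : MeasurableSet {r : ι → ℝ | f r + r v = g r} :=
    measurableSet_eq_fun (hf.add (measurable_pi_apply v)) hg
  rw [ae_iff]
  simp only [not_not]
  conv_lhs => rw [← (measurePreserving_update v).map_eq]
  rw [Measure.map_apply (measurePreserving_update v).measurable hm,
    Measure.prod_apply_symm ((measurePreserving_update v).measurable hm), lintegral_eq_zero_iff']
  · refine Eventually.of_forall fun r => ?_
    -- With the other clocks frozen, a single value of the clock `v` is bad, and Exp(1) has no
    -- atoms.
    have : ((fun y => (y, r)) ⁻¹' ((fun p : ℝ × (ι → ℝ) => Function.update p.2 v p.1) ⁻¹'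
        {r | f r + r v = g r})) ⊆ {g r - f r} := by
      intro y hy
      simp only [Set.mem_preimage, Set.mem_ofPred_eq, hfu, hgu, Function.update_self] at hy
      simp only [Set.mem_singleton_iff]; linarith
    exact measure_mono_null this (measure_singleton _)
  · exact (measurable_measure_prodMk_right
      ((measurePreserving_update v).measurable hm)).aemeasurable

/-- The first ring among the clocks in `L`: the clock that rings first is uniform, the time of the
first ring is exponential of parameter `#L`, and the remaining clocks start afresh. -/
theorem clockLaw_first_ring [DecidableEq ι] {L : Finset ι} {v : ι} (hv : v ∈ L) {B : Set ℝ}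
    (hB : MeasurableSet B) {A : Set (ι → ℝ)} (hA : MeasurableSet A)
    (hAv : ∀ r y, Function.update r v y ∈ A ↔ r ∈ A) :
    clockLaw ι {r | (∀ w ∈ L.erase v, r v < r w) ∧ r v ∈ B ∧ elapse L (r v) r ∈ A}
      = (L.card : ENNReal)⁻¹ * (expMeasure L.card B * clockLaw ι A) := by
  have hel : Measurable fun r : ι → ℝ => elapse L (r v) r := by
    refine measurable_pi_lambda _ fun w => ?_
    unfold elapse
    split_ifs
    · exact (measurable_pi_apply w).sub (measurable_pi_apply v)
    · exact measurable_pi_apply w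
  have hm : MeasurableSet
      {r : ι → ℝ | (∀ w ∈ L.erase v, r v < r w) ∧ r v ∈ B ∧ elapse L (r v) r ∈ A} := by
    refine MeasurableSet.inter ?_ ((measurable_pi_apply v hB).inter (hel hA))
    have : {r : ι → ℝ | ∀ w ∈ L.erase v, r v < r w} = ⋂ w ∈ L.erase v, {r | r v < r w} := by
      ext; simp
    refine (congrArg MeasurableSet this).mpr ?_
    exact Finset.measurableSet_biInter _ fun w _ =>
      measurableSet_lt (measurable_pi_apply v) (measurable_pi_apply w)
  have hcard : (L.erase v).card + 1 = L.card := Finset.card_erase_add_one hv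
  rw [clockLaw_apply_update v hm]
  -- Given that the clock `v` rings at `y`, the other clocks in `L` must survive `y`; lack of memory
  -- applies to `L.erase v`.
  have h1 : ∀ᵐ y ∂expMeasure 1, clockLaw ι {r | Function.update r v y ∈
      {r : ι → ℝ | (∀ w ∈ L.erase v, r v < r w) ∧ r v ∈ B ∧ elapse L (r v) r ∈ A}}
      = B.indicator (fun y => ENNReal.ofReal (Real.exp (-((L.erase v).card * y)))) y
        * clockLaw ι A := by
    filter_upwards [ae_pos_expMeasure 1] with y hy
    by_cases hyB : y ∈ B
    · rw [Set.indicator_of_mem hyB, ← clockLaw_elapse (L.erase v) hy.le hA]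
      congr 1
      ext r
      -- Elapsing on `L` rather than on `L.erase v` affects only the coordinate `v`, which `A`
      -- ignores by `hAv`.
      have h2 : elapse L y (Function.update r v y)
          = Function.update (elapse (L.erase v) y r) v 0 := by
        funext w
        by_cases hwv : w = v
        · subst hwv; simp [elapse, hv]
        · simp [elapse, hwv]
      simp only [Set.mem_ofPred_eq, Function.update_self, hyB, true_and, h2, hAv]
      refine and_congr_left fun _ => forall₂_congr fun w hw => ?_
      rw [Function.update_of_ne (Finset.ne_of_mem_erase hw)]
    · rw [Set.indicator_of_notMem hyB, zero_mul]
      simp [hyB]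
  rw [lintegral_congr_ae h1, lintegral_mul_const' _ _ (measure_ne_top _ _),
    lintegral_indicator hB, lintegral_exp_neg_mul_expMeasure _ hB, ← hcard, mul_assoc]
  push_cast
  rfl

end Clocks

/-! ### The splitting dynamics on leaves carrying residual lifetimes -/

instance : MeasurableSpace (List Bool) := ⊤
instance : MeasurableSpace (List (List Bool)) := ⊤
instance : DiscreteMeasurableSpace (List Bool) := ⟨fun _ => trivial⟩
instance : DiscreteMeasurableSpace (List (List Bool)) := ⟨fun _ => trivial⟩

/-- Replacing the leaf `v` by its two children. -/
def splitLeaf (L : Finset Word) (v : Word) : Finset Word :=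
  L.erase v ∪ {v ++ [false], v ++ [true]}

/-- The leaves obtained from `L` by successive splits. -/
def leavesAfter (L : Finset Word) (l : List Word) : Finset Word := l.foldl splitLeaf L

/-- Nonempty finite sets of words none of which is a prefix of another one. -/
def IsFront (L : Finset Word) : Prop :=
  L.Nonempty ∧ ∀ v ∈ L, ∀ w ∈ L, v <+: w → v = w

theorem mem_splitLeaf' {L : Finset Word} {v w : Word} :
    w ∈ splitLeaf L v ↔ (w ≠ v ∧ w ∈ L) ∨ ∃ b : Bool, w = v ++ [b] := by
  simp [splitLeaf]; tauto

theorem splitLeaf_nonempty (L : Finset Word) (v : Word) : (splitLeaf L v).Nonempty :=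
  ⟨v ++ [false], by simp [splitLeaf]⟩

theorem isFront_root : IsFront {[]} := by
  refine ⟨⟨[], by simp⟩, ?_⟩
  simp

theorem IsFront.child_notMem {L : Finset Word} (hL : IsFront L) {v : Word} (hv : v ∈ L)
    (b : Bool) : v ++ [b] ∉ L := fun h => by
  have := hL.2 v hv _ h (List.prefix_append v [b])
  simp at this

theorem IsFront.splitLeaf {L : Finset Word} (hL : IsFront L) {v : Word} (hv : v ∈ L) :
    IsFront (splitLeaf L v) := by
  refine ⟨splitLeaf_nonempty L v, fun a ha b hb hab => ?_⟩
  rw [mem_splitLeaf'] at ha hb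
  rcases ha with ⟨hav, ha⟩ | ⟨i, rfl⟩ <;> rcases hb with ⟨hbv, hb⟩ | ⟨j, rfl⟩
  · exact hL.2 a ha b hb hab
  · rcases List.prefix_concat_iff.1 hab with h | h
    · exact h
    · exact absurd (hL.2 a ha v hv h) hav
  · exact absurd (hL.2 v hv b hb ((List.prefix_append v [i]).trans hab)).symm hbv
  · exact hab.eq_of_length (by simp)

theorem IsFront.card_splitLeaf {L : Finset Word} (hL : IsFront L) {v : Word} (hv : v ∈ L) :
    (YuleBST.splitLeaf L v).card = L.card + 1 := by
  unfold YuleBST.splitLeaf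
  rw [Finset.card_union_of_disjoint, Finset.card_pair (by simp), Finset.card_erase_of_mem hv]
  · have := Finset.card_pos.2 ⟨v, hv⟩; omega
  · rw [Finset.disjoint_left]
    intro a ha h
    have ha := Finset.mem_of_mem_erase ha
    simp only [Finset.mem_insert, Finset.mem_singleton] at h
    rcases h with rfl | rfl
    · exact hL.child_notMem hv _ ha
    · exact hL.child_notMem hv _ ha

/-! ### A split as a measurable map on leaves and residual clocks -/

noncomputable section

open scoped Classical in
/-- The elements of `L` whose clock rings first. -/
def minimizers (L : Finset Word) (r : Word → ℝ) : Finset Word :=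
  {v ∈ L | ∀ w ∈ L, r v ≤ r w}

open scoped Classical in
/-- An arbitrary element of a finite set of words. -/
def pick (S : Finset Word) : Word := if h : S.Nonempty then h.choose else []

/-- An element of `L` whose clock rings first. -/
def firstRing (L : Finset Word) (r : Word → ℝ) : Word := pick (minimizers L r)

/-- One split: the leaf whose clock rings first is replaced by its children. -/
def split (s : Finset Word × (Word → ℝ)) : Finset Word × (Word → ℝ) :=
  (splitLeaf s.1 (firstRing s.1 s.2), elapse s.1 (s.2 (firstRing s.1 s.2)) s.2)

/-- The leaf involved in the `n`-th split. -/
def splitAt (n : ℕ) (s : Finset Word × (Word → ℝ)) : Word :=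
  firstRing (split^[n] s).1 (split^[n] s).2

/-- The waiting time before the `n`-th split. -/
def waitAt (n : ℕ) (s : Finset Word × (Word → ℝ)) : ℝ := (split^[n] s).2 (splitAt n s)

/-- The first `n` leaves that are split. -/
def history (n : ℕ) (s : Finset Word × (Word → ℝ)) : List Word :=
  (List.range n).map fun k => splitAt k s

theorem minimizers_nonempty {L : Finset Word} (hL : L.Nonempty) (r : Word → ℝ) :
    (minimizers L r).Nonempty := by
  obtain ⟨v, hv, h⟩ := Finset.exists_min_image L r hL
  exact ⟨v, by simp only [minimizers, Finset.mem_filter]; exact ⟨hv, h⟩⟩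

theorem firstRing_mem_minimizers {L : Finset Word} (hL : L.Nonempty) (r : Word → ℝ) :
    firstRing L r ∈ minimizers L r := by
  unfold firstRing pick
  rw [dif_pos (minimizers_nonempty hL r)]
  exact (minimizers_nonempty hL r).choose_spec

theorem firstRing_mem {L : Finset Word} (hL : L.Nonempty) (r : Word → ℝ) :
    firstRing L r ∈ L :=
  (Finset.mem_filter.1 (firstRing_mem_minimizers hL r)).1

theorem firstRing_le {L : Finset Word} (r : Word → ℝ) {w : Word} (hw : w ∈ L) :
    r (firstRing L r) ≤ r w :=
  (Finset.mem_filter.1 (firstRing_mem_minimizers ⟨w, hw⟩ r)).2 w hw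

theorem split_iterate_nonempty {s : Finset Word × (Word → ℝ)} (hs : s.1.Nonempty) (n : ℕ) :
    (split^[n] s).1.Nonempty := by
  cases n with
  | zero => exact hs
  | succ n => rw [Function.iterate_succ_apply']; exact splitLeaf_nonempty _ _

theorem waitAt_succ (n : ℕ) (s : Finset Word × (Word → ℝ)) :
    waitAt (n + 1) s = waitAt n (split s) := rfl

theorem history_succ (n : ℕ) (s : Finset Word × (Word → ℝ)) :
    history (n + 1) s = firstRing s.1 s.2 :: history n (split s) := by
  unfold history
  rw [List.range_succ_eq_map, List.map_cons, List.map_map]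
  rfl

theorem history_succ' (n : ℕ) (s : Finset Word × (Word → ℝ)) :
    history (n + 1) s = history n s ++ [splitAt n s] := by
  simp [history, List.range_succ]

theorem length_history (n : ℕ) (s : Finset Word × (Word → ℝ)) : (history n s).length = n := by
  simp [history]

theorem split_iterate_fst (n : ℕ) (s : Finset Word × (Word → ℝ)) :
    (split^[n] s).1 = leavesAfter s.1 (history n s) := by
  induction n generalizing s with
  | zero => rfl
  | succ n ih => rw [Function.iterate_succ_apply, ih, history_succ]; rfl

theorem measurable_minimizers (L : Finset Word) : Measurable (minimizers L) := by
  refine measurable_to_countable' fun S => ?_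
  have : minimizers L ⁻¹' {S} = ⋂ v : Word, {r | (v ∈ L ∧ ∀ w ∈ L, r v ≤ r w) ↔ v ∈ S} := by
    ext r
    simp [minimizers, Finset.ext_iff]
  rw [this]
  refine MeasurableSet.iInter fun v => ?_
  have hv : MeasurableSet {r : Word → ℝ | v ∈ L ∧ ∀ w ∈ L, r v ≤ r w} := by
    refine (MeasurableSet.const _).inter ?_
    have : {r : Word → ℝ | ∀ w ∈ L, r v ≤ r w} = ⋂ w ∈ L, {r | r v ≤ r w} := by
      ext; simp
    refine (congrArg MeasurableSet this).mpr ?_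
    exact Finset.measurableSet_biInter _ fun w _ =>
      measurableSet_le (measurable_pi_apply v) (measurable_pi_apply w)
  by_cases hS : v ∈ S
  · simpa [hS] using hv
  · simp only [hS, iff_false]; exact hv.compl

/-- Breaking ties by an arbitrary choice is harmless: the choice is applied to the set of
minimizers, a measurable map into a countable type. -/
theorem measurable_firstRing :
    Measurable fun s : Finset Word × (Word → ℝ) => firstRing s.1 s.2 :=
  measurable_from_prod_countable_right fun L =>
    (measurable_of_countable pick).comp (measurable_minimizers L)

theorem measurable_eval_word :
    Measurable fun p : (Word → ℝ) × Word => p.1 p.2 :=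
  measurable_from_prod_countable_left fun w => measurable_pi_apply w

theorem measurable_split_fst : Measurable fun s => (split s).1 := by
  have h : Measurable fun p : Finset Word × Word => splitLeaf p.1 p.2 :=
    measurable_from_prod_countable_right fun _ => measurable_of_countable _
  have h' : Measurable fun s : Finset Word × (Word → ℝ) => splitLeaf s.1 (firstRing s.1 s.2) := by
    have := h.comp (measurable_fst.prodMk measurable_firstRing)
    exact this
  exact h'

theorem measurable_split_snd : Measurable fun s => (split s).2 := by
  refine measurable_pi_lambda _ fun w => ?_
  have h2 : Measurable fun s : Finset Word × (Word → ℝ) => s.2 (firstRing s.1 s.2) :=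
    measurable_eval_word.comp (measurable_snd.prodMk measurable_firstRing)
  have h4 : Measurable fun s : Finset Word × (Word → ℝ) => s.2 w :=
    (measurable_pi_apply w).comp measurable_snd
  have h5 : MeasurableSet {s : Finset Word × (Word → ℝ) | w ∈ s.1} :=
    measurable_fst (measurableSet_mem_finset w)
  exact Measurable.ite h5 (h4.sub h2) h4

theorem measurable_split : Measurable split :=
  measurable_split_fst.prodMk measurable_split_snd

theorem measurable_splitAt (n : ℕ) : Measurable (splitAt n) :=
  measurable_firstRing.comp (measurable_split.iterate n)

theorem measurable_waitAt (n : ℕ) : Measurable (waitAt n) :=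
  measurable_eval_word.comp
    ((measurable_snd.comp (measurable_split.iterate n)).prodMk (measurable_splitAt n))

theorem measurable_history (n : ℕ) : Measurable (history n) := by
  induction n with
  | zero => exact measurable_const
  | succ n ih =>
    have : history (n + 1) = fun s => history n s ++ [splitAt n s] :=
      funext (history_succ' n)
    rw [this]
    exact (measurable_of_countable fun p : List Word × Word => p.1 ++ [p.2]).comp
      (ih.prodMk (measurable_splitAt n))

/-! ### Locality -/

/-- Two families of clocks that agree on the words with a prefix in `L`. -/
def AgreeBelow (L : Finset Word) (r r' : Word → ℝ) : Prop :=
  ∀ a ∈ L, ∀ x : Word, r (a ++ x) = r' (a ++ x)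

theorem AgreeBelow.eq {L : Finset Word} {r r' : Word → ℝ} (h : AgreeBelow L r r') {a : Word}
    (ha : a ∈ L) : r a = r' a := by
  simpa using h a ha []

theorem AgreeBelow.firstRing {L : Finset Word} {r r' : Word → ℝ} (h : AgreeBelow L r r') :
    firstRing L r = firstRing L r' := by
  unfold YuleBST.firstRing minimizers
  congr 1
  refine Finset.filter_congr fun v hv => forall₂_congr fun w hw => ?_
  rw [h.eq hv, h.eq hw]

/-- A split reads only the clocks of the leaves, and every new leaf extends an old one, so agreement
below the leaves persists. This serves to show that the evolution after `v` has split ignores the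
clock of `v`. -/
theorem AgreeBelow.split {L : Finset Word} (hL : L.Nonempty) {r r' : Word → ℝ}
    (h : AgreeBelow L r r') :
    (split (L, r)).1 = (split (L, r')).1 ∧
      AgreeBelow (split (L, r)).1 (split (L, r)).2 (split (L, r')).2 := by
  refine ⟨by simp only [YuleBST.split, h.firstRing], fun a ha x => ?_⟩
  have hax : r (a ++ x) = r' (a ++ x) := by
    rcases mem_splitLeaf'.1 ha with ⟨-, ha⟩ | ⟨b, rfl⟩
    · exact h a ha x
    · have := h _ (firstRing_mem hL r) ([b] ++ x)
      simpa using this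
  have hf : r (YuleBST.firstRing L r) = r' (YuleBST.firstRing L r') := by
    rw [← h.firstRing]; exact h.eq (firstRing_mem hL r)
  simp only [YuleBST.split, elapse, hax, hf]

theorem AgreeBelow.iterate {L : Finset Word} (hL : L.Nonempty) {r r' : Word → ℝ}
    (h : AgreeBelow L r r') (n : ℕ) :
    (YuleBST.split^[n] (L, r)).1 = (YuleBST.split^[n] (L, r')).1 ∧
      AgreeBelow (YuleBST.split^[n] (L, r)).1 (YuleBST.split^[n] (L, r)).2
        (YuleBST.split^[n] (L, r')).2 := by
  induction n with
  | zero => exact ⟨rfl, h⟩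
  | succ n ih =>
    rw [Function.iterate_succ_apply', Function.iterate_succ_apply']
    have := AgreeBelow.split (split_iterate_nonempty (s := (L, r)) hL n) ih.2
    have h1 : YuleBST.split ((YuleBST.split^[n] (L, r)).1, (YuleBST.split^[n] (L, r')).2)
        = YuleBST.split (YuleBST.split^[n] (L, r')) := by rw [ih.1]
    rwa [h1] at this

theorem AgreeBelow.splitAt {L : Finset Word} (hL : L.Nonempty) {r r' : Word → ℝ}
    (h : AgreeBelow L r r') (n : ℕ) : splitAt n (L, r) = splitAt n (L, r') := by
  obtain ⟨h1, h2⟩ := AgreeBelow.iterate hL h n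
  unfold YuleBST.splitAt
  rw [h2.firstRing, h1]

theorem AgreeBelow.waitAt {L : Finset Word} (hL : L.Nonempty) {r r' : Word → ℝ}
    (h : AgreeBelow L r r') (n : ℕ) : waitAt n (L, r) = waitAt n (L, r') := by
  unfold YuleBST.waitAt
  rw [← AgreeBelow.splitAt hL h n]
  exact (AgreeBelow.iterate hL h n).2.eq
    (firstRing_mem (split_iterate_nonempty (s := (L, r)) hL n) _)

theorem AgreeBelow.history {L : Finset Word} (hL : L.Nonempty) {r r' : Word → ℝ}
    (h : AgreeBelow L r r') (n : ℕ) : history n (L, r) = history n (L, r') :=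
  List.map_congr_left fun k _ => AgreeBelow.splitAt hL h k

/-! ### The law of the dynamics -/

/-- The probability that the successive splits from `L` are those listed in `l`. -/
def splitWeight : Finset Word → List Word → ENNReal
  | _, [] => 1
  | L, v :: l => if v ∈ L then (L.card : ENNReal)⁻¹ * splitWeight (splitLeaf L v) l else 0

theorem splitWeight_append (L : Finset Word) (l : List Word) (u : Word) :
    splitWeight L (l ++ [u]) = splitWeight L l *
      (if u ∈ leavesAfter L l then ((leavesAfter L l).card : ENNReal)⁻¹ else 0) := by
  induction l generalizing L with
  | nil => rw [List.nil_append, splitWeight, splitWeight, splitWeight, mul_one, one_mul]; rfl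
  | cons v l ih =>
    simp only [List.cons_append, splitWeight]
    rw [ih]
    split_ifs <;> simp_all [leavesAfter, mul_assoc]

theorem ae_injective_clockLaw : ∀ᵐ r ∂clockLaw Word, Function.Injective r := by
  have : ∀ᵐ r ∂clockLaw Word, ∀ v w : Word, v ≠ w → r v ≠ r w := by
    simp only [ae_all_iff]
    intro v w hvw
    have := ae_ne_of_update_eq (ι := Word) v (f := fun _ => 0) (g := fun r => r w)
      measurable_const (measurable_pi_apply w) (fun _ _ => rfl)
      (fun r y => Function.update_of_ne hvw.symm y r)
    simpa using this
  filter_upwards [this] with r hr v w h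
  by_contra hvw
  exact hr v w hvw h

theorem firstRing_eq_iff {L : Finset Word} {r : Word → ℝ} (hr : Function.Injective r) {v : Word}
    (hv : v ∈ L) : firstRing L r = v ↔ ∀ w ∈ L.erase v, r v < r w := by
  constructor
  · rintro rfl w hw
    obtain ⟨h1, h2⟩ := Finset.mem_erase.1 hw
    exact lt_of_le_of_ne (firstRing_le r h2) fun h => h1 (hr h).symm
  · intro h
    by_contra hne
    have := h (firstRing L r) (Finset.mem_erase.2 ⟨hne, firstRing_mem ⟨v, hv⟩ r⟩)
    exact absurd (firstRing_le r hv) (not_le.2 this)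

theorem measurableSet_history_waitAt (n : ℕ) (L : Finset Word) (l : List Word) {B : ℕ → Set ℝ}
    (hB : ∀ k, MeasurableSet (B k)) :
    MeasurableSet {r | history n (L, r) = l ∧ ∀ k < n, waitAt k (L, r) ∈ B k} := by
  have hL : Measurable fun r : Word → ℝ => (L, r) := measurable_const.prodMk measurable_id
  refine MeasurableSet.inter ?_ ?_
  · exact (measurable_history n).comp hL (MeasurableSet.singleton l)
  · have : {r : Word → ℝ | ∀ k < n, waitAt k (L, r) ∈ B k}
        = ⋂ k, ⋂ _ : k < n, {r | waitAt k (L, r) ∈ B k} := by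
      ext; simp
    refine (congrArg MeasurableSet this).mpr ?_
    exact MeasurableSet.iInter fun k => MeasurableSet.iInter fun _ =>
      (measurable_waitAt k).comp hL (hB k)

/-- The splits and the waiting times are independent; the leaf to be split is uniform among the
leaves, and the waiting times are independent exponential variables, of parameter the number of
leaves. -/
theorem clockLaw_history_waitAt (n : ℕ) {L : Finset Word} (hL : IsFront L) {l : List Word}
    (hl : l.length = n) {B : ℕ → Set ℝ} (hB : ∀ k, MeasurableSet (B k)) :
    clockLaw Word {r | history n (L, r) = l ∧ ∀ k < n, waitAt k (L, r) ∈ B k}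
      = splitWeight L l * ∏ k ∈ Finset.range n, expMeasure ((L.card + k : ℕ) : ℝ) (B k) := by
  induction n generalizing L l B with
  | zero =>
    obtain rfl := List.length_eq_zero_iff.1 hl
    simp [history, splitWeight]
  | succ n ih =>
    obtain ⟨v, l, rfl⟩ := List.exists_cons_of_length_eq_add_one hl
    have hl' : l.length = n := by simpa using hl
    by_cases hv : v ∈ L
    -- `A` is the event prescribed for the evolution after the first split, for fresh clocks.
    · set A : Set (Word → ℝ) := {r | history n (splitLeaf L v, r) = l ∧
        ∀ k < n, waitAt k (splitLeaf L v, r) ∈ B (k + 1)} with hA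
      -- No new leaf is a prefix of `v`: old leaves because `L` is a front, children because they
      -- are longer. So the clock `v` is never read again.
      have hAv : ∀ r y, Function.update r v y ∈ A ↔ r ∈ A := by
        intro r y
        have hag : AgreeBelow (splitLeaf L v) (Function.update r v y) r := by
          intro a ha x
          refine Function.update_of_ne (fun h => ?_) _ _
          have hpre : a <+: v := ⟨x, h⟩
          rcases mem_splitLeaf'.1 ha with ⟨hne, ha⟩ | ⟨b, rfl⟩
          · exact hne (hL.2 a ha v hv hpre)
          · have := hpre.length_le
            simp at this
        have hne := splitLeaf_nonempty L v
        simp only [hA, Set.mem_ofPred_eq, AgreeBelow.history hne hag, AgreeBelow.waitAt hne hag]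
      have hset : {r | history (n + 1) (L, r) = v :: l ∧ ∀ k < n + 1, waitAt k (L, r) ∈ B k}
          =ᵐ[clockLaw Word]
          {r | (∀ w ∈ L.erase v, r v < r w) ∧ r v ∈ B 0 ∧ elapse L (r v) r ∈ A} := by
        filter_upwards [ae_injective_clockLaw] with r hr
        apply propext
        change (history (n + 1) (L, r) = v :: l ∧ ∀ k < n + 1, waitAt k (L, r) ∈ B k) ↔
          ((∀ w ∈ L.erase v, r v < r w) ∧ r v ∈ B 0 ∧ elapse L (r v) r ∈ A)
        rw [← firstRing_eq_iff hr hv, history_succ, List.cons.injEq]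
        by_cases hf : firstRing L r = v
        · have hs : split (L, r) = (splitLeaf L v, elapse L (r v) r) := by
            simp only [split, hf]
          have h0 : waitAt 0 (L, r) = r v := by
            simp only [waitAt, splitAt, Function.iterate_zero, id, hf]
          simp only [hf, true_and, hs, hA, Set.mem_ofPred_eq]
          constructor
          · rintro ⟨h1, h2⟩
            refine ⟨h0 ▸ h2 0 (by omega), h1, fun k hk => ?_⟩
            rw [← hs, ← waitAt_succ]
            exact h2 (k + 1) (by omega)
          · rintro ⟨h1, h2, h3⟩
            refine ⟨h2, fun k hk => ?_⟩
            cases k with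
            | zero => rwa [h0]
            | succ k => rw [waitAt_succ, hs]; exact h3 k (by omega)
        · simp [hf]
      -- The first ring gives the factors `1 / #L` and Exp(#L); the induction hypothesis for a front
      -- of `#L + 1` leaves gives the rest.
      rw [measure_congr hset, clockLaw_first_ring hv (hB 0)
        (measurableSet_history_waitAt n _ l fun k => hB (k + 1)) hAv,
        ih (hL.splitLeaf hv) hl' fun k => hB (k + 1), splitWeight, if_pos hv,
        Finset.prod_range_succ', hL.card_splitLeaf hv]
      have : ∀ k, L.card + 1 + k = L.card + (k + 1) := fun k => by ring
      simp only [this, add_zero]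
      ring
    · rw [splitWeight, if_neg hv, zero_mul]
      convert measure_empty (μ := clockLaw Word)
      rw [Set.eq_empty_iff_forall_notMem]
      rintro r ⟨h1, -⟩
      rw [history_succ, List.cons.injEq] at h1
      exact hv (h1.1 ▸ firstRing_mem hL.1 r)

end

/-! ### Births, deaths, and generic lifetimes -/

noncomputable section

/-- The time at which `u` splits. -/
def death (e : Word → ℝ) (u : Word) : ℝ := birth e u + e u

/-- Positive lifetimes for which no two individuals split at the same time. -/
structure IsGeneric (e : Word → ℝ) : Prop where
  pos : ∀ u, 0 < e u
  inj : Function.Injective (death e)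

theorem birth_nil (e : Word → ℝ) : birth e [] = 0 := by simp [birth]

theorem birth_concat (e : Word → ℝ) (u : Word) (b : Bool) :
    birth e (u ++ [b]) = death e u := by
  rw [birth_append]; simp [birth, shift, death]

theorem birth_nonneg {e : Word → ℝ} (he : ∀ u, 0 ≤ e u) (u : Word) : 0 ≤ birth e u :=
  Finset.sum_nonneg fun _ _ => he _

theorem measurable_birth (u : Word) : Measurable fun e : Word → ℝ => birth e u :=
  Finset.measurable_sum _ fun _ _ => measurable_pi_apply _

/-- The hypothesis excludes strict prefixes of `u`, the only words whose lifetimes enter its birth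
time. -/
theorem birth_update {u v : Word} (h : v <+: u → v = u) (e : Word → ℝ) (y : ℝ) :
    birth (Function.update e v y) u = birth e u := by
  refine Finset.sum_congr rfl fun k hk => Function.update_of_ne (fun hv => ?_) _ _
  have h1 := h (hv ▸ List.take_prefix k u)
  have h2 := congrArg List.length (hv.trans h1)
  rw [List.length_take] at h2
  have := Finset.mem_range.1 hk
  omega

/-- Of two distinct words, one is not a prefix of the other. Its own lifetime then enters its death
time additively and does not enter the other's at all, so coincidence forces an independent clock to
take a prescribed value. -/
theorem ae_isGeneric : ∀ᵐ e ∂clockLaw Word, IsGeneric e := by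
  have hne : ∀ v w : Word, v ≠ w → ¬ v <+: w → ∀ᵐ e ∂clockLaw Word, death e v ≠ death e w := by
    intro v w hvw hpre
    refine ae_ne_of_update_eq v (f := fun e => birth e v) (g := fun e => death e w)
      (measurable_birth v) ((measurable_birth w).add (measurable_pi_apply w))
      (fun e y => birth_update (fun _ => rfl) e y) fun e y => ?_
    simp only [death]
    rw [birth_update (fun h => absurd h hpre), Function.update_of_ne hvw.symm]
  have hall : ∀ᵐ e ∂clockLaw Word, ∀ v w : Word, v ≠ w → death e v ≠ death e w := by
    simp only [ae_all_iff]
    intro v w hvw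
    by_cases h : v <+: w
    · have h' : ¬ w <+: v := fun h' => hvw (h.eq_of_length (le_antisymm h.length_le h'.length_le))
      filter_upwards [hne w v hvw.symm h'] with e he using he.symm
    · exact hne v w hvw h
  filter_upwards [ae_pos_clockLaw, hall] with e h1 h2
  refine ⟨h1, fun v w h => ?_⟩
  by_contra hvw
  exact h2 v w hvw h

theorem mem_boundary_tree' {e : Word → ℝ} (he : IsGeneric e) (t : ℝ) (u : Word) :
    u ∈ boundary (tree e t) ↔ birth e u ≤ t ∧ t < death e u :=
  mem_boundary_tree (fun v => (he.pos v).le) t u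

theorem birth_lt_death {e : Word → ℝ} (he : IsGeneric e) (u : Word) : birth e u < death e u :=
  lt_add_of_pos_right _ (he.pos u)

/-- An individual that has not appeared at time `t` appears after some individual that is alive at
time `t` has split. -/
theorem exists_alive_death_le_birth {e : Word → ℝ} (he : IsGeneric e) {t : ℝ} (ht : 0 ≤ t)
    (u : Word) (hu : t < birth e u) :
    ∃ a, birth e a ≤ t ∧ t < death e a ∧ death e a ≤ birth e u := by
  induction u using List.reverseRecOn with
  | nil => rw [birth_nil] at hu; linarith
  | append_singleton u b ih =>
    rw [birth_concat] at hu ⊢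
    rcases le_or_gt (birth e u) t with h | h
    · exact ⟨u, h, hu, le_rfl⟩
    · obtain ⟨a, h1, h2, h3⟩ := ih h
      exact ⟨a, h1, h2, h3.trans (birth_lt_death he u).le⟩

/-! ### The splitting dynamics describes the Yule tree -/

/-- The leaves of the tree after the `n`-th split. -/
def leavesAt (e : Word → ℝ) (n : ℕ) : Finset Word := (split^[n] ({[]}, e)).1

/-- The residual lifetimes after the `n`-th split. -/
def residualAt (e : Word → ℝ) (n : ℕ) : Word → ℝ := (split^[n] ({[]}, e)).2

/-- The time of the `n`-th split. -/
def splitTime (e : Word → ℝ) (n : ℕ) : ℝ := ∑ k ∈ Finset.range n, waitAt k ({[]}, e)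

theorem splitTime_zero (e : Word → ℝ) : splitTime e 0 = 0 := by simp [splitTime]

theorem splitTime_succ (e : Word → ℝ) (n : ℕ) :
    splitTime e (n + 1) = splitTime e n + waitAt n ({[]}, e) := by
  simp [splitTime, Finset.sum_range_succ]

theorem leavesAt_nonempty (e : Word → ℝ) (n : ℕ) : (leavesAt e n).Nonempty :=
  split_iterate_nonempty (s := ({[]}, e)) ⟨[], by simp⟩ n

theorem splitAt_mem_leavesAt (e : Word → ℝ) (n : ℕ) : splitAt n ({[]}, e) ∈ leavesAt e n :=
  firstRing_mem (leavesAt_nonempty e n) _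

theorem leavesAt_succ (e : Word → ℝ) (n : ℕ) :
    leavesAt e (n + 1) = splitLeaf (leavesAt e n) (splitAt n ({[]}, e)) := by
  unfold leavesAt
  rw [Function.iterate_succ_apply']
  rfl

theorem residualAt_succ (e : Word → ℝ) (n : ℕ) :
    residualAt e (n + 1) = elapse (leavesAt e n) (waitAt n ({[]}, e)) (residualAt e n) := by
  unfold residualAt
  rw [Function.iterate_succ_apply']
  rfl

theorem leavesAt_eq_leavesAfter (e : Word → ℝ) (n : ℕ) :
    leavesAt e n = leavesAfter {[]} (history n ({[]}, e)) :=
  split_iterate_fst n _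

theorem isFront_leavesAt (e : Word → ℝ) (n : ℕ) : IsFront (leavesAt e n) := by
  induction n with
  | zero => exact isFront_root
  | succ n ih => rw [leavesAt_succ]; exact ih.splitLeaf (splitAt_mem_leavesAt e n)

theorem card_leavesAt (e : Word → ℝ) (n : ℕ) : (leavesAt e n).card = n + 1 := by
  induction n with
  | zero => rfl
  | succ n ih =>
    rw [leavesAt_succ, (isFront_leavesAt e n).card_splitLeaf (splitAt_mem_leavesAt e n), ih]

/-- The leaves after the `n`-th split are alive at that time, with the given residual lifetimes. -/
structure Describes (e : Word → ℝ) (n : ℕ) : Prop where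
  nonneg : 0 ≤ splitTime e n
  mem_iff : ∀ u, u ∈ leavesAt e n ↔ birth e u ≤ splitTime e n ∧ splitTime e n < death e u
  residual : ∀ u ∈ leavesAt e n, residualAt e n u = death e u - splitTime e n
  fresh : ∀ u, splitTime e n < birth e u → residualAt e n u = e u

theorem Describes.splitTime_succ_eq {e : Word → ℝ} {n : ℕ} (h : Describes e n) :
    splitTime e (n + 1) = death e (splitAt n ({[]}, e)) := by
  have := h.residual _ (splitAt_mem_leavesAt e n)
  rw [splitTime_succ]
  change splitTime e n + residualAt e n _ = _
  rw [this]; ring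

theorem Describes.splitTime_succ_le {e : Word → ℝ} {n : ℕ} (h : Describes e n) {u : Word}
    (hu : u ∈ leavesAt e n) : splitTime e (n + 1) ≤ death e u := by
  have h1 : residualAt e n (splitAt n ({[]}, e)) ≤ residualAt e n u :=
    firstRing_le (L := leavesAt e n) (residualAt e n) hu
  rw [h.residual _ hu, h.residual _ (splitAt_mem_leavesAt e n)] at h1
  rw [h.splitTime_succ_eq]; linarith

theorem Describes.splitTime_lt_succ {e : Word → ℝ} {n : ℕ} (h : Describes e n) :
    splitTime e n < splitTime e (n + 1) := by
  rw [h.splitTime_succ_eq]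
  exact ((h.mem_iff _).1 (splitAt_mem_leavesAt e n)).2

/-- A new individual can only come from the death of one now alive, and the next split is the
earliest such death. -/
theorem Describes.succ_le_birth {e : Word → ℝ} (he : IsGeneric e) {n : ℕ} (h : Describes e n)
    {u : Word} (hu : splitTime e n < birth e u) : splitTime e (n + 1) ≤ birth e u := by
  obtain ⟨a, h1, h2, h3⟩ := exists_alive_death_le_birth he h.nonneg u hu
  exact (h.splitTime_succ_le ((h.mem_iff a).2 ⟨h1, h2⟩)).trans h3

/-- The individuals that appear at the `(n + 1)`-st split. -/
theorem Describes.birth_le_succ_iff {e : Word → ℝ} (he : IsGeneric e) {n : ℕ}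
    (h : Describes e n) (u : Word) :
    birth e u ≤ splitTime e (n + 1) ↔
      birth e u ≤ splitTime e n ∨ ∃ b : Bool, u = splitAt n ({[]}, e) ++ [b] := by
  constructor
  · intro hu
    by_contra! hc
    obtain ⟨hu', hb⟩ := hc
    rcases List.eq_nil_or_concat u with rfl | ⟨p, b, rfl⟩
    · rw [birth_nil] at hu'; exact absurd h.nonneg (not_le.2 hu')
    · rw [List.concat_eq_append] at *
      rw [birth_concat] at hu hu'
      rcases le_or_gt (birth e p) (splitTime e n) with hp | hp
      · have hmem := (h.mem_iff p).2 ⟨hp, hu'⟩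
        have heq : death e p = death e (splitAt n ({[]}, e)) := by
          rw [← h.splitTime_succ_eq]
          exact le_antisymm hu (h.splitTime_succ_le hmem)
        exact hb b (by rw [he.inj heq])
      · have h1 := h.succ_le_birth he hp
        have h2 := birth_lt_death he p
        linarith
  · rintro (hu | ⟨b, rfl⟩)
    · exact hu.trans h.splitTime_lt_succ.le
    · rw [birth_concat, h.splitTime_succ_eq]

/-- At the next split time exactly one leaf dies, by injectivity of the death times. Its children
are born at that moment with clocks that have not been touched, and the other leaves lose the
waiting time. -/
theorem describes_leavesAt {e : Word → ℝ} (he : IsGeneric e) (n : ℕ) : Describes e n := by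
  induction n with
  | zero =>
    refine ⟨by rw [splitTime_zero], fun u => ?_, fun u hu => ?_, fun u _ => rfl⟩
    · rw [splitTime_zero]
      have hl : leavesAt e 0 = {[]} := rfl
      rw [hl, Finset.mem_singleton]
      constructor
      · rintro rfl
        have := birth_lt_death he []
        rw [birth_nil] at this ⊢
        exact ⟨le_rfl, this⟩
      · rintro ⟨h1, -⟩
        rcases List.eq_nil_or_concat u with rfl | ⟨p, b, rfl⟩
        · rfl
        · rw [List.concat_eq_append, birth_concat] at h1
          have h2 := birth_lt_death he p
          have h3 := birth_nonneg (fun v => (he.pos v).le) p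
          linarith
    · have hl : leavesAt e 0 = {[]} := rfl
      rw [hl, Finset.mem_singleton] at hu
      subst hu
      have hr : residualAt e 0 = e := rfl
      rw [hr, splitTime_zero, death, birth_nil]; ring
  | succ n ih =>
    have hlt := ih.splitTime_lt_succ
    have hnew : ∀ b : Bool, birth e (splitAt n ({[]}, e) ++ [b]) = splitTime e (n + 1) :=
      fun b => by rw [birth_concat, ih.splitTime_succ_eq]
    have hnot : ∀ b : Bool, splitAt n ({[]}, e) ++ [b] ∉ leavesAt e n := fun b hb => by
      have := ((ih.mem_iff _).1 hb).1
      rw [hnew] at this; linarith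
    refine ⟨ih.nonneg.trans hlt.le, fun u => ?_, fun u hu => ?_, fun u hu => ?_⟩
    · rw [leavesAt_succ, mem_splitLeaf', ih.birth_le_succ_iff he]
      constructor
      · rintro (⟨hne, hu⟩ | ⟨b, rfl⟩)
        · refine ⟨Or.inl ((ih.mem_iff u).1 hu).1, lt_of_le_of_ne (ih.splitTime_succ_le hu) ?_⟩
          rw [ih.splitTime_succ_eq]
          exact fun h => hne (he.inj h).symm
        · refine ⟨Or.inr ⟨b, rfl⟩, ?_⟩
          rw [← hnew b]; exact birth_lt_death he _
      · rintro ⟨hu | ⟨b, rfl⟩, hd⟩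
        · refine Or.inl ⟨?_, (ih.mem_iff u).2 ⟨hu, hlt.trans hd⟩⟩
          rintro rfl
          rw [ih.splitTime_succ_eq] at hd
          exact lt_irrefl _ hd
        · exact Or.inr ⟨b, rfl⟩
    · rw [residualAt_succ, elapse, splitTime_succ]
      rw [leavesAt_succ, mem_splitLeaf'] at hu
      rcases hu with ⟨-, hu⟩ | ⟨b, rfl⟩
      · rw [if_pos hu, ih.residual u hu]; ring
      · rw [if_neg (hnot b), ih.fresh _ (by rw [hnew]; exact hlt), death, hnew, splitTime_succ]
        ring
    · have hu' : splitTime e n < birth e u := hlt.trans hu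
      rw [residualAt_succ, elapse, if_neg, ih.fresh u hu']
      exact fun hm => absurd ((ih.mem_iff u).1 hm).1 (not_le.2 hu')

theorem splitTime_strictMono {e : Word → ℝ} (he : IsGeneric e) : StrictMono (splitTime e) :=
  strictMono_nat_of_lt_succ fun n => (describes_leavesAt he n).splitTime_lt_succ

/-- Nobody is born and nobody dies strictly between two consecutive split times. -/
theorem boundary_tree_eq {e : Word → ℝ} (he : IsGeneric e) {n : ℕ} {t : ℝ}
    (h1 : splitTime e n ≤ t) (h2 : t < splitTime e (n + 1)) :
    boundary (tree e t) = (leavesAt e n : Set Word) := by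
  have h := describes_leavesAt he n
  ext u
  rw [mem_boundary_tree' he, Finset.mem_coe]
  constructor
  · rintro ⟨hb, hd⟩
    refine (h.mem_iff u).2 ⟨?_, h1.trans_lt hd⟩
    by_contra! hc
    exact absurd (h.succ_le_birth he hc) (not_le.2 (hb.trans_lt h2))
  · intro hu
    exact ⟨((h.mem_iff u).1 hu).1.trans h1, h2.trans_le (h.splitTime_succ_le hu)⟩

theorem numLeaves_eq {e : Word → ℝ} (he : IsGeneric e) {n : ℕ} {t : ℝ}
    (h1 : splitTime e n ≤ t) (h2 : t < splitTime e (n + 1)) : numLeaves e t = n + 1 := by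
  rw [numLeaves, boundary_tree_eq he h1 h2, Set.ncard_coe_finset, card_leavesAt]

theorem levelPoly_tree_eq {e : Word → ℝ} (he : IsGeneric e) {n : ℕ} {t : ℝ}
    (h1 : splitTime e n ≤ t) (h2 : t < splitTime e (n + 1)) (z : ℝ) :
    levelPoly (tree e t) z = ∑ u ∈ leavesAt e n, z ^ u.length := by
  rw [levelPoly, boundary_tree_eq he h1 h2, finsum_mem_coe_finset]

theorem exists_splitTime_le_lt (e : Word → ℝ) {t : ℝ} (ht : 0 ≤ t) {n : ℕ}
    (hn : t < splitTime e n) : ∃ m < n, splitTime e m ≤ t ∧ t < splitTime e (m + 1) := by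
  induction n with
  | zero => rw [splitTime_zero] at hn; linarith
  | succ n ih =>
    rcases lt_or_ge t (splitTime e n) with h | h
    · obtain ⟨m, hm, h'⟩ := ih h
      exact ⟨m, by omega, h'⟩
    · exact ⟨n, by omega, h, hn⟩

theorem jumpTime_eq_splitTime {e : Word → ℝ} (he : IsGeneric e) (n : ℕ) :
    jumpTime e n = splitTime e n := by
  refine IsLeast.csInf_eq ⟨⟨(describes_leavesAt he n).nonneg,
    numLeaves_eq he le_rfl (splitTime_strictMono he (Nat.lt_succ_self n))⟩, ?_⟩
  rintro t ⟨ht, hN⟩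
  by_contra! hc
  obtain ⟨m, hm, h1, h2⟩ := exists_splitTime_le_lt e ht hc
  rw [numLeaves_eq he h1 h2] at hN
  omega

theorem boundary_bst {e : Word → ℝ} (he : IsGeneric e) (n : ℕ) :
    boundary (bst e n) = (leavesAt e n : Set Word) := by
  rw [bst, jumpTime_eq_splitTime he]
  exact boundary_tree_eq he le_rfl (splitTime_strictMono he (Nat.lt_succ_self n))

theorem bst_zero {e : Word → ℝ} (he : IsGeneric e) : bst e 0 = {[]} := by
  rw [bst, jumpTime_eq_splitTime he, splitTime_zero]
  ext u
  simp only [tree, Set.mem_ofPred_eq, Set.mem_singleton_iff]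
  rcases List.eq_nil_or_concat u with rfl | ⟨p, b, rfl⟩
  · simp [birth_nil]
  · rw [List.concat_eq_append, birth_concat]
    have h2 := birth_lt_death he p
    have h3 := birth_nonneg (fun v => (he.pos v).le) p
    simp only [List.append_eq_nil_iff, List.cons_ne_nil, and_false, iff_false, not_le]
    linarith

theorem bst_succ {e : Word → ℝ} (he : IsGeneric e) (n : ℕ) :
    bst e (n + 1) =
      bst e n ∪ {splitAt n ({[]}, e) ++ [false], splitAt n ({[]}, e) ++ [true]} := by
  ext u
  simp only [bst, jumpTime_eq_splitTime he, tree, Set.mem_union, Set.mem_ofPred_eq,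
    (describes_leavesAt he n).birth_le_succ_iff he, Bool.exists_bool, Set.mem_insert_iff,
    Set.mem_singleton_iff]

/-- The trees grown along a list of splits. -/
def treeAfter (l : List Word) : Set Word := {[]} ∪ {u | ∃ v ∈ l, ∃ b : Bool, u = v ++ [b]}

/-- Factors the tree through the history, which takes values in a countable type; measurability of
events about the trees rests on this. -/
theorem bst_eq_treeAfter {e : Word → ℝ} (he : IsGeneric e) (n : ℕ) :
    bst e n = treeAfter (history n ({[]}, e)) := by
  induction n with
  | zero => rw [bst_zero he]; simp [treeAfter, history]
  | succ n ih =>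
    rw [bst_succ he, ih, history_succ']
    ext u
    simp only [treeAfter, Set.mem_union, Set.mem_ofPred_eq, List.mem_append, List.mem_singleton,
      Set.mem_insert_iff, Set.mem_singleton_iff, or_and_right, exists_or, exists_eq_left,
      Bool.exists_bool, or_assoc]

theorem children_notMem_bst {e : Word → ℝ} (n : ℕ) {u : Word}
    (hu : u ∈ boundary (bst e n)) (b : Bool) : u ++ [b] ∉ bst e n :=
  hu.2 [b] (by simp)

/-- The tree at time `n + 1` determines the `n`-th split. -/
theorem bst_succ_eq_iff {e : Word → ℝ} (he : IsGeneric e) (n : ℕ) {u : Word}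
    (hu : u ∈ boundary (bst e n)) :
    bst e (n + 1) = bst e n ∪ {u ++ [false], u ++ [true]} ↔ splitAt n ({[]}, e) = u := by
  rw [bst_succ he]
  constructor
  · intro h
    have hmem : splitAt n ({[]}, e) ∈ boundary (bst e n) := by
      rw [boundary_bst he]; exact splitAt_mem_leavesAt e n
    have h1 : splitAt n ({[]}, e) ++ [false] ∈ bst e n ∪ {u ++ [false], u ++ [true]} := by
      rw [← h]; simp
    rcases h1 with h1 | h1
    · exact absurd h1 (children_notMem_bst n hmem false)
    · simpa using h1
  · rintro rfl; rfl

/-- The trees up to time `n` determine the first `n` splits. -/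
theorem forall_bst_eq_iff {e e' : Word → ℝ} (he : IsGeneric e) (he' : IsGeneric e') (n : ℕ) :
    (∀ j ≤ n, bst e j = bst e' j) ↔ history n ({[]}, e) = history n ({[]}, e') := by
  induction n with
  | zero => simp [bst_zero he, bst_zero he', history]
  | succ n ih =>
    rw [history_succ', history_succ']
    have hsplit : (∀ j ≤ n + 1, bst e j = bst e' j) ↔
        (∀ j ≤ n, bst e j = bst e' j) ∧ bst e (n + 1) = bst e' (n + 1) := by
      constructor
      · exact fun h => ⟨fun j hj => h j (by omega), h _ le_rfl⟩
      · rintro ⟨h1, h2⟩ j hj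
        rcases Nat.lt_or_ge j (n + 1) with hj' | hj'
        · exact h1 j (by omega)
        · obtain rfl : j = n + 1 := by omega
          exact h2
    rw [hsplit, ih]
    constructor
    · rintro ⟨h1, h2⟩
      have hn := (ih.2 h1) n le_rfl
      rw [h1]
      congr 2
      rw [bst_succ he', ← hn] at h2
      refine (bst_succ_eq_iff he n ?_).1 h2
      rw [hn, boundary_bst he']
      exact splitAt_mem_leavesAt e' n
    · intro h
      obtain ⟨h1, h2⟩ := List.append_inj' h rfl
      refine ⟨h1, ?_⟩
      rw [bst_eq_treeAfter he, bst_eq_treeAfter he', history_succ', history_succ', h]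

end

/-! ### The splits of the Yule tree and its waiting times -/

theorem measurable_root : Measurable fun e : Word → ℝ => (({[]} : Finset Word), e) :=
  measurable_const.prodMk measurable_id

theorem measurable_history_root (n : ℕ) : Measurable fun e : Word → ℝ => history n ({[]}, e) :=
  (measurable_history n).comp measurable_root

theorem measurable_splitAt_root (n : ℕ) : Measurable fun e : Word → ℝ => splitAt n ({[]}, e) :=
  (measurable_splitAt n).comp measurable_root

theorem measurable_waitAt_root (n : ℕ) : Measurable fun e : Word → ℝ => waitAt n ({[]}, e) :=
  (measurable_waitAt n).comp measurable_root

theorem measurable_waits : Measurable fun (e : Word → ℝ) (k : ℕ) => waitAt k ({[]}, e) :=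
  measurable_pi_lambda _ measurable_waitAt_root

theorem clockLaw_history_eq (l : List Word) :
    clockLaw Word {e | history l.length ({[]}, e) = l} = splitWeight {[]} l := by
  have := clockLaw_history_waitAt l.length isFront_root (l := l) rfl
    (B := fun _ => Set.univ) fun _ => MeasurableSet.univ
  have hp : ∀ k : ℕ, expMeasure ((({[]} : Finset Word).card + k : ℕ) : ℝ) Set.univ = 1 := by
    intro k
    have : ((({[]} : Finset Word).card + k : ℕ) : ℝ) = (k : ℝ) + 1 := by
      simp [add_comm]
    rw [this]; exact measure_univ
  rw [Finset.prod_congr rfl fun k _ => hp k, Finset.prod_const_one, mul_one] at this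
  simpa using this

theorem clockLaw_history_append (l : List Word) (u : Word) (hu : u ∈ leavesAfter {[]} l) :
    clockLaw Word {e | history (l.length + 1) ({[]}, e) = l ++ [u]}
      = clockLaw Word {e | history l.length ({[]}, e) = l} *
        ((leavesAfter {[]} l).card : ENNReal)⁻¹ := by
  have := clockLaw_history_eq (l ++ [u])
  rw [List.length_append, List.length_singleton] at this
  rw [this, splitWeight_append, if_pos hu, clockLaw_history_eq]

theorem clockLaw_history_inter_waits (n : ℕ) (S : Set (List Word)) {B : ℕ → Set ℝ}
    (hB : ∀ k, MeasurableSet (B k)) :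
    clockLaw Word {e | history n ({[]}, e) ∈ S ∧ ∀ k < n, waitAt k ({[]}, e) ∈ B k}
      = clockLaw Word {e | history n ({[]}, e) ∈ S} *
        ∏ k ∈ Finset.range n, expMeasure ((k : ℝ) + 1) (B k) := by
  set c := ∏ k ∈ Finset.range n, expMeasure ((k : ℝ) + 1) (B k) with hc
  have hW : MeasurableSet {e : Word → ℝ | ∀ k < n, waitAt k ({[]}, e) ∈ B k} := by
    have : {e : Word → ℝ | ∀ k < n, waitAt k ({[]}, e) ∈ B k}
        = ⋂ k, ⋂ _ : k < n, {e | waitAt k ({[]}, e) ∈ B k} := by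
      ext; simp
    refine (congrArg MeasurableSet this).mpr ?_
    exact MeasurableSet.iInter fun k => MeasurableSet.iInter fun _ =>
      measurable_waitAt_root k (hB k)
  -- The product formula is known list by list; two measures on a countable space that agree on
  -- singletons are equal.
  have key : ((clockLaw Word).restrict {e | ∀ k < n, waitAt k ({[]}, e) ∈ B k}).map
      (fun e => history n ({[]}, e)) = c • (clockLaw Word).map fun e => history n ({[]}, e) := by
    refine Measure.ext_of_singleton fun l => ?_
    rw [Measure.map_apply (measurable_history_root n) (MeasurableSet.singleton l),
      Measure.restrict_apply (measurable_history_root n (MeasurableSet.singleton l)),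
      Measure.smul_apply, Measure.map_apply (measurable_history_root n)
        (MeasurableSet.singleton l), smul_eq_mul]
    change clockLaw Word {e | history n ({[]}, e) = l ∧ ∀ k < n, waitAt k ({[]}, e) ∈ B k}
      = c * clockLaw Word {e | history n ({[]}, e) = l}
    by_cases hl : l.length = n
    · subst hl
      rw [clockLaw_history_waitAt _ isFront_root rfl hB, clockLaw_history_eq, mul_comm, hc]
      congr 1
      refine Finset.prod_congr rfl fun k _ => ?_
      congr 2
      simp [add_comm]
    · have h1 : ∀ e : Word → ℝ, history n ({[]}, e) ≠ l := by
        rintro e rfl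
        exact hl (length_history n _)
      simp [h1]
  have := congrArg (fun ν => ν S) key
  rw [Measure.map_apply (measurable_history_root n) MeasurableSet.of_discrete,
    Measure.restrict_apply (measurable_history_root n MeasurableSet.of_discrete),
    Measure.smul_apply, Measure.map_apply (measurable_history_root n)
      MeasurableSet.of_discrete, smul_eq_mul, mul_comm] at this
  exact this

theorem take_history {n m : ℕ} (h : n ≤ m) (s : Finset Word × (Word → ℝ)) :
    (history m s).take n = history n s := by
  unfold history
  rw [← List.map_take, List.take_range, min_eq_left h]

/-- The waiting times may have indices beyond `n`: pass to a horizon `m` beyond both `n` and `s`,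
and read the first `n` splits as a prefix of the first `m`. -/
theorem clockLaw_history_inter_waits_pi (n : ℕ) (S : Set (List Word)) (s : Finset ℕ)
    {t : ℕ → Set ℝ} (ht : ∀ k, MeasurableSet (t k)) :
    clockLaw Word ({e | history n ({[]}, e) ∈ S} ∩
        (fun (e : Word → ℝ) (k : ℕ) => waitAt k ({[]}, e)) ⁻¹' Set.pi (s : Set ℕ) t)
      = clockLaw Word {e | history n ({[]}, e) ∈ S} *
        ∏ k ∈ s, expMeasure ((k : ℝ) + 1) (t k) := by
  set m := n ⊔ (s.sup id + 1) with hm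
  have hnm : n ≤ m := le_sup_left
  have hsm : ∀ k ∈ s, k < m := fun k hk =>
    lt_of_lt_of_le (Nat.lt_succ_of_le (Finset.le_sup (f := id) hk)) le_sup_right
  have hS : ∀ e : Word → ℝ, history n ({[]}, e) ∈ S ↔
      history m ({[]}, e) ∈ (fun l => List.take n l) ⁻¹' S := fun e => by
    rw [Set.mem_preimage, take_history hnm]
  simp only [hS]
  have := clockLaw_history_inter_waits m ((fun l => List.take n l) ⁻¹' S)
    (B := fun k => if k ∈ s then t k else Set.univ) (fun k => by
      split_ifs
      · exact ht k
      · exact MeasurableSet.univ)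
  have hprod : ∏ k ∈ Finset.range m, expMeasure ((k : ℝ) + 1) (if k ∈ s then t k else Set.univ)
      = ∏ k ∈ s, expMeasure ((k : ℝ) + 1) (t k) := by
    rw [← Finset.prod_subset (s₁ := s) fun k hk => Finset.mem_range.2 (hsm k hk)]
    · exact Finset.prod_congr rfl fun k hk => by rw [if_pos hk]
    · intro k _ hk
      rw [if_neg hk, measure_univ]
  rw [hprod] at this
  rw [← this]
  congr 1
  ext e
  simp only [Set.mem_inter_iff, Set.mem_ofPred_eq, Set.mem_preimage, Set.mem_pi, Finset.mem_coe]
  refine and_congr_right fun _ => ⟨fun h k _ => ?_, fun h k hk => ?_⟩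
  · split_ifs with hk
    · exact h k hk
    · trivial
  · simpa [hk] using h k (hsm k hk)

/-- The law of the waiting times: independent exponential variables of parameters `1, 2, …`. -/
theorem map_waits : (clockLaw Word).map (fun (e : Word → ℝ) (k : ℕ) => waitAt k ({[]}, e))
    = Measure.infinitePi fun k : ℕ => expMeasure ((k : ℝ) + 1) := by
  refine Measure.eq_infinitePi _ fun s t ht => ?_
  rw [Measure.map_apply measurable_waits
    (MeasurableSet.pi (Finset.countable_toSet s) fun w _ => ht w)]
  simpa using clockLaw_history_inter_waits_pi 0 Set.univ s ht

theorem hasLaw_waitAt (k : ℕ) :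
    HasLaw (fun e : Word → ℝ => waitAt k ({[]}, e)) (expMeasure ((k : ℝ) + 1)) (clockLaw Word) := by
  refine ⟨(measurable_waitAt_root k).aemeasurable, ?_⟩
  rw [← Measure.infinitePi_map_eval (fun k : ℕ => expMeasure ((k : ℝ) + 1)) k, ← map_waits,
    Measure.map_map (measurable_pi_apply k) measurable_waits]
  rfl

theorem iIndepFun_waitAt :
    iIndepFun (fun (k : ℕ) (e : Word → ℝ) => waitAt k ({[]}, e)) (clockLaw Word) := by
  rw [iIndepFun_iff_hasLaw_Pi_infinitePi hasLaw_waitAt measurable_waits.aemeasurable]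
  exact ⟨measurable_waits.aemeasurable, map_waits⟩

theorem indepFun_history_waits (n : ℕ) :
    IndepFun (fun e : Word → ℝ => history n ({[]}, e))
      (fun (e : Word → ℝ) (k : ℕ) => waitAt k ({[]}, e)) (clockLaw Word) := by
  rw [indepFun_iff_measure_inter_preimage_eq_mul]
  intro S T hS hT
  set A := (fun e : Word → ℝ => history n ({[]}, e)) ⁻¹' S with hA
  have hAm : MeasurableSet A := measurable_history_root n hS
  by_cases h0 : clockLaw Word A = 0
  · rw [h0, zero_mul]
    exact measure_mono_null Set.inter_subset_left h0
  -- Conditionally on `A`, the waiting times have the same law on cylinders, hence the same product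
  -- law.
  have key : (clockLaw Word A)⁻¹ • ((clockLaw Word).restrict A).map
      (fun (e : Word → ℝ) (k : ℕ) => waitAt k ({[]}, e))
      = Measure.infinitePi fun k : ℕ => expMeasure ((k : ℝ) + 1) := by
    refine Measure.eq_infinitePi _ fun s t ht => ?_
    have hpi := MeasurableSet.pi (Finset.countable_toSet s) fun w _ => ht w
    rw [Measure.smul_apply, Measure.map_apply measurable_waits hpi,
      Measure.restrict_apply (measurable_waits hpi), Set.inter_comm, smul_eq_mul, hA]
    have := clockLaw_history_inter_waits_pi n S s ht
    change _ * clockLaw Word ({e | history n ({[]}, e) ∈ S} ∩ _) = _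
    rw [this, ← mul_assoc]
    change (clockLaw Word A)⁻¹ * clockLaw Word A * _ = _
    rw [ENNReal.inv_mul_cancel h0 (measure_ne_top _ _), one_mul]
  rw [← map_waits] at key
  have := congrArg (fun ν => clockLaw Word A * ν T) key
  simp only [Measure.smul_apply, smul_eq_mul, ← mul_assoc,
    ENNReal.mul_inv_cancel h0 (measure_ne_top _ _), one_mul] at this
  rw [Measure.map_apply measurable_waits hT, Measure.map_apply measurable_waits hT,
    Measure.restrict_apply (measurable_waits hT), Set.inter_comm] at this
  exact this

/-- The splits are independent of the waiting times. -/
theorem indepFun_splits_waits :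
    IndepFun (fun (e : Word → ℝ) (k : ℕ) => splitAt k ({[]}, e))
      (fun (e : Word → ℝ) (k : ℕ) => waitAt k ({[]}, e)) (clockLaw Word) := by
  refine IndepFun.process_indepFun measurable_splitAt_root measurable_waits fun I => ?_
  -- Finitely many splits are read off a long enough history; the default value `[]` is never
  -- reached.
  have h : (fun (e : Word → ℝ) (i : I) => splitAt i ({[]}, e)) =
      (fun (l : List Word) (i : I) => l.getD i []) ∘
        fun e => history (I.sup id + 1) ({[]}, e) := by
    funext e i
    have hi : (i : ℕ) < I.sup id + 1 := Nat.lt_succ_of_le (Finset.le_sup (f := id) i.2)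
    simp [history, List.getElem?_range hi]
  rw [h]
  exact (indepFun_history_waits _).comp
    (φ := fun (l : List Word) (i : I) => l.getD i []) (ψ := id)
    (measurable_of_countable _) measurable_id

/-! ### The embedded binary search tree process -/

theorem isBSTProcess_clockLaw : IsBSTProcess (clockLaw Word) fun n e => bst e n := by
  refine ⟨?_, fun n => ?_, fun n t u hu => ?_⟩
  · filter_upwards [ae_isGeneric] with e he using bst_zero he
  · filter_upwards [ae_isGeneric] with e he
    refine ⟨?_, splitAt n ({[]}, e), ?_, bst_succ he n⟩
    · rw [boundary_bst he, Set.ncard_coe_finset, card_leavesAt]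
    · rw [boundary_bst he]; exact splitAt_mem_leavesAt e n
  -- If generic lifetimes realise the prescribed trees, they determine a list of splits and the
  -- claim becomes the transition probability of the history. Otherwise both sides vanish.
  · by_cases hex : ∃ e, IsGeneric e ∧ ∀ j ≤ n, bst e j = t j
    · obtain ⟨e₀, he₀, ht⟩ := hex
      set l := history n ({[]}, e₀) with hl
      have hlen : l.length = n := length_history _ _
      have hu' : u ∈ leavesAfter {[]} l := by
        rw [hl, ← leavesAt_eq_leavesAfter, ← Finset.mem_coe, ← boundary_bst he₀, ht n le_rfl]
        exact hu
      have hcard : (leavesAfter {[]} l).card = n + 1 := by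
        rw [hl, ← leavesAt_eq_leavesAfter, card_leavesAt]
      have hiff : ∀ e, IsGeneric e → ((∀ j ≤ n, bst e j = t j) ↔ history n ({[]}, e) = l) := by
        intro e he
        rw [hl, ← forall_bst_eq_iff he he₀]
        exact forall₂_congr fun j hj => by rw [ht j hj]
      have h1 : clockLaw Word {e | ∀ j ≤ n, bst e j = t j}
          = clockLaw Word {e | history l.length ({[]}, e) = l} := by
        refine measure_congr ?_
        filter_upwards [ae_isGeneric] with e he
        apply propext
        change (∀ j ≤ n, bst e j = t j) ↔ history l.length ({[]}, e) = l
        rw [hlen]; exact hiff e he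
      have h2 : clockLaw Word {e | (∀ j ≤ n, bst e j = t j) ∧
            bst e (n + 1) = t n ∪ {u ++ [false], u ++ [true]}}
          = clockLaw Word {e | history (l.length + 1) ({[]}, e) = l ++ [u]} := by
        refine measure_congr ?_
        filter_upwards [ae_isGeneric] with e he
        apply propext
        change ((∀ j ≤ n, bst e j = t j) ∧ bst e (n + 1) = t n ∪ {u ++ [false], u ++ [true]}) ↔
          history (l.length + 1) ({[]}, e) = l ++ [u]
        have happ : ∀ (l₁ l₂ : List Word) (a b : Word),
            l₁ ++ [a] = l₂ ++ [b] ↔ l₁ = l₂ ∧ a = b := by simp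
        rw [hlen, history_succ', happ, ← hiff e he]
        refine and_congr_right fun h => ?_
        rw [← h n le_rfl]
        exact bst_succ_eq_iff he n (by rw [h n le_rfl]; exact hu)
      simp only
      rw [h1, h2, clockLaw_history_append l u hu', hcard, ENNReal.div_eq_inv_mul, mul_comm]
      push_cast
      rfl
    · have h0 : clockLaw Word {e | ∀ j ≤ n, bst e j = t j} = 0 := by
        refine measure_mono_null (t := {e | ¬ IsGeneric e}) ?_ (ae_iff.1 ae_isGeneric)
        intro e he hg
        exact hex ⟨e, hg, he⟩
      simp only
      rw [h0, ENNReal.zero_div]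
      exact measure_mono_null (fun e he => he.1) h0

/-! ### Convergence of nonnegative martingales -/

section Martingales

variable {Ω : Type*} {m : MeasurableSpace Ω} {μ : Measure Ω} [IsProbabilityMeasure μ]

/-- For a nonnegative martingale the `L¹` norm equals the constant expectation, so Doob's
convergence theorem applies. -/
theorem ae_exists_tendsto_of_nonneg_martingale {f : ℕ → Ω → ℝ} {ℱ : Filtration ℕ m}
    (hf : Martingale f ℱ μ) (h0 : ∀ n, 0 ≤ᵐ[μ] f n) :
    ∀ᵐ ω ∂μ, ∃ c, Tendsto (fun n => f n ω) atTop (𝓝 c) := by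
  refine hf.submartingale.exists_ae_tendsto_of_bdd (R := (∫ ω, f 0 ω ∂μ).toNNReal) fun n => ?_
  rw [eLpNorm_one_eq_lintegral_enorm]
  have h1 : ∫⁻ ω, ‖f n ω‖ₑ ∂μ = ENNReal.ofReal (∫ ω, f n ω ∂μ) := by
    rw [ofReal_integral_eq_lintegral_ofReal (hf.integrable n) (h0 n)]
    refine lintegral_congr_ae ?_
    filter_upwards [h0 n] with ω hω
    exact Real.enorm_of_nonneg hω
  have h2 : ∫ ω, f n ω ∂μ = ∫ ω, f 0 ω ∂μ := by
    have := hf.setIntegral_eq (Nat.zero_le n) (s := Set.univ) MeasurableSet.univ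
    simpa using this.symm
  rw [h1, h2]
  rfl

theorem ae_exists_tendsto_prod_of_iIndepFun {Y : ℕ → Ω → ℝ} (hY : ∀ n, Measurable (Y n))
    (h0 : ∀ n ω, 0 ≤ Y n ω) (hind : iIndepFun Y μ) (hint : ∀ n, Integrable (Y n) μ)
    (hone : ∀ n, ∫ ω, Y n ω ∂μ = 1) :
    ∀ᵐ ω ∂μ, ∃ c, Tendsto (fun n => ∏ k ∈ Finset.range n, Y k ω) atTop (𝓝 c) := by
  have hs : ∀ n, StronglyMeasurable (Y n) := fun n => (hY n).stronglyMeasurable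
  set f : ℕ → Ω → ℝ := fun n => ∏ k ∈ Finset.range n, Y k with hf
  have hfint : ∀ n, Integrable (f n) μ := by
    intro n
    induction n with
    | zero => exact (integrable_const (1 : ℝ) : Integrable (fun _ : Ω => (1 : ℝ)) μ)
    | succ n ih =>
      have : f (n + 1) = f n * Y n := Finset.prod_range_succ _ _
      rw [this]
      exact (hind.indepFun_prod_range_succ hY n).integrable_mul ih (hint n)
  -- The index is shifted because the natural filtration at time `n` already contains `Y n`, the
  -- last factor of `f (n + 1)`.
  have hmart : Martingale (fun n => f (n + 1)) (Filtration.natural Y hs) μ := by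
    refine martingale_nat (fun n => ?_) (fun n => hfint _) fun n => ?_
    · refine Finset.stronglyMeasurable_prod _ fun k hk => ?_
      have hk' : k ≤ n := Nat.lt_succ_iff.1 (Finset.mem_range.1 hk)
      exact (Filtration.stronglyAdapted_natural hs k).mono ((Filtration.natural Y hs).mono hk')
    · have hfn : StronglyMeasurable[Filtration.natural Y hs n] (f (n + 1)) := by
        refine Finset.stronglyMeasurable_prod _ fun k hk => ?_
        have hk' : k ≤ n := Nat.lt_succ_iff.1 (Finset.mem_range.1 hk)
        exact (Filtration.stronglyAdapted_natural hs k).mono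
          ((Filtration.natural Y hs).mono hk')
      have hsucc : f (n + 1 + 1) = f (n + 1) * Y (n + 1) := Finset.prod_range_succ _ _
      have h1 := condExp_mul_of_stronglyMeasurable_left hfn (hsucc ▸ hfint (n + 1 + 1))
        (hint (n + 1))
      have h2 := hind.condExp_natural_ae_eq_of_lt hs (Nat.lt_succ_self n)
      change f (n + 1) =ᵐ[μ] μ[f (n + 1 + 1) | Filtration.natural Y hs n]
      rw [hsucc]
      filter_upwards [h1, h2] with ω h1 h2
      rw [h1, Pi.mul_apply, h2, hone, mul_one]
  have h := ae_exists_tendsto_of_nonneg_martingale hmart fun n =>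
    Eventually.of_forall fun ω => by
      simp only [hf, Finset.prod_apply]
      exact Finset.prod_nonneg fun k _ => h0 k ω
  filter_upwards [h] with ω ⟨c, hc⟩
  refine ⟨c, ?_⟩
  rw [← tendsto_add_atTop_iff_nat 1]
  simpa [hf, Finset.prod_apply] using hc

end Martingales

/-! ### The limit of `(n + 1) exp (-τ_n)` -/

/-- Exp(k + 1) is Exp(1) weighted by `(k + 1) exp (-k y)`; the extra factor `exp (-y)` is one more
tilt, of total mass `1 / (k + 2)`. -/
theorem lintegral_exp_neg_expMeasure (k : ℕ) :
    ∫⁻ y, ENNReal.ofReal (Real.exp (-y)) ∂expMeasure ((k : ℝ) + 1)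
      = ((k : ENNReal) + 1) * ((k : ENNReal) + 2)⁻¹ := by
  have hme : Measurable fun y : ℝ => ENNReal.ofReal (Real.exp (-(k * y))) := by fun_prop
  have hk0 : ((k : ENNReal) + 1) ≠ 0 := by simp
  have hkt : ((k : ENNReal) + 1) ≠ ⊤ := by simp
  have h : expMeasure ((k : ℝ) + 1) = ((k : ENNReal) + 1) •
      (expMeasure 1).withDensity fun y => ENNReal.ofReal (Real.exp (-(k * y))) := by
    ext B hB
    rw [Measure.smul_apply, withDensity_apply _ hB, lintegral_exp_neg_mul_expMeasure k hB,
      smul_eq_mul, ← mul_assoc, ENNReal.mul_inv_cancel hk0 hkt, one_mul]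
  rw [h, lintegral_smul_measure, lintegral_withDensity_eq_lintegral_mul _ hme (by fun_prop),
    smul_eq_mul]
  congr 1
  have h2 := lintegral_exp_neg_mul_expMeasure (k + 1) MeasurableSet.univ
  rw [measure_univ, mul_one, Measure.restrict_univ] at h2
  have h3 : ((k + 1 : ℕ) : ENNReal) + 1 = (k : ENNReal) + 2 := by
    push_cast; rw [add_assoc, one_add_one_eq_two]
  rw [h3] at h2
  rw [← h2]
  refine lintegral_congr fun y => ?_
  rw [Pi.mul_apply, ← ENNReal.ofReal_mul (Real.exp_nonneg _), ← Real.exp_add]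
  congr 2
  push_cast; ring

theorem integral_exp_neg_expMeasure (k : ℕ) :
    Integrable (fun y => Real.exp (-y)) (expMeasure ((k : ℝ) + 1)) ∧
      ∫ y, Real.exp (-y) ∂expMeasure ((k : ℝ) + 1) = (k + 1) / (k + 2) := by
  refine ⟨Integrable.of_bound (by fun_prop) 1 ?_, ?_⟩
  · filter_upwards [ae_pos_expMeasure ((k : ℝ) + 1)] with y hy
    rw [Real.norm_of_nonneg (Real.exp_nonneg _)]
    exact Real.exp_le_one_iff.2 (by linarith)
  · rw [integral_eq_lintegral_of_nonneg_ae (Eventually.of_forall fun y => Real.exp_nonneg _)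
      (by fun_prop), lintegral_exp_neg_expMeasure, ENNReal.toReal_mul, ENNReal.toReal_inv,
      ENNReal.toReal_add (by simp) (by simp), ENNReal.toReal_add (by simp) (by simp)]
    simp [div_eq_mul_inv]

/-- The rational factors telescope to `n + 1`. They are chosen so that each factor of the product
has mean one when `d k` is Exp(k + 1). -/
theorem prod_wait_factors (d : ℕ → ℝ) (n : ℕ) :
    ∏ k ∈ Finset.range n, (((k : ℝ) + 2) / (k + 1) * Real.exp (-d k))
      = (n + 1) * Real.exp (-∑ k ∈ Finset.range n, d k) := by
  induction n with
  | zero => simp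
  | succ n ih =>
    rw [Finset.prod_range_succ, ih, Finset.sum_range_succ, neg_add, Real.exp_add]
    push_cast
    field_simp
    ring

theorem ae_exists_tendsto_splitTime :
    ∀ᵐ e ∂clockLaw Word, ∃ c,
      Tendsto (fun n : ℕ => ((n : ℝ) + 1) * Real.exp (-splitTime e n)) atTop (𝓝 c) := by
  have hm : ∀ k : ℕ, Measurable fun d : ℝ => ((k : ℝ) + 2) / (k + 1) * Real.exp (-d) :=
    fun k => by fun_prop
  have hmap : ∀ k : ℕ, (clockLaw Word).map (fun e => waitAt k ({[]}, e))
      = expMeasure ((k : ℝ) + 1) := fun k => (hasLaw_waitAt k).map_eq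
  have h := ae_exists_tendsto_prod_of_iIndepFun (μ := clockLaw Word)
    (Y := fun k e => ((k : ℝ) + 2) / (k + 1) * Real.exp (-waitAt k ({[]}, e)))
    (fun k => (hm k).comp (measurable_waitAt_root k)) (fun k e => by positivity)
    (iIndepFun_waitAt.comp (fun (k : ℕ) (d : ℝ) => ((k : ℝ) + 2) / (k + 1) * Real.exp (-d)) hm)
    (fun k => by
      refine Integrable.const_mul ?_ _
      have := (integral_exp_neg_expMeasure k).1
      rw [← hmap k] at this
      exact this.comp_measurable (measurable_waitAt_root k))
    (fun k => by
      have h1 := (integral_exp_neg_expMeasure k).2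
      rw [← hmap k, integral_map (measurable_waitAt_root k).aemeasurable (by fun_prop)] at h1
      rw [integral_const_mul, h1]
      field_simp)
  filter_upwards [h] with e ⟨c, hc⟩
  refine ⟨c, hc.congr fun n => ?_⟩
  rw [prod_wait_factors fun k => waitAt k ({[]}, e)]
  rfl

/-! ### The martingale of the binary search tree -/

noncomputable section

/-- The normalized level polynomial after the splits in `l`. -/
def historyM (z : ℝ) (l : List Word) : ℝ :=
  (bstC l.length z)⁻¹ * ∑ u ∈ leavesAfter {[]} l, z ^ u.length

theorem bstC_pos {z : ℝ} (hz : 0 < z) (n : ℕ) : 0 < bstC n z :=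
  Finset.prod_pos fun k _ => by positivity

theorem bstC_succ (n : ℕ) (z : ℝ) :
    bstC (n + 1) z = bstC n z * (((n : ℝ) + 2 * z) / ((n : ℝ) + 1)) :=
  Finset.prod_range_succ _ _

theorem bstM_eq_historyM {e : Word → ℝ} (he : IsGeneric e) (z : ℝ) (n : ℕ) :
    bstM z e n = historyM z (history n ({[]}, e)) := by
  rw [bstM, historyM, length_history, levelPoly, boundary_bst he, finsum_mem_coe_finset,
    leavesAt_eq_leavesAfter]

theorem leavesAfter_append (L : Finset Word) (l : List Word) (u : Word) :
    leavesAfter L (l ++ [u]) = splitLeaf (leavesAfter L l) u := by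
  simp [leavesAfter]

theorem sum_splitLeaf {L : Finset Word} (hL : IsFront L) {u : Word} (hu : u ∈ L) (z : ℝ) :
    ∑ w ∈ splitLeaf L u, z ^ w.length
      = ∑ w ∈ L, z ^ w.length + (2 * z - 1) * z ^ u.length := by
  rw [splitLeaf, Finset.sum_union, Finset.sum_pair (by simp), ← Finset.add_sum_erase L _ hu]
  · simp only [List.length_append, List.length_singleton, pow_succ]; ring
  · rw [Finset.disjoint_left]
    intro a ha h
    have ha := Finset.mem_of_mem_erase ha
    simp only [Finset.mem_insert, Finset.mem_singleton] at h
    rcases h with rfl | rfl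
    · exact hL.child_notMem hu _ ha
    · exact hL.child_notMem hu _ ha

/-- Splitting a leaf of depth `d` adds `(2z - 1) z ^ d`. With `n` the length of `l`, averaging over
the `n + 1` leaves multiplies the level polynomial by `(n + 2z) / (n + 1)`, which is the ratio of
consecutive constants `C_n(z)`. -/
theorem sum_historyM_append {z : ℝ} (hz : 0 < z) {l : List Word}
    (hL : IsFront (leavesAfter {[]} l)) (hcard : (leavesAfter {[]} l).card = l.length + 1) :
    ∑ u ∈ leavesAfter {[]} l, historyM z (l ++ [u]) = (l.length + 1) * historyM z l := by
  have hC := (bstC_pos hz l.length).ne'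
  have hn : (l.length : ℝ) + 2 * z ≠ 0 := by positivity
  have h1 : ∀ u ∈ leavesAfter {[]} l, historyM z (l ++ [u])
      = (bstC (l.length + 1) z)⁻¹ * (∑ w ∈ leavesAfter {[]} l, z ^ w.length
        + (2 * z - 1) * z ^ u.length) := by
    intro u hu
    rw [historyM, leavesAfter_append, sum_splitLeaf hL hu, List.length_append,
      List.length_singleton]
  rw [Finset.sum_congr rfl h1, ← Finset.mul_sum, Finset.sum_add_distrib, ← Finset.mul_sum,
    Finset.sum_const, hcard, nsmul_eq_mul, historyM, bstC_succ]
  push_cast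
  field_simp
  ring

/-- Makes every real function of the history bounded, hence integrable. -/
theorem finite_range_history (n : ℕ) :
    (Set.range fun e : Word → ℝ => history n ({[]}, e)).Finite := by
  induction n with
  | zero =>
    refine (Set.finite_singleton ([] : List Word)).subset ?_
    rintro _ ⟨e, rfl⟩
    rfl
  | succ n ih =>
    refine (ih.biUnion (t := fun l => (fun u => l ++ [u]) '' (leavesAfter {[]} l : Set Word))
      fun l _ => (Finset.finite_toSet _).image _).subset ?_
    rintro _ ⟨e, rfl⟩
    refine Set.mem_biUnion ⟨e, rfl⟩ ⟨splitAt n ({[]}, e), ?_, (history_succ' n _).symm⟩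
    rw [Finset.mem_coe, ← leavesAt_eq_leavesAfter]
    exact splitAt_mem_leavesAt e n

theorem integrable_comp_history (F : List Word → ℝ) (n : ℕ) :
    Integrable (fun e => F (history n ({[]}, e))) (clockLaw Word) := by
  set H := (finite_range_history n).toFinset
  refine Integrable.of_bound
    ((measurable_of_countable F).comp (measurable_history_root n)).aestronglyMeasurable
    (∑ l ∈ H, ‖F l‖) (Eventually.of_forall fun e => ?_)
  exact Finset.single_le_sum (f := fun l => ‖F l‖) (fun _ _ => norm_nonneg _)
    ((finite_range_history n).mem_toFinset.2 ⟨e, rfl⟩)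

theorem setIntegral_history_eq (F : List Word → ℝ) (n : ℕ) (l : List Word) :
    ∫ e in {e | history n ({[]}, e) = l}, F (history n ({[]}, e)) ∂clockLaw Word
      = (clockLaw Word).real {e | history n ({[]}, e) = l} * F l := by
  have hm : MeasurableSet {e : Word → ℝ | history n ({[]}, e) = l} :=
    measurable_history_root n (MeasurableSet.singleton l)
  rw [setIntegral_congr_fun (g := fun _ => F l) hm fun e he => by
      simp only [show history n ({[]}, e) = l from he], setIntegral_const, smul_eq_mul]

/-- The martingale property on one atom of the filtration: the atom is cut according to the next
split, which is uniform among the leaves. -/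
theorem setIntegral_historyM_succ {z : ℝ} (hz : 0 < z) (n : ℕ) (l : List Word) :
    ∫ e in {e | history n ({[]}, e) = l}, historyM z (history (n + 1) ({[]}, e)) ∂clockLaw Word
      = ∫ e in {e | history n ({[]}, e) = l}, historyM z (history n ({[]}, e)) ∂clockLaw Word := by
  by_cases hex : ∃ e₀, history n ({[]}, e₀) = l
  swap
  · push Not at hex
    have : {e : Word → ℝ | history n ({[]}, e) = l} = ∅ :=
      Set.eq_empty_iff_forall_notMem.2 fun e he => hex e he
    simp [this]
  obtain ⟨e₀, rfl⟩ := hex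
  set l := history n ({[]}, e₀) with hl
  have hlen : l.length = n := length_history _ _
  have hL : leavesAfter {[]} l = leavesAt e₀ n := (leavesAt_eq_leavesAfter e₀ n).symm
  have hfront : IsFront (leavesAfter {[]} l) := by rw [hL]; exact isFront_leavesAt e₀ n
  have hcard : (leavesAfter {[]} l).card = l.length + 1 := by rw [hL, card_leavesAt, hlen]
  have happ : ∀ (l₁ l₂ : List Word) (a b : Word),
      l₁ ++ [a] = l₂ ++ [b] ↔ l₁ = l₂ ∧ a = b := by simp
  have hset : {e : Word → ℝ | history n ({[]}, e) = l}
      = ⋃ u ∈ leavesAfter {[]} l, {e | history (n + 1) ({[]}, e) = l ++ [u]} := by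
    ext e
    simp only [Set.mem_ofPred_eq, Set.mem_iUnion, history_succ', happ, exists_prop]
    constructor
    · intro h
      refine ⟨_, ?_, h, rfl⟩
      rw [← h, ← leavesAt_eq_leavesAfter]
      exact splitAt_mem_leavesAt e n
    · rintro ⟨u, -, h, -⟩
      exact h
  rw [setIntegral_history_eq, hset, integral_biUnion_finset]
  · simp only [setIntegral_history_eq]
    have h1 : ∀ u ∈ leavesAfter {[]} l,
        (clockLaw Word).real {e | history (n + 1) ({[]}, e) = l ++ [u]} * historyM z (l ++ [u])
        = (clockLaw Word).real {e | history n ({[]}, e) = l} * ((l.length : ℝ) + 1)⁻¹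
          * historyM z (l ++ [u]) := by
      intro u hu
      have := clockLaw_history_append l u hu
      rw [hlen] at this
      rw [measureReal_def, this, ENNReal.toReal_mul, hcard, ENNReal.toReal_inv,
        ENNReal.toReal_natCast, Nat.cast_add_one, measureReal_def]
    rw [Finset.sum_congr rfl h1, ← Finset.mul_sum, sum_historyM_append hz hfront hcard, ← hset]
    have : (l.length : ℝ) + 1 ≠ 0 := by positivity
    field_simp
  · exact fun u _ => measurable_history_root (n + 1) (MeasurableSet.singleton _)
  · intro u _ v _ huv
    rw [Function.onFun, Set.disjoint_left]
    rintro e (h1 : _ = _) (h2 : _ = _)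
    exact huv ((happ _ _ _ _).1 (h1.symm.trans h2)).2
  · exact fun u _ => (integrable_comp_history (historyM z) (n + 1)).integrableOn

/-- The filtration generated by the successive splits. -/
def historyFiltration : Filtration ℕ (MeasurableSpace.pi : MeasurableSpace (Word → ℝ)) where
  seq n := MeasurableSpace.comap (fun e => history n ({[]}, e)) ⊤
  mono' n m h := by
    rintro _ ⟨S, -, rfl⟩
    refine ⟨(fun l => l.take n) ⁻¹' S, trivial, ?_⟩
    ext e
    simp only [Set.mem_preimage, take_history h]
  le' n := (measurable_history_root n).comap_le

theorem martingale_historyM {z : ℝ} (hz : 0 < z) :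
    Martingale (fun n e => historyM z (history n ({[]}, e))) historyFiltration
      (clockLaw Word) := by
  refine martingale_of_setIntegral_eq_succ (fun n => ?_)
    (fun n => integrable_comp_history (historyM z) n) fun n s hs => ?_
  · refine Measurable.stronglyMeasurable ?_
    exact (measurable_of_countable (historyM z)).comp
      (comap_measurable (fun e : Word → ℝ => history n ({[]}, e)))
  · classical
    obtain ⟨S, -, rfl⟩ := hs
    set H := (finite_range_history n).toFinset.filter (· ∈ S) with hH
    have hset : (fun e : Word → ℝ => history n ({[]}, e)) ⁻¹' S
        = ⋃ l ∈ H, {e | history n ({[]}, e) = l} := by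
      ext e
      simp only [Set.mem_preimage, hH, Finset.mem_filter, Set.Finite.mem_toFinset, Set.mem_range,
        Set.mem_iUnion, Set.mem_ofPred_eq, exists_prop]
      constructor
      · exact fun h => ⟨_, ⟨⟨e, rfl⟩, h⟩, rfl⟩
      · rintro ⟨l, ⟨-, h⟩, rfl⟩
        exact h
    have hm : ∀ l ∈ H, MeasurableSet {e : Word → ℝ | history n ({[]}, e) = l} :=
      fun l _ => measurable_history_root n (MeasurableSet.singleton l)
    have hd : (H : Set (List Word)).Pairwise
        (Function.onFun Disjoint fun l => {e : Word → ℝ | history n ({[]}, e) = l}) := by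
      intro l _ l' _ hll
      rw [Function.onFun, Set.disjoint_left]
      rintro e (h1 : _ = _) (h2 : _ = _)
      exact hll (h1.symm.trans h2)
    rw [hset, integral_biUnion_finset _ hm hd fun l _ =>
        (integrable_comp_history (historyM z) n).integrableOn,
      integral_biUnion_finset _ hm hd fun l _ =>
        (integrable_comp_history (historyM z) (n + 1)).integrableOn]
    exact Finset.sum_congr rfl fun l _ => (setIntegral_historyM_succ hz n l).symm

theorem historyM_nonneg {z : ℝ} (hz : 0 < z) (l : List Word) : 0 ≤ historyM z l :=
  mul_nonneg (inv_nonneg.2 (bstC_pos hz _).le)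
    (Finset.sum_nonneg fun _ _ => pow_nonneg hz.le _)

theorem ae_exists_tendsto_historyM {z : ℝ} (hz : 0 < z) :
    ∀ᵐ e ∂clockLaw Word, ∃ c,
      Tendsto (fun n => historyM z (history n ({[]}, e))) atTop (𝓝 c) :=
  ae_exists_tendsto_of_nonneg_martingale (martingale_historyM hz) fun _ =>
    Eventually.of_forall fun _ => historyM_nonneg hz _

end

/-! ### The law of the limit of `(n + 1) exp (-τ_n)` -/

theorem hasDerivAt_neg_exp_sub_pow (t : ℝ) (n : ℕ) (y : ℝ) :
    HasDerivAt (fun y => -(Real.exp (-y) - Real.exp (-t)) ^ (n + 1))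
      (((n : ℝ) + 1) * Real.exp (-y) * (Real.exp (-y) - Real.exp (-t)) ^ n) y := by
  have h1 : HasDerivAt (fun y : ℝ => Real.exp (-y) - Real.exp (-t)) (-Real.exp (-y)) y := by
    have := ((hasDerivAt_id y).neg.exp).sub_const (Real.exp (-t))
    simpa using this
  have h2 := (h1.pow (n + 1)).neg
  refine h2.congr_deriv ?_
  push_cast
  ring

/-- The induction step for the law of the split times: adding an independent Exp(n + 1) variable
raises the power of the distribution function `1 - exp (-t)` by one. -/
theorem lintegral_expMeasure_convolution (n : ℕ) {t : ℝ} (ht : 0 ≤ t) :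
    ∫⁻ y, (if 0 ≤ t - y then ENNReal.ofReal ((1 - Real.exp (-(t - y))) ^ n) else 0)
        ∂expMeasure ((n : ℝ) + 1)
      = ENNReal.ofReal ((1 - Real.exp (-t)) ^ (n + 1)) := by
  have hme : Measurable fun y : ℝ =>
      if 0 ≤ t - y then ENNReal.ofReal ((1 - Real.exp (-(t - y))) ^ n) else 0 :=
    Measurable.ite (measurableSet_le measurable_const (measurable_const.sub measurable_id))
      (by fun_prop) measurable_const
  -- Distributing one factor `exp (-y)` to each of the `n` powers turns the integrand into the exact
  -- derivative of `-(exp (-y) - exp (-t)) ^ (n + 1)`.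
  set h : ℝ → ℝ := fun y =>
    ((n : ℝ) + 1) * Real.exp (-y) * (Real.exp (-y) - Real.exp (-t)) ^ n with hh
  have hcont : Continuous h := by fun_prop
  have h0 : ∀ y ∈ Set.Icc 0 t, 0 ≤ h y := fun y hy => by
    have : Real.exp (-t) ≤ Real.exp (-y) := Real.exp_le_exp.2 (by linarith [hy.2])
    have : 0 ≤ Real.exp (-y) - Real.exp (-t) := by linarith
    positivity
  rw [expMeasure_eq_withDensity, lintegral_withDensity_eq_lintegral_mul _
    (measurable_exponentialPDF _) hme]
  have hpt : ∀ y, (exponentialPDF ((n : ℝ) + 1) * fun y =>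
      if 0 ≤ t - y then ENNReal.ofReal ((1 - Real.exp (-(t - y))) ^ n) else 0) y
      = (Set.Icc 0 t).indicator (fun y => ENNReal.ofReal (h y)) y := by
    intro y
    rw [Pi.mul_apply]
    rcases lt_or_ge y 0 with hy | hy
    · rw [exponentialPDF_of_neg hy, zero_mul, Set.indicator_of_notMem]
      exact fun hm => absurd hm.1 (not_le.2 hy)
    · by_cases hyt : 0 ≤ t - y
      · rw [if_pos hyt, exponentialPDF_of_nonneg hy, Set.indicator_of_mem (by
          exact ⟨hy, by linarith⟩), ← ENNReal.ofReal_mul (by positivity)]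
        congr 1
        have e1 : Real.exp (-y) - Real.exp (-t)
            = Real.exp (-y) * (1 - Real.exp (-(t - y))) := by
          rw [mul_sub, mul_one, ← Real.exp_add]; congr 2; ring
        have e2 : Real.exp (-(((n : ℝ) + 1) * y)) = Real.exp (-y) * Real.exp (-y) ^ n := by
          rw [← pow_succ', ← Real.exp_nat_mul]; congr 1; push_cast; ring
        rw [hh]
        simp only
        rw [e1, e2, mul_pow]; ring
      · rw [if_neg hyt, mul_zero, Set.indicator_of_notMem]
        exact fun hm => hyt (by linarith [hm.2])
  rw [lintegral_congr hpt, lintegral_indicator measurableSet_Icc,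
    ← ofReal_integral_eq_lintegral_ofReal]
  · congr 1
    rw [integral_Icc_eq_integral_Ioc, ← intervalIntegral.integral_of_le ht,
      intervalIntegral.integral_eq_sub_of_hasDerivAt
        (fun y _ => hasDerivAt_neg_exp_sub_pow t n y) (hcont.intervalIntegrable _ _)]
    simp
  · exact hcont.integrableOn_Icc
  · exact (ae_restrict_iff' measurableSet_Icc).2 (Eventually.of_forall h0)

theorem measurable_splitTime (n : ℕ) : Measurable fun e : Word → ℝ => splitTime e n :=
  Finset.measurable_sum _ fun k _ => measurable_waitAt_root k

theorem indepFun_splitTime_waitAt (n : ℕ) :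
    IndepFun (fun e : Word → ℝ => splitTime e n) (fun e => waitAt n ({[]}, e))
      (clockLaw Word) := by
  have := iIndepFun_waitAt.indepFun_finsetSum_of_notMem measurable_waitAt_root
    (s := Finset.range n) (i := n) (by simp)
  have h : (∑ k ∈ Finset.range n, fun e : Word → ℝ => waitAt k ({[]}, e))
      = fun e => splitTime e n := by
    funext e; simp [splitTime, Finset.sum_apply]
  rwa [h] at this

/-- The `n`-th split time is distributed as the maximum of `n` independent exponential variables. -/
theorem clockLaw_splitTime_le (n : ℕ) (t : ℝ) :
    clockLaw Word {e | splitTime e n ≤ t}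
      = if 0 ≤ t then ENNReal.ofReal ((1 - Real.exp (-t)) ^ n) else 0 := by
  by_cases ht : 0 ≤ t
  swap
  · rw [if_neg ht]
    refine measure_mono_null (t := {e | ¬ IsGeneric e}) ?_ (ae_iff.1 ae_isGeneric)
    intro e (he : splitTime e n ≤ t) hg
    exact ht ((describes_leavesAt hg n).nonneg.trans he)
  induction n generalizing t with
  | zero => simp [splitTime_zero, ht]
  | succ n ih =>
    have hX := measurable_splitTime n
    have hY := measurable_waitAt_root n
    have hind := (indepFun_iff_map_prod_eq_prod_map_map hX.aemeasurable hY.aemeasurable).1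
      (indepFun_splitTime_waitAt n)
    have hms : MeasurableSet {p : ℝ × ℝ | p.1 + p.2 ≤ t} :=
      measurableSet_le (measurable_fst.add measurable_snd) measurable_const
    have h1 : clockLaw Word {e | splitTime e (n + 1) ≤ t}
        = (clockLaw Word).map (fun e => (splitTime e n, waitAt n ({[]}, e)))
          {p : ℝ × ℝ | p.1 + p.2 ≤ t} := by
      rw [Measure.map_apply (hX.prodMk hY) hms]
      simp only [splitTime_succ]
      rfl
    rw [if_pos ht, h1, hind, Measure.prod_apply_symm hms, (hasLaw_waitAt n).map_eq,
      ← lintegral_expMeasure_convolution n ht]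
    refine lintegral_congr fun y => ?_
    have h2 : ((fun x => (x, y)) ⁻¹' {p : ℝ × ℝ | p.1 + p.2 ≤ t}) = Set.Iic (t - y) := by
      ext x
      simp only [Set.mem_preimage, Set.mem_ofPred_eq, Set.mem_Iic]
      constructor <;> intro h <;> linarith
    rw [h2, Measure.map_apply hX measurableSet_Iic]
    change clockLaw Word {e | splitTime e n ≤ t - y} = _
    by_cases hy : 0 ≤ t - y
    · rw [ih (t - y) hy]
    · rw [if_neg hy]
      refine measure_mono_null (t := {e | ¬ IsGeneric e}) ?_ (ae_iff.1 ae_isGeneric)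
      intro e (he : splitTime e n ≤ t - y) hg
      exact hy ((describes_leavesAt hg n).nonneg.trans he)

theorem tendsto_one_sub_div_pow (x : ℝ) :
    Tendsto (fun n : ℕ => (1 - x / ((n : ℝ) + 1)) ^ n) atTop (𝓝 (Real.exp (-x))) := by
  have h1 : Tendsto (fun n : ℕ => (1 - x / ((n : ℝ) + 1)) ^ (n + 1)) atTop
      (𝓝 (Real.exp (-x))) := by
    have := (tendsto_add_atTop_iff_nat 1).2 (Real.tendsto_one_add_div_pow_exp (-x))
    refine this.congr fun n => ?_
    push_cast
    rw [neg_div, sub_eq_add_neg]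
  have h2 : Tendsto (fun n : ℕ => 1 - x / ((n : ℝ) + 1)) atTop (𝓝 1) := by
    have : Tendsto (fun n : ℕ => x / ((n : ℝ) + 1)) atTop (𝓝 0) :=
      (tendsto_const_nhds (x := x)).div_atTop
        (tendsto_atTop_add_const_right _ _ tendsto_natCast_atTop_atTop)
    simpa using this.const_sub 1
  have h3 := h1.div h2 one_ne_zero
  rw [div_one] at h3
  refine h3.congr' ?_
  filter_upwards [h2.eventually_ne one_ne_zero] with n hn
  simp only [Pi.div_apply]
  rw [pow_succ, mul_div_assoc, div_self hn, mul_one]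

theorem tendsto_clockLaw_le_scaled {x : ℝ} (hx : 0 < x) :
    Tendsto (fun n : ℕ => clockLaw Word {e | x ≤ ((n : ℝ) + 1) * Real.exp (-splitTime e n)})
      atTop (𝓝 (ENNReal.ofReal (Real.exp (-x)))) := by
  refine (ENNReal.tendsto_ofReal (tendsto_one_sub_div_pow x)).congr' ?_
  -- For these `n` the threshold time `-log (x / (n + 1))` is nonnegative, so the formula for the
  -- law of the split time gives `(1 - x / (n + 1)) ^ n`.
  filter_upwards [eventually_ge_atTop ⌈x⌉₊] with n hn
  have hxn : x ≤ n := Nat.ceil_le.1 hn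
  have hn1 : 0 < (n : ℝ) + 1 := by positivity
  have hq : 0 < x / ((n : ℝ) + 1) := by positivity
  have hset : {e : Word → ℝ | x ≤ ((n : ℝ) + 1) * Real.exp (-splitTime e n)}
      = {e | splitTime e n ≤ -Real.log (x / ((n : ℝ) + 1))} := by
    ext e
    simp only [Set.mem_ofPred_eq]
    rw [← div_le_iff₀' hn1, ← Real.log_le_iff_le_exp hq, le_neg]
  have hlog : 0 ≤ -Real.log (x / ((n : ℝ) + 1)) := by
    rw [neg_nonneg]
    exact Real.log_nonpos hq.le ((div_le_one hn1).2 (by linarith))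
  rw [hset, clockLaw_splitTime_le, if_pos hlog, neg_neg, Real.exp_log hq]

/-- Fatou's lemma for sets. -/
theorem measure_le_of_forall_eventually_mem {Ω : Type*} {m : MeasurableSpace Ω} {μ : Measure Ω}
    {A : Set Ω} {S : ℕ → Set Ω} (hA : MeasurableSet A) (hS : ∀ n, MeasurableSet (S n))
    (h : ∀ᵐ ω ∂μ, ω ∈ A → ∀ᶠ n in atTop, ω ∈ S n) {c : ENNReal}
    (hc : Tendsto (fun n => μ (S n)) atTop (𝓝 c)) : μ A ≤ c := by
  have h1 : ∫⁻ ω, A.indicator 1 ω ∂μ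
      ≤ ∫⁻ ω, liminf (fun n => (S n).indicator (1 : Ω → ENNReal) ω) atTop ∂μ := by
    refine lintegral_mono_ae ?_
    filter_upwards [h] with ω hω
    by_cases hωA : ω ∈ A
    · refine le_liminf_of_le (f := atTop) (by isBoundedDefault) ?_
      filter_upwards [hω hωA] with n hn
      simp [hωA, hn]
    · simp [hωA]
  have h2 := lintegral_liminf_le (μ := μ) (u := atTop) (f := fun n ω => (S n).indicator (1 : Ω → ENNReal) ω)
    fun n => measurable_one.indicator (hS n)
  simp only [lintegral_indicator_one hA, lintegral_indicator_one (hS _)] at h1 h2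
  rw [hc.liminf_eq] at h2
  exact h1.trans h2

/-- Fatou's lemma bounds open rays from above and closed rays from below; continuity of `exp` closes
the gap. At `x = 0` the upper bound is just total mass one. -/
theorem measure_Ioi_eq_of_tail_bounds {ν : Measure ℝ} [IsProbabilityMeasure ν]
    (h1 : ∀ x, 0 < x → ν (Set.Ioi x) ≤ ENNReal.ofReal (Real.exp (-x)))
    (h2 : ∀ x, 0 < x → ENNReal.ofReal (Real.exp (-x)) ≤ ν (Set.Ici x)) {x : ℝ} (hx : 0 ≤ x) :
    ν (Set.Ioi x) = ENNReal.ofReal (Real.exp (-x)) := by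
  have hge : ENNReal.ofReal (Real.exp (-x)) ≤ ν (Set.Ioi x) := by
    have hc : Continuous fun y : ℝ => ENNReal.ofReal (Real.exp (-y)) :=
      ENNReal.continuous_ofReal.comp (by fun_prop)
    refine le_of_tendsto ((hc.tendsto x).mono_left (nhdsWithin_le_nhds (s := Set.Ioi x))) ?_
    filter_upwards [self_mem_nhdsWithin] with y (hy : x < y)
    exact (h2 y (hx.trans_lt hy)).trans (measure_mono fun w hw => hy.trans_le hw)
  rcases hx.eq_or_lt with rfl | hx'
  · refine le_antisymm ?_ hge
    simpa using prob_le_one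
  · exact le_antisymm (h1 x hx') hge

theorem expMeasure_one_Ioi {x : ℝ} (hx : 0 ≤ x) :
    expMeasure 1 (Set.Ioi x) = ENNReal.ofReal (Real.exp (-x)) := by
  have := expMeasure_one_shift hx MeasurableSet.univ
  simpa [Set.Ioi] using this

theorem eq_expMeasure_one_of_Ioi {ν : Measure ℝ} [IsProbabilityMeasure ν]
    (h : ∀ x, 0 ≤ x → ν (Set.Ioi x) = ENNReal.ofReal (Real.exp (-x))) : ν = expMeasure 1 := by
  have hIic : ∀ (ρ : Measure ℝ) [IsProbabilityMeasure ρ] (x : ℝ),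
      ρ (Set.Iic x) = 1 - ρ (Set.Ioi x) := fun ρ _ x => by
    rw [← prob_compl_eq_one_sub measurableSet_Ioi, Set.compl_Ioi]
  refine Measure.ext_of_Iic _ _ fun x => ?_
  rcases le_or_gt 0 x with hx | hx
  · rw [hIic, hIic, h x hx, expMeasure_one_Ioi hx]
  · have h0 : ∀ (ρ : Measure ℝ) [IsProbabilityMeasure ρ],
        ρ (Set.Ioi 0) = ENNReal.ofReal (Real.exp (-0)) → ρ (Set.Iic x) = 0 := by
      intro ρ _ hρ
      refine measure_mono_null (Set.Iic_subset_Iic.2 hx.le) ?_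
      rw [hIic, hρ]; simp
    rw [h0 ν (h 0 le_rfl), h0 _ (expMeasure_one_Ioi le_rfl)]

noncomputable section

/-- The limit of `(n + 1) exp (-τ_n)` as a function of the waiting times. -/
def waitLimit (d : ℕ → ℝ) : ℝ :=
  limsup (fun n : ℕ => ((n : ℝ) + 1) * Real.exp (-∑ k ∈ Finset.range n, d k)) atTop

/-- Taking a `limsup` gives a function measurable on all sequences, convergent or not, so that
independence and laws can be pushed through it. -/
theorem measurable_waitLimit : Measurable waitLimit :=
  Measurable.limsup fun n => by fun_prop

/-- The limit of the martingale of the binary search tree as a function of the splits. -/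
def splitLimit (z : ℝ) (v : ℕ → Word) : ℝ :=
  limsup (fun n : ℕ => historyM z ((List.range n).map v)) atTop

theorem measurable_map_range (n : ℕ) : Measurable fun v : ℕ → Word => (List.range n).map v := by
  induction n with
  | zero => exact measurable_const
  | succ n ih =>
    simp only [List.range_succ, List.map_append, List.map_cons, List.map_nil]
    exact (measurable_of_countable fun p : List Word × Word => p.1 ++ [p.2]).comp
      (ih.prodMk (measurable_pi_apply n))

theorem measurable_splitLimit (z : ℝ) : Measurable (splitLimit z) :=
  Measurable.limsup fun n => (measurable_of_countable (historyM z)).comp (measurable_map_range n)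

theorem ae_tendsto_waitLimit :
    ∀ᵐ e ∂clockLaw Word, Tendsto (fun n : ℕ => ((n : ℝ) + 1) * Real.exp (-splitTime e n)) atTop
      (𝓝 (waitLimit fun k => waitAt k ({[]}, e))) := by
  filter_upwards [ae_exists_tendsto_splitTime] with e ⟨c, hc⟩
  have : waitLimit (fun k => waitAt k ({[]}, e)) = c := hc.limsup_eq
  rwa [this]

theorem ae_tendsto_splitLimit {z : ℝ} (hz : 0 < z) :
    ∀ᵐ e ∂clockLaw Word, Tendsto (fun n : ℕ => historyM z (history n ({[]}, e))) atTop
      (𝓝 (splitLimit z fun k => splitAt k ({[]}, e))) := by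
  filter_upwards [ae_exists_tendsto_historyM hz] with e ⟨c, hc⟩
  have : splitLimit z (fun k => splitAt k ({[]}, e)) = c := hc.limsup_eq
  rwa [this]

/-- The tails of `(n + 1) exp (-τ_n)` converge to those of Exp(1). Fatou for the events `X > x` and
`X < x` passes this to the almost sure limit. -/
theorem hasLaw_waitLimit :
    HasLaw (fun e : Word → ℝ => waitLimit fun k => waitAt k ({[]}, e)) (expMeasure 1)
      (clockLaw Word) := by
  set X : (Word → ℝ) → ℝ := fun e => waitLimit fun k => waitAt k ({[]}, e) with hX
  have hm : Measurable X := measurable_waitLimit.comp measurable_waits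
  have hS : ∀ n : ℕ, Measurable fun e : Word → ℝ => ((n : ℝ) + 1) * Real.exp (-splitTime e n) :=
    fun n => (Real.measurable_exp.comp (measurable_splitTime n).neg).const_mul _
  have : IsProbabilityMeasure ((clockLaw Word).map X) := Measure.isProbabilityMeasure_map
    hm.aemeasurable
  refine ⟨hm.aemeasurable, eq_expMeasure_one_of_Ioi fun x hx =>
    measure_Ioi_eq_of_tail_bounds (fun x hx => ?_) (fun x hx => ?_) hx⟩
  · rw [Measure.map_apply hm measurableSet_Ioi]
    refine measure_le_of_forall_eventually_mem (hm measurableSet_Ioi)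
      (fun n => measurableSet_le measurable_const (hS n)) ?_ (tendsto_clockLaw_le_scaled hx)
    filter_upwards [ae_tendsto_waitLimit] with e he hxe
    filter_upwards [he.eventually_const_lt hxe] with n hn using hn.le
  · rw [Measure.map_apply hm measurableSet_Ici]
    have hcompl : clockLaw Word (X ⁻¹' Set.Iio x) ≤ 1 - ENNReal.ofReal (Real.exp (-x)) := by
      refine measure_le_of_forall_eventually_mem (hm measurableSet_Iio)
        (S := fun n => {e | x ≤ ((n : ℝ) + 1) * Real.exp (-splitTime e n)}ᶜ)
        (fun n => (measurableSet_le measurable_const (hS n)).compl) ?_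
        (c := 1 - ENNReal.ofReal (Real.exp (-x))) ?_
      · filter_upwards [ae_tendsto_waitLimit] with e he hxe
        filter_upwards [he.eventually_lt_const hxe] with n hn
        simpa using hn
      · have := ENNReal.Tendsto.sub (tendsto_const_nhds (x := (1 : ENNReal)))
          (tendsto_clockLaw_le_scaled hx) (Or.inl ENNReal.one_ne_top)
        refine this.congr fun n => ?_
        rw [← prob_compl_eq_one_sub (measurableSet_le measurable_const (hS n))]
    have hle : ENNReal.ofReal (Real.exp (-x)) ≤ 1 := by
      rw [← ENNReal.ofReal_one]
      exact ENNReal.ofReal_le_ofReal (Real.exp_le_one_iff.2 (by linarith))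
    have hIci : X ⁻¹' Set.Ici x = (X ⁻¹' Set.Iio x)ᶜ := by
      rw [← Set.preimage_compl, Set.compl_Iio]
    rw [hIci, prob_compl_eq_one_sub (hm measurableSet_Iio)]
    refine ENNReal.le_sub_of_add_le_left (measure_ne_top _ _) ?_
    calc clockLaw Word (X ⁻¹' Set.Iio x) + ENNReal.ofReal (Real.exp (-x))
        ≤ (1 - ENNReal.ofReal (Real.exp (-x))) + ENNReal.ofReal (Real.exp (-x)) := by gcongr
      _ = 1 := tsub_add_cancel_of_le hle

/-- The independence of `ξ` and `𝓜_∞(z)`: one is a function of the waiting times, the other of the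
splits. -/
theorem indepFun_waitLimit_splitLimit (z : ℝ) :
    IndepFun (fun e : Word → ℝ => waitLimit fun k => waitAt k ({[]}, e))
      (fun e => splitLimit z fun k => splitAt k ({[]}, e)) (clockLaw Word) :=
  indepFun_splits_waits.symm.comp measurable_waitLimit (measurable_splitLimit z)

end

/-! ### The limit martingale connection -/

theorem prod_two_mul_add (z : ℝ) (n : ℕ) :
    ∏ j ∈ Finset.range n, (2 * z + j) = bstC n z * n.factorial := by
  induction n with
  | zero => simp [bstC]
  | succ n ih =>
    rw [Finset.prod_range_succ, ih, bstC_succ, Nat.factorial_succ]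
    push_cast
    field_simp
    ring

/-- The normalizing constants satisfy `C_n(z) ~ n ^ (2 z - 1) / Γ(2 z)`. -/
theorem tendsto_bstC_div {z : ℝ} (hz : 0 < z) :
    Tendsto (fun n : ℕ => bstC n z / ((n : ℝ) + 1) ^ (2 * z - 1)) atTop
      (𝓝 (Real.Gamma (2 * z))⁻¹) := by
  have h2z : 0 < 2 * z := by positivity
  have hG : Real.Gamma (2 * z) ≠ 0 := (Real.Gamma_pos_of_pos h2z).ne'
  have h1 : Tendsto (fun n : ℕ => (n : ℝ) / ((n : ℝ) + 1)) atTop (𝓝 1) :=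
    tendsto_natCast_div_add_atTop (1 : ℝ)
  have h2 : Tendsto (fun n : ℕ => (n : ℝ) / ((n : ℝ) + 2 * z)) atTop (𝓝 1) :=
    tendsto_natCast_div_add_atTop (2 * z)
  -- The quotient is `(n / (n + 1)) ^ (2z - 1) * (n / (n + 2z))` divided by Euler's sequence for
  -- `Γ(2z)`, whose product contains the extra factor `n + 2z`.
  have h3 := (h1.rpow_const (p := 2 * z - 1) (Or.inl one_ne_zero)).mul
    (h2.mul ((Real.GammaSeq_tendsto_Gamma (2 * z)).inv₀ hG))
  rw [Real.one_rpow, one_mul, one_mul] at h3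
  refine h3.congr' ?_
  filter_upwards [eventually_ge_atTop 1] with n hn
  have hn0 : 0 < (n : ℝ) := by exact_mod_cast hn
  have hn1 : 0 < (n : ℝ) + 1 := by positivity
  have hC := bstC_pos hz n
  have hf : (0 : ℝ) < n.factorial := by exact_mod_cast n.factorial_pos
  have hseq : Real.GammaSeq (2 * z) n
      = (n : ℝ) ^ (2 * z - 1) * n / (bstC n z * (2 * z + n)) := by
    rw [Real.GammaSeq, Finset.prod_range_succ, prod_two_mul_add, Real.rpow_sub_one hn0.ne']
    field_simp
  rw [hseq, Real.div_rpow hn0.le hn1.le]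
  have hp : 0 < (n : ℝ) ^ (2 * z - 1) := Real.rpow_pos_of_pos hn0 _
  have hq : 0 < ((n : ℝ) + 1) ^ (2 * z - 1) := Real.rpow_pos_of_pos hn1 _
  have hs : (n : ℝ) + 2 * z ≠ 0 := by positivity
  have hs' : 2 * z + (n : ℝ) ≠ 0 := by positivity
  field_simp
  ring

/-- Absence of explosion: a finite limit of `(n + 1) exp (-τ_n)` forces `exp (-τ_n)` to vanish. -/
theorem tendsto_splitTime_atTop {e : Word → ℝ} {x : ℝ}
    (h : Tendsto (fun n : ℕ => ((n : ℝ) + 1) * Real.exp (-splitTime e n)) atTop (𝓝 x)) :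
    Tendsto (splitTime e) atTop atTop := by
  have h1 : Tendsto (fun n : ℕ => Real.exp (-splitTime e n)) atTop (𝓝 0) := by
    have h2 : Tendsto (fun n : ℕ => (n : ℝ) + 1) atTop atTop :=
      tendsto_atTop_add_const_right _ _ tendsto_natCast_atTop_atTop
    refine (h.div_atTop h2).congr fun n => ?_
    have : (n : ℝ) + 1 ≠ 0 := by positivity
    field_simp
  rw [Real.tendsto_exp_comp_nhds_zero] at h1
  exact tendsto_neg_atBot_iff.1 h1

theorem exists_splitTime_interval {e : Word → ℝ} (h : Tendsto (splitTime e) atTop atTop) {t : ℝ}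
    (ht : 0 ≤ t) : ∃ n, splitTime e n ≤ t ∧ t < splitTime e (n + 1) := by
  obtain ⟨n, hn⟩ := (h.eventually_gt_atTop t).exists
  obtain ⟨m, -, hm⟩ := exists_splitTime_le_lt e ht hn
  exact ⟨m, hm⟩

theorem exists_index_tendsto {e : Word → ℝ} (he : IsGeneric e)
    (h : Tendsto (splitTime e) atTop atTop) :
    ∃ N : ℝ → ℕ, Tendsto N atTop atTop ∧
      ∀ t, 0 ≤ t → splitTime e (N t) ≤ t ∧ t < splitTime e (N t + 1) := by
  have hex : ∀ t, ∃ n, 0 ≤ t → splitTime e n ≤ t ∧ t < splitTime e (n + 1) := fun t => by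
    by_cases ht : 0 ≤ t
    · obtain ⟨n, hn⟩ := exists_splitTime_interval h ht
      exact ⟨n, fun _ => hn⟩
    · exact ⟨0, fun h => absurd h ht⟩
  choose N hN using hex
  refine ⟨N, tendsto_atTop.2 fun m => ?_, hN⟩
  filter_upwards [eventually_ge_atTop (splitTime e m), eventually_ge_atTop 0] with t ht ht0
  have := (splitTime_strictMono he).lt_iff_lt.1 (ht.trans_lt (hN t ht0).2)
  omega

/-- Sandwich `t` between consecutive split times. The two bounds have the same limit because `(n +
1) / (n + 2)` tends to one. -/
theorem tendsto_exp_neg_mul_index {e : Word → ℝ} {x : ℝ}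
    (h : Tendsto (fun n : ℕ => ((n : ℝ) + 1) * Real.exp (-splitTime e n)) atTop (𝓝 x))
    {N : ℝ → ℕ} (hN : Tendsto N atTop atTop)
    (hNt : ∀ t, 0 ≤ t → splitTime e (N t) ≤ t ∧ t < splitTime e (N t + 1)) :
    Tendsto (fun t => ((N t : ℝ) + 1) * Real.exp (-t)) atTop (𝓝 x) := by
  have h1 : Tendsto (fun n : ℕ => ((n : ℝ) + 1) * Real.exp (-splitTime e (n + 1))) atTop
      (𝓝 x) := by
    have h2 := (tendsto_add_atTop_iff_nat 1).2 h
    have h3 := h2.mul ((tendsto_add_atTop_iff_nat 1).2 (tendsto_natCast_div_add_atTop (1 : ℝ)))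
    rw [mul_one] at h3
    refine h3.congr fun n => ?_
    push_cast
    have : (n : ℝ) + 1 + 1 ≠ 0 := by positivity
    field_simp
  refine tendsto_of_tendsto_of_tendsto_of_le_of_le' (h1.comp hN) (h.comp hN) ?_ ?_
  · filter_upwards [eventually_ge_atTop 0] with t ht
    simp only [Function.comp_apply]
    gcongr
    exact (hNt t ht).2.le
  · filter_upwards [eventually_ge_atTop 0] with t ht
    simp only [Function.comp_apply]
    gcongr
    exact (hNt t ht).1

theorem tendsto_exp_neg_mul_numLeaves {e : Word → ℝ} (he : IsGeneric e) {x : ℝ}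
    (h : Tendsto (fun n : ℕ => ((n : ℝ) + 1) * Real.exp (-splitTime e n)) atTop (𝓝 x)) :
    Tendsto (fun t => Real.exp (-t) * (numLeaves e t : ℝ)) atTop (𝓝 x) := by
  obtain ⟨N, hN, hNt⟩ := exists_index_tendsto he (tendsto_splitTime_atTop h)
  refine (tendsto_exp_neg_mul_index h hN hNt).congr' ?_
  filter_upwards [eventually_ge_atTop 0] with t ht
  rw [numLeaves_eq he (hNt t ht).1 (hNt t ht).2, mul_comm]
  push_cast
  rfl

/-- Between two splits, `M(t, z)` factors into `((n + 1) exp (-t)) ^ (2z - 1)`, the normalized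
constant and `𝓜_n(z)`, each of which converges. Positivity of `x` makes the power continuous there
even when `2z - 1` is negative. -/
theorem tendsto_yuleM {e : Word → ℝ} (he : IsGeneric e) {z : ℝ} (hz : 0 < z) {x b : ℝ}
    (hx : 0 < x)
    (h : Tendsto (fun n : ℕ => ((n : ℝ) + 1) * Real.exp (-splitTime e n)) atTop (𝓝 x))
    (hb : Tendsto (fun n : ℕ => historyM z (history n ({[]}, e))) atTop (𝓝 b)) :
    Tendsto (yuleM z e) atTop (𝓝 (x ^ (2 * z - 1) / Real.Gamma (2 * z) * b)) := by
  obtain ⟨N, hN, hNt⟩ := exists_index_tendsto he (tendsto_splitTime_atTop h)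
  have h1 := (tendsto_exp_neg_mul_index h hN hNt).rpow_const (p := 2 * z - 1) (Or.inl hx.ne')
  have h2 := (h1.mul ((tendsto_bstC_div hz).comp hN)).mul (hb.comp hN)
  rw [← div_eq_mul_inv] at h2
  refine h2.congr' ?_
  filter_upwards [eventually_ge_atTop 0] with t ht
  have hn1 : 0 < (N t : ℝ) + 1 := by positivity
  have hp := (Real.rpow_pos_of_pos hn1 (2 * z - 1)).ne'
  have hC := (bstC_pos hz (N t)).ne'
  have hexp : Real.exp (-t) ^ (2 * z - 1) = Real.exp (t * (1 - 2 * z)) := by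
    rw [← Real.exp_mul]; congr 1; ring
  simp only [Function.comp_apply]
  rw [yuleM, levelPoly_tree_eq he (hNt t ht).1 (hNt t ht).2, historyM, length_history,
    ← leavesAt_eq_leavesAfter, Real.mul_rpow hn1.le (Real.exp_nonneg _), hexp]
  field_simp

/-- Generic lifetimes for which all the limits exist. -/
structure HasLimits (z : ℝ) (e : Word → ℝ) : Prop where
  generic : IsGeneric e
  splitTime_atTop : Tendsto (splitTime e) atTop atTop
  xi_pos : 0 < xi e
  tendsto_xi : Tendsto (fun t => Real.exp (-t) * (numLeaves e t : ℝ)) atTop (𝓝 (xi e))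
  tendsto_yuleM : Tendsto (fun t => yuleM z e t) atTop (𝓝 (yuleMInf z e))
  tendsto_bstM : Tendsto (fun n => bstM z e n) atTop (𝓝 (bstMInf z e))
  xi_eq : xi e = waitLimit fun k => waitAt k ({[]}, e)
  bstMInf_eq : bstMInf z e = splitLimit z fun k => splitAt k ({[]}, e)
  yuleMInf_eq : yuleMInf z e = xi e ^ (2 * z - 1) / Real.Gamma (2 * z) * bstMInf z e

theorem ae_hasLimits {z : ℝ} (hz : 0 < z) : ∀ᵐ e ∂clockLaw Word, HasLimits z e := by
  have hpos : ∀ᵐ e ∂clockLaw Word, 0 < waitLimit fun k => waitAt k ({[]}, e) := by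
    have h := ae_pos_expMeasure 1
    rw [← hasLaw_waitLimit.map_eq] at h
    exact ae_of_ae_map hasLaw_waitLimit.aemeasurable h
  filter_upwards [ae_isGeneric, ae_tendsto_waitLimit, ae_tendsto_splitLimit hz, hpos]
    with e he hx hb hx0
  have h1 := tendsto_exp_neg_mul_numLeaves he hx
  have h2 := tendsto_yuleM he hz hx0 hx hb
  have h3 : Tendsto (fun n => bstM z e n) atTop
      (𝓝 (splitLimit z fun k => splitAt k ({[]}, e))) :=
    hb.congr fun n => (bstM_eq_historyM he z n).symm
  have e1 : xi e = waitLimit fun k => waitAt k ({[]}, e) := h1.limUnder_eq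
  have e2 : yuleMInf z e = _ := h2.limUnder_eq
  have e3 : bstMInf z e = splitLimit z fun k => splitAt k ({[]}, e) := h3.limUnder_eq
  exact
    { generic := he
      splitTime_atTop := tendsto_splitTime_atTop hx
      xi_pos := by rw [e1]; exact hx0
      tendsto_xi := by rw [e1]; exact h1
      tendsto_yuleM := by rw [e2]; exact h2
      tendsto_bstM := by rw [e3]; exact h3
      xi_eq := e1
      bstMInf_eq := e3
      yuleMInf_eq := by rw [e2, e1, e3] }

/-! ### The subtrees of the root -/

theorem measurable_shift (w : Word) : Measurable (shift w) :=
  measurable_pi_lambda _ fun v => measurable_pi_apply (w ++ v)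

theorem measurePreserving_shift (w : Word) :
    MeasurePreserving (shift w) (clockLaw Word) (clockLaw Word) :=
  ⟨measurable_shift w,
    Measure.map_infinitePi_infinitePi_of_inj (P := fun _ : Word => expMeasure 1)
      (f := fun v => w ++ v) (List.append_right_injective w)⟩

theorem birth_cons (e : Word → ℝ) (b : Bool) (u : Word) :
    birth e (b :: u) = e [] + birth (shift [b] e) u := by
  have h := birth_append e [b] u
  have h' := birth_concat e [] b
  rw [death, birth_nil, zero_add, List.nil_append] at h'
  rw [← h', ← h]
  rfl

theorem death_cons (e : Word → ℝ) (b : Bool) (u : Word) :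
    death e (b :: u) = e [] + death (shift [b] e) u := by
  rw [death, death, birth_cons, add_assoc]
  rfl

/-- Birth and death times below a child of the root are those of its subtree delayed by `e []`, and
from that time on the root is no longer a leaf. -/
theorem boundary_tree_split {e : Word → ℝ} (he : IsGeneric e)
    (he' : ∀ b, IsGeneric (shift [b] e)) {t : ℝ} (ht : e [] ≤ t) :
    boundary (tree e t) =
      List.cons false '' boundary (tree (shift [false] e) (t - e [])) ∪
        List.cons true '' boundary (tree (shift [true] e) (t - e [])) := by
  have h : ∀ b u, b :: u ∈ boundary (tree e t) ↔
      u ∈ boundary (tree (shift [b] e) (t - e [])) := by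
    intro b u
    rw [mem_boundary_tree' he, mem_boundary_tree' (he' b), birth_cons, death_cons]
    constructor <;> rintro ⟨h1, h2⟩ <;> constructor <;> linarith
  ext u
  rcases u with _ | ⟨b, u⟩
  · rw [mem_boundary_tree' he, death, birth_nil]
    simp only [Set.mem_union, Set.mem_image, reduceCtorEq, and_false, exists_false, or_self,
      iff_false, not_and, not_lt, zero_add]
    exact fun _ => ht
  · rw [h]
    cases b <;> simp

theorem finite_boundary_tree {e : Word → ℝ} (he : IsGeneric e)
    (h : Tendsto (splitTime e) atTop atTop) {t : ℝ} (ht : 0 ≤ t) : (boundary (tree e t)).Finite := by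
  obtain ⟨n, h1, h2⟩ := exists_splitTime_interval h ht
  rw [boundary_tree_eq he h1 h2]
  exact Finset.finite_toSet _

theorem levelPoly_split {e : Word → ℝ} (he : IsGeneric e)
    (he' : ∀ b, IsGeneric (shift [b] e))
    (h : ∀ b, Tendsto (splitTime (shift [b] e)) atTop atTop) {t : ℝ} (ht : e [] ≤ t) (z : ℝ) :
    levelPoly (tree e t) z = z * (levelPoly (tree (shift [false] e) (t - e [])) z +
      levelPoly (tree (shift [true] e) (t - e [])) z) := by
  have hfin : ∀ b, (boundary (tree (shift [b] e) (t - e []))).Finite := fun b =>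
    finite_boundary_tree (he' b) (h b) (by linarith)
  have himg : ∀ b : Bool, ∑ᶠ u ∈ List.cons b '' boundary (tree (shift [b] e) (t - e [])),
      z ^ u.length = z * levelPoly (tree (shift [b] e) (t - e [])) z := by
    intro b
    rw [finsum_mem_image (List.cons_injective.injOn), levelPoly, mul_finsum_mem' _ _ (hfin b)]
    exact finsum_mem_congr rfl fun u _ => by rw [List.length_cons, pow_succ']
  rw [levelPoly, boundary_tree_split he he' ht, finsum_mem_union, himg, himg, mul_add]
  · rw [Set.disjoint_left]
    rintro _ ⟨u, -, rfl⟩ ⟨v, -, h⟩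
    simp at h
  · exact (hfin false).image _
  · exact (hfin true).image _

theorem yuleM_split {e : Word → ℝ} (he : IsGeneric e)
    (he' : ∀ b, IsGeneric (shift [b] e))
    (h : ∀ b, Tendsto (splitTime (shift [b] e)) atTop atTop) {t : ℝ} (ht : e [] ≤ t) (z : ℝ) :
    yuleM z e t = z * Real.exp ((1 - 2 * z) * e []) *
      (yuleM z (shift [false] e) (t - e []) + yuleM z (shift [true] e) (t - e [])) := by
  have hexp : Real.exp (t * (1 - 2 * z))
      = Real.exp ((1 - 2 * z) * e []) * Real.exp ((t - e []) * (1 - 2 * z)) := by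
    rw [← Real.exp_add]; congr 1; ring
  rw [yuleM, yuleM, yuleM, levelPoly_split he he' h ht, hexp]
  ring

theorem HasLimits.yuleMInf_split {z : ℝ} {e : Word → ℝ} (h : HasLimits z e)
    (h' : ∀ b, HasLimits z (shift [b] e)) :
    yuleMInf z e = z * Real.exp ((1 - 2 * z) * e []) *
      (yuleMInf z (shift [false] e) + yuleMInf z (shift [true] e)) := by
  have hsub : Tendsto (fun t : ℝ => t - e []) atTop atTop :=
    tendsto_atTop_add_const_right _ (-e []) tendsto_id
  have hlim := (((h' false).tendsto_yuleM.comp hsub).add ((h' true).tendsto_yuleM.comp hsub)).const_mul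
    (z * Real.exp ((1 - 2 * z) * e []))
  refine tendsto_nhds_unique h.tendsto_yuleM (hlim.congr' ?_)
  filter_upwards [eventually_ge_atTop (e [])] with t ht
  exact (yuleM_split h.generic (fun b => (h' b).generic) (fun b => (h' b).splitTime_atTop) ht z).symm

/-- At `z = 1` every leaf has weight one and `M(t, 1) = exp (-t) N_t`. The splitting formula for `ξ`
is therefore a case of the one for `M`. -/
theorem HasLimits.yuleMInf_one {e : Word → ℝ} (h : HasLimits 1 e) : yuleMInf 1 e = xi e := by
  refine tendsto_nhds_unique h.tendsto_yuleM (h.tendsto_xi.congr' ?_)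
  filter_upwards [eventually_ge_atTop 0] with t ht
  obtain ⟨n, h1, h2⟩ := exists_splitTime_interval h.splitTime_atTop ht
  rw [yuleM, levelPoly_tree_eq h.generic h1 h2, numLeaves_eq h.generic h1 h2]
  simp only [one_pow, Finset.sum_const, card_leavesAt, nsmul_eq_mul, mul_one, Nat.cast_add,
    Nat.cast_one]
  rw [mul_comm]
  congr 2; ring

theorem xi_split {e : Word → ℝ} (h : HasLimits 1 e) (h' : ∀ b, HasLimits 1 (shift [b] e)) :
    xi e = Real.exp (-e []) * (xi (shift [false] e) + xi (shift [true] e)) := by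
  have := h.yuleMInf_split h'
  rw [h.yuleMInf_one, (h' false).yuleMInf_one, (h' true).yuleMInf_one] at this
  rw [this, one_mul]
  congr 2; ring

theorem HasLimits.bstMInf_eq_yuleMInf {z : ℝ} (hz : 0 < z) {e : Word → ℝ} (h : HasLimits z e) :
    bstMInf z e = Real.Gamma (2 * z) * xi e ^ (1 - 2 * z) * yuleMInf z e := by
  have hG : Real.Gamma (2 * z) ≠ 0 := (Real.Gamma_pos_of_pos (by positivity)).ne'
  have hp : xi e ^ (1 - 2 * z) * xi e ^ (2 * z - 1) = 1 := by
    rw [← Real.rpow_add h.xi_pos, show 1 - 2 * z + (2 * z - 1) = 0 by ring, Real.rpow_zero]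
  rw [h.yuleMInf_eq]
  calc bstMInf z e = xi e ^ (1 - 2 * z) * xi e ^ (2 * z - 1) * bstMInf z e := by
        rw [hp, one_mul]
    _ = _ := by field_simp

/-- Solve the limit connection for `𝓜_∞`, expand `M` by its splitting formula, and apply the
connection in both subtrees. Since `ξ = exp (-e []) (ξ_0 + ξ_1)`, the exponentials cancel and the
powers of `ξ_0`, `ξ_1` and their sum combine into powers of `U` and `1 - U`. -/
theorem HasLimits.bstMInf_split {z : ℝ} (hz : 0 < z) {e : Word → ℝ} (h : HasLimits z e)
    (h' : ∀ b, HasLimits z (shift [b] e)) (h₁ : HasLimits 1 e)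
    (h₁' : ∀ b, HasLimits 1 (shift [b] e)) :
    bstMInf z e = z * (splitU e ^ (2 * z - 1) * bstMInf z (shift [false] e) +
      (1 - splitU e) ^ (2 * z - 1) * bstMInf z (shift [true] e)) := by
  have hx0 := (h' false).xi_pos
  have hx1 := (h' true).xi_pos
  set x0 := xi (shift [false] e) with hx0def
  set x1 := xi (shift [true] e) with hx1def
  have hs : 0 < x0 + x1 := by positivity
  have hG : Real.Gamma (2 * z) ≠ 0 := (Real.Gamma_pos_of_pos (by positivity)).ne'
  have hU : splitU e = x0 / (x0 + x1) := rfl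
  have hU' : 1 - splitU e = x1 / (x0 + x1) := by rw [hU]; field_simp; ring
  have hexp : Real.exp (-e []) ^ (1 - 2 * z) * Real.exp ((1 - 2 * z) * e []) = 1 := by
    rw [← Real.exp_mul, ← Real.exp_add, ← Real.exp_zero]; congr 1; ring
  have hinv : (x0 + x1) ^ (1 - 2 * z) = ((x0 + x1) ^ (2 * z - 1))⁻¹ := by
    rw [← Real.rpow_neg hs.le]; congr 1; ring
  have hsp := (Real.rpow_pos_of_pos hs (2 * z - 1)).ne'
  rw [h.bstMInf_eq_yuleMInf hz, xi_split h₁ h₁', h.yuleMInf_split h', hU', hU,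
    Real.div_rpow hx0.le hs.le, Real.div_rpow hx1.le hs.le,
    Real.mul_rpow (Real.exp_nonneg _) hs.le, (h' false).yuleMInf_eq, (h' true).yuleMInf_eq,
    ← hx0def, ← hx1def, hinv]
  calc Real.Gamma (2 * z) * (Real.exp (-e []) ^ (1 - 2 * z) * ((x0 + x1) ^ (2 * z - 1))⁻¹) *
        (z * Real.exp ((1 - 2 * z) * e []) *
          (x0 ^ (2 * z - 1) / Real.Gamma (2 * z) * bstMInf z (shift [false] e) +
            x1 ^ (2 * z - 1) / Real.Gamma (2 * z) * bstMInf z (shift [true] e)))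
      = (Real.exp (-e []) ^ (1 - 2 * z) * Real.exp ((1 - 2 * z) * e [])) *
        (Real.Gamma (2 * z) * ((x0 + x1) ^ (2 * z - 1))⁻¹ * (z *
          (x0 ^ (2 * z - 1) / Real.Gamma (2 * z) * bstMInf z (shift [false] e) +
            x1 ^ (2 * z - 1) / Real.Gamma (2 * z) * bstMInf z (shift [true] e)))) := by ring
    _ = _ := by rw [hexp]; field_simp

theorem jumpTime_one {e : Word → ℝ} (he : IsGeneric e) : jumpTime e 1 = e [] := by
  rw [jumpTime_eq_splitTime he, (describes_leavesAt he 0).splitTime_succ_eq]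
  have h := splitAt_mem_leavesAt e 0
  have hl : leavesAt e 0 = {[]} := rfl
  rw [hl, Finset.mem_singleton] at h
  rw [h, death, birth_nil, zero_add]

/-! ### Independence -/

section Independence

variable {Ω : Type*} {m : MeasurableSpace Ω} {μ : Measure Ω} [IsProbabilityMeasure μ]

theorem iIndepFun_of_measure_iInter_eq_prod {ι : Type*} [Fintype ι] {β : ι → Type*}
    [∀ i, MeasurableSpace (β i)] {f : (i : ι) → Ω → β i} (hf : ∀ i, Measurable (f i))
    (h : ∀ s : (i : ι) → Set (β i), (∀ i, MeasurableSet (s i)) →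
      μ (⋂ i, f i ⁻¹' s i) = ∏ i, μ (f i ⁻¹' s i)) : iIndepFun f μ := by
  have hp : ∀ i, IsProbabilityMeasure (μ.map (f i)) := fun i =>
    Measure.isProbabilityMeasure_map (hf i).aemeasurable
  rw [iIndepFun_iff_map_fun_eq_pi_map fun i => (hf i).aemeasurable]
  refine (Measure.pi_eq fun s hs => ?_).symm
  rw [Measure.map_apply (measurable_pi_lambda _ hf) (MeasurableSet.univ_pi hs)]
  have : (fun ω i => f i ω) ⁻¹' Set.univ.pi s = ⋂ i, f i ⁻¹' s i := by
    ext ω; simp [Set.mem_pi]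
  rw [this, h s hs]
  exact Finset.prod_congr rfl fun i _ => (Measure.map_apply (hf i) (hs i)).symm

theorem iIndepFun_bool {γ : Type*} [MeasurableSpace γ] {f : Bool → Ω → γ}
    (hf : ∀ b, Measurable (f b)) (h : IndepFun (f false) (f true) μ) : iIndepFun f μ := by
  refine iIndepFun_of_measure_iInter_eq_prod hf fun s hs => ?_
  have hset : ⋂ i, f i ⁻¹' s i = f false ⁻¹' s false ∩ f true ⁻¹' s true := by
    ext ω; simp [Bool.forall_bool]
  rw [Fintype.prod_bool, hset, mul_comm]
  exact indepFun_iff_measure_inter_preimage_eq_mul.1 h _ _ (hs false) (hs true)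

theorem iIndepFun_three {f g h : Ω → ℝ} (hf : Measurable f) (hg : Measurable g)
    (hh : Measurable h) (h1 : IndepFun f (fun ω => (g ω, h ω)) μ) (h2 : IndepFun g h μ) :
    iIndepFun (![f, g, h] : Fin 3 → Ω → ℝ) μ := by
  refine iIndepFun_of_measure_iInter_eq_prod (fun i => ?_) fun s hs => ?_
  · fin_cases i
    · exact hf
    · exact hg
    · exact hh
  · have e1 := indepFun_iff_measure_inter_preimage_eq_mul.1 h1 (s 0) (s 1 ×ˢ s 2) (hs 0)
      ((hs 1).prod (hs 2))
    have e2 := indepFun_iff_measure_inter_preimage_eq_mul.1 h2 (s 1) (s 2) (hs 1) (hs 2)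
    have hset : (⋂ i, (![f, g, h] : Fin 3 → Ω → ℝ) i ⁻¹' s i)
        = f ⁻¹' s 0 ∩ (fun ω => (g ω, h ω)) ⁻¹' (s 1 ×ˢ s 2) := by
      ext ω
      simp [Fin.forall_fin_succ]
    have hset2 : (fun ω => (g ω, h ω)) ⁻¹' (s 1 ×ˢ s 2) = g ⁻¹' s 1 ∩ h ⁻¹' s 2 := rfl
    rw [hset, e1, hset2, e2, Fin.prod_univ_three, mul_assoc]
    rfl

theorem iIndepFun_comp_of_hasLaw {Ω' : Type*} [MeasurableSpace Ω'] {P : Measure Ω'}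
    [IsProbabilityMeasure P] {E : Ω → Ω'} (hE : HasLaw E P μ) {ι : Type*} [Fintype ι]
    {F : ι → Ω' → ℝ} (hF : ∀ i, Measurable (F i)) (h : iIndepFun F P) :
    iIndepFun (fun i ω => F i (E ω)) μ := by
  have hFE : ∀ i, AEMeasurable (fun ω => F i (E ω)) μ := fun i =>
    (hF i).comp_aemeasurable hE.aemeasurable
  have hmap : ∀ i, μ.map (fun ω => F i (E ω)) = P.map (F i) := fun i => by
    rw [← hE.map_eq, AEMeasurable.map_map_of_aemeasurable (hF i).aemeasurable hE.aemeasurable]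
    rfl
  rw [iIndepFun_iff_map_fun_eq_pi_map fun i => (hF i).aemeasurable] at h
  rw [iIndepFun_iff_map_fun_eq_pi_map hFE]
  simp only [hmap]
  rw [← h, ← hE.map_eq, AEMeasurable.map_map_of_aemeasurable
    (measurable_pi_lambda _ hF).aemeasurable hE.aemeasurable]
  rfl

end Independence

theorem comap_comp_le_iSup {ι α : Type*} (p : α → ι) :
    MeasurableSpace.comap (fun (r : ι → ℝ) a => r (p a)) MeasurableSpace.pi
      ≤ ⨆ i ∈ Set.range p, MeasurableSpace.comap (fun r : ι → ℝ => r i) inferInstance := by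
  rw [MeasurableSpace.pi, MeasurableSpace.comap_iSup]
  refine iSup_le fun a => ?_
  rw [MeasurableSpace.comap_comp]
  exact le_iSup₂ (f := fun i (_ : i ∈ Set.range p) =>
    MeasurableSpace.comap (fun r : ι → ℝ => r i) inferInstance) (p a) ⟨a, rfl⟩

/-- Two subfamilies of clocks with disjoint index sets generate independent σ-algebras. -/
theorem indepFun_clocks {ι α β : Type*} (p : α → ι) (q : β → ι) (h : ∀ a b, p a ≠ q b) :
    IndepFun (fun (r : ι → ℝ) a => r (p a)) (fun (r : ι → ℝ) b => r (q b)) (clockLaw ι) := by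
  have hind : iIndep (fun i : ι => MeasurableSpace.comap (fun r : ι → ℝ => r i) inferInstance)
      (clockLaw ι) :=
    iIndepFun_infinitePi (P := fun _ : ι => expMeasure 1) (X := fun _ x => x)
      fun _ => measurable_id
  have hdis : Disjoint (Set.range p) (Set.range q) := by
    rw [Set.disjoint_left]
    rintro _ ⟨a, rfl⟩ ⟨b, hb⟩
    exact h a b hb.symm
  have key := indep_iSup_of_disjoint (fun i => (measurable_pi_apply i).comap_le) hind hdis
  rw [IndepFun_iff_Indep]
  exact indep_of_indep_of_le_left (indep_of_indep_of_le_right key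
    (comap_comp_le_iSup q)) (comap_comp_le_iSup p)

theorem indepFun_root_shift :
    IndepFun (fun e : Word → ℝ => e []) (fun e => (shift [false] e, shift [true] e))
      (clockLaw Word) := by
  have h := indepFun_clocks (fun _ : Unit => ([] : Word))
    (fun p : Bool × Word => (p.1 :: p.2 : Word)) (by simp)
  exact h.comp (φ := fun r : Unit → ℝ => r ())
    (ψ := fun r : Bool × Word → ℝ => ((fun u => r (false, u)), (fun u => r (true, u))))
    (measurable_pi_apply _) (by fun_prop)

theorem indepFun_shift_shift :
    IndepFun (shift [false]) (shift [true]) (clockLaw Word) :=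
  indepFun_clocks (fun u => [false] ++ u) (fun u => [true] ++ u) (by simp)

/-! ### A ratio of exponential variables -/

theorem eq_volume_restrict_Icc_of_Ioi {ν : Measure ℝ} [IsProbabilityMeasure ν]
    (h : ∀ u, 0 ≤ u → u < 1 → ν (Set.Ioi u) = ENNReal.ofReal (1 - u)) :
    ν = volume.restrict (Set.Icc (0 : ℝ) 1) := by
  have : IsProbabilityMeasure (volume.restrict (Set.Icc (0 : ℝ) 1)) := ⟨by simp⟩
  have hvol : ∀ u : ℝ, 0 ≤ u → u < 1 →
      volume.restrict (Set.Icc (0 : ℝ) 1) (Set.Ioi u) = ENNReal.ofReal (1 - u) := by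
    intro u hu hu1
    rw [Measure.restrict_apply measurableSet_Ioi]
    have : Set.Ioi u ∩ Set.Icc 0 1 = Set.Ioc u 1 := by
      ext x
      simp only [Set.mem_inter_iff, Set.mem_Ioi, Set.mem_Icc, Set.mem_Ioc]
      constructor
      · rintro ⟨h1, -, h2⟩; exact ⟨h1, h2⟩
      · rintro ⟨h1, h2⟩; exact ⟨h1, by linarith, h2⟩
    rw [this, Real.volume_Ioc]
  have hIic : ∀ (ρ : Measure ℝ) [IsProbabilityMeasure ρ] (x : ℝ),
      ρ (Set.Iic x) = 1 - ρ (Set.Ioi x) := fun ρ _ x => by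
    rw [← prob_compl_eq_one_sub measurableSet_Ioi, Set.compl_Ioi]
  have hneg : ∀ (ρ : Measure ℝ) [IsProbabilityMeasure ρ],
      (∀ u, 0 ≤ u → u < 1 → ρ (Set.Ioi u) = ENNReal.ofReal (1 - u)) → ∀ u < 0,
      ρ (Set.Iic u) = 0 := by
    intro ρ _ hρ u hu
    refine measure_mono_null (Set.Iic_subset_Iic.2 hu.le) ?_
    rw [hIic, hρ 0 le_rfl one_pos]
    simp
  have hbig : ∀ (ρ : Measure ℝ) [IsProbabilityMeasure ρ],
      (∀ u, 0 ≤ u → u < 1 → ρ (Set.Ioi u) = ENNReal.ofReal (1 - u)) → ∀ u, 1 ≤ u →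
      ρ (Set.Ioi u) = 0 := by
    intro ρ _ hρ u hu
    have hc : Continuous fun v : ℝ => ENNReal.ofReal (1 - v) :=
      ENNReal.continuous_ofReal.comp (by fun_prop)
    have hlim : Tendsto (fun v : ℝ => ENNReal.ofReal (1 - v)) (𝓝[<] 1) (𝓝 0) := by
      have := (hc.tendsto 1).mono_left (nhdsWithin_le_nhds (s := Set.Iio 1))
      simpa using this
    refine le_antisymm (ge_of_tendsto hlim ?_) zero_le
    filter_upwards [Ioo_mem_nhdsLT (show (0 : ℝ) < 1 from one_pos)] with v hv
    rw [← hρ v hv.1.le hv.2]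
    exact measure_mono (Set.Ioi_subset_Ioi (hv.2.le.trans hu))
  refine Measure.ext_of_Iic _ _ fun u => ?_
  rcases lt_or_ge u 0 with hu | hu
  · rw [hneg ν h u hu, hneg _ hvol u hu]
  · rw [hIic, hIic]
    rcases lt_or_ge u 1 with hu1 | hu1
    · rw [h u hu hu1, hvol u hu hu1]
    · rw [hbig ν h u hu1, hbig _ hvol u hu1]

/-- For positive `X, Y` and `c = u / (1 - u)`, the ratio `X / (X + Y)` exceeds `u` exactly when `X >
c Y`. Conditioning on `Y`, this has probability `E exp (-c Y) = 1 / (c + 1) = 1 - u`. -/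
theorem map_ratio_expMeasure :
    ((expMeasure 1).prod (expMeasure 1)).map (fun p : ℝ × ℝ => p.1 / (p.1 + p.2))
      = volume.restrict (Set.Icc (0 : ℝ) 1) := by
  have hm : Measurable fun p : ℝ × ℝ => p.1 / (p.1 + p.2) :=
    measurable_fst.div (measurable_fst.add measurable_snd)
  have : IsProbabilityMeasure
      (((expMeasure 1).prod (expMeasure 1)).map fun p : ℝ × ℝ => p.1 / (p.1 + p.2)) :=
    Measure.isProbabilityMeasure_map hm.aemeasurable
  refine eq_volume_restrict_Icc_of_Ioi fun u hu hu1 => ?_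
  have hu1' : 0 < 1 - u := by linarith
  set c : ℝ := u / (1 - u) with hc
  have hc0 : 0 ≤ c := by positivity
  have hms : MeasurableSet {p : ℝ × ℝ | c * p.2 < p.1} :=
    measurableSet_lt (measurable_const.mul measurable_snd) measurable_fst
  have hpos : ∀ᵐ p ∂(expMeasure 1).prod (expMeasure 1), 0 < p.1 ∧ 0 < p.2 :=
    (Measure.quasiMeasurePreserving_fst.ae (ae_pos_expMeasure 1)).and
      (Measure.quasiMeasurePreserving_snd.ae (ae_pos_expMeasure 1))
  rw [Measure.map_apply hm measurableSet_Ioi]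
  have hset : ((fun p : ℝ × ℝ => p.1 / (p.1 + p.2)) ⁻¹' Set.Ioi u)
      =ᵐ[(expMeasure 1).prod (expMeasure 1)] {p : ℝ × ℝ | c * p.2 < p.1} := by
    filter_upwards [hpos] with p hp
    apply propext
    change u < p.1 / (p.1 + p.2) ↔ c * p.2 < p.1
    rw [lt_div_iff₀ (add_pos hp.1 hp.2), hc, div_mul_eq_mul_div, div_lt_iff₀ hu1']
    constructor <;> intro h <;> linarith
  rw [measure_congr hset, Measure.prod_apply_symm hms]
  have hint : ∀ᵐ y ∂expMeasure 1,
      expMeasure 1 ((fun x => (x, y)) ⁻¹' {p : ℝ × ℝ | c * p.2 < p.1})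
        = ENNReal.ofReal (Real.exp (-(c * y))) := by
    filter_upwards [ae_pos_expMeasure 1] with y hy
    have hcy : 0 ≤ c * y := by positivity
    exact expMeasure_one_Ioi hcy
  have : IsProbabilityMeasure (expMeasure (c + 1)) :=
    isProbabilityMeasure_expMeasure (by positivity)
  have hval := lintegral_exp_neg_mul_expMeasure_of_nonneg hc0 MeasurableSet.univ
  rw [measure_univ, mul_one, Measure.restrict_univ] at hval
  rw [lintegral_congr_ae hint, hval, hc]
  congr 1
  field_simp
  ring

/-! ### Measurable versions of the limits -/

noncomputable section

/-- A measurable version of `ξ`. -/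
def xiVersion (e : Word → ℝ) : ℝ := waitLimit fun k => waitAt k ({[]}, e)

/-- A measurable version of `𝓜_∞(z)`. -/
def bstVersion (z : ℝ) (e : Word → ℝ) : ℝ := splitLimit z fun k => splitAt k ({[]}, e)

/-- A measurable version of `M(∞, z)`. -/
def yuleVersion (z : ℝ) (e : Word → ℝ) : ℝ :=
  xiVersion e ^ (2 * z - 1) / Real.Gamma (2 * z) * bstVersion z e

/-- A measurable version of `U`. -/
def splitUVersion (e : Word → ℝ) : ℝ :=
  xiVersion (shift [false] e) / (xiVersion (shift [false] e) + xiVersion (shift [true] e))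

theorem measurable_xiVersion : Measurable xiVersion :=
  measurable_waitLimit.comp measurable_waits

theorem measurable_bstVersion (z : ℝ) : Measurable (bstVersion z) :=
  (measurable_splitLimit z).comp (measurable_pi_lambda _ measurable_splitAt_root)

theorem measurable_yuleVersion (z : ℝ) : Measurable (yuleVersion z) :=
  ((measurable_xiVersion.pow_const _).div_const _).mul (measurable_bstVersion z)

theorem measurable_splitUVersion : Measurable splitUVersion :=
  (measurable_xiVersion.comp (measurable_shift _)).div
    ((measurable_xiVersion.comp (measurable_shift _)).add
      (measurable_xiVersion.comp (measurable_shift _)))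

theorem HasLimits.yuleMInf_eq_version {z : ℝ} {e : Word → ℝ} (h : HasLimits z e) :
    yuleMInf z e = yuleVersion z e := by
  rw [h.yuleMInf_eq, h.xi_eq, h.bstMInf_eq]; rfl

theorem HasLimits.bstMInf_eq_version {z : ℝ} {e : Word → ℝ} (h : HasLimits z e) :
    bstMInf z e = bstVersion z e := h.bstMInf_eq

theorem HasLimits.xi_eq_version {z : ℝ} {e : Word → ℝ} (h : HasLimits z e) :
    xi e = xiVersion e := h.xi_eq

theorem iIndepFun_yuleVersion (z : ℝ) :
    iIndepFun (![fun e => e [], fun e => yuleVersion z (shift [false] e),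
      fun e => yuleVersion z (shift [true] e)] : Fin 3 → (Word → ℝ) → ℝ) (clockLaw Word) := by
  have hy := measurable_yuleVersion z
  refine iIndepFun_three (measurable_pi_apply _) (hy.comp (measurable_shift _))
    (hy.comp (measurable_shift _)) ?_ ?_
  · exact indepFun_root_shift.comp (φ := id)
      (ψ := fun p : (Word → ℝ) × (Word → ℝ) => (yuleVersion z p.1, yuleVersion z p.2))
      measurable_id ((hy.comp measurable_fst).prodMk (hy.comp measurable_snd))
  · exact indepFun_shift_shift.comp hy hy

/-- The limits of the two subtrees of the root; `false` stands for `ξ` and `true` for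
`𝓜_∞(z)`. -/
def subtreeVersion (z : ℝ) (b i : Bool) (e : Word → ℝ) : ℝ :=
  if i then bstVersion z (shift [b] e) else xiVersion (shift [b] e)

theorem measurable_subtreeVersion (z : ℝ) (b i : Bool) : Measurable (subtreeVersion z b i) := by
  cases i
  · exact measurable_xiVersion.comp (measurable_shift _)
  · exact (measurable_bstVersion z).comp (measurable_shift _)

theorem _root_.ProbabilityTheory.IndepFun.comp_measurePreserving {α β γ δ : Type*}
    [MeasurableSpace α] [MeasurableSpace β] [MeasurableSpace γ] [MeasurableSpace δ]
    {P : Measure α} {Q : Measure β} {f : β → γ} {g : β → δ} {θ : α → β} (h : IndepFun f g Q)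
    (hθ : MeasurePreserving θ P Q) (hf : Measurable f) (hg : Measurable g) :
    IndepFun (fun a => f (θ a)) (fun a => g (θ a)) P := by
  rw [indepFun_iff_measure_inter_preimage_eq_mul] at h ⊢
  intro s t hs ht
  have h' := h s t hs ht
  rw [← hθ.measure_preimage ((hf hs).inter (hg ht)).nullMeasurableSet,
    ← hθ.measure_preimage (hf hs).nullMeasurableSet,
    ← hθ.measure_preimage (hg ht).nullMeasurableSet] at h'
  exact h'

theorem indepFun_xiVersion_bstVersion (z : ℝ) :
    IndepFun xiVersion (bstVersion z) (clockLaw Word) :=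
  indepFun_waitLimit_splitLimit z

/-- The four variables are independent: across the two children because the clocks are disjoint,
within one child because splits are independent of waiting times. -/
theorem iIndepFun_subtreeVersion (z : ℝ) :
    iIndepFun (fun (p : Bool × Bool) => subtreeVersion z p.1 p.2) (clockLaw Word) := by
  refine iIndepFun_uncurry' (X := subtreeVersion z) (measurable_subtreeVersion z) ?_ fun b => ?_
  · refine iIndepFun_bool (fun b => measurable_pi_lambda _ fun i =>
      measurable_subtreeVersion z b i) ?_
    have hm : Measurable fun (e : Word → ℝ) (i : Bool) =>
        if i then bstVersion z e else xiVersion e := by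
      refine measurable_pi_lambda _ fun i => ?_
      cases i
      · exact measurable_xiVersion
      · exact measurable_bstVersion z
    exact indepFun_shift_shift.comp hm hm
  · refine iIndepFun_bool (measurable_subtreeVersion z b) ?_
    exact (indepFun_xiVersion_bstVersion z).comp_measurePreserving
      (measurePreserving_shift [b]) measurable_xiVersion (measurable_bstVersion z)

/-- `U` is a function of the pair `(ξ_0, ξ_1)`, which is independent of the pair of search tree
limits. -/
theorem iIndepFun_splitUVersion (z : ℝ) :
    iIndepFun (![splitUVersion, fun e => bstVersion z (shift [false] e),
      fun e => bstVersion z (shift [true] e)] : Fin 3 → (Word → ℝ) → ℝ) (clockLaw Word) := by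
  have hb := measurable_bstVersion z
  refine iIndepFun_three measurable_splitUVersion (hb.comp (measurable_shift _))
    (hb.comp (measurable_shift _)) ?_ (indepFun_shift_shift.comp hb hb)
  have h := (iIndepFun_subtreeVersion z).indepFun_prodMk_prodMk
    (fun p => measurable_subtreeVersion z p.1 p.2) (false, false) (true, false) (false, true)
    (true, true) (by simp) (by simp) (by simp) (by simp)
  exact h.comp (φ := fun p : ℝ × ℝ => p.1 / (p.1 + p.2)) (ψ := id)
    (measurable_fst.div (measurable_fst.add measurable_snd)) measurable_id

theorem hasLaw_xiVersion : HasLaw xiVersion (expMeasure 1) (clockLaw Word) :=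
  hasLaw_waitLimit

theorem hasLaw_splitUVersion :
    HasLaw splitUVersion (volume.restrict (Set.Icc (0 : ℝ) 1)) (clockLaw Word) := by
  have hx : ∀ b, HasLaw (fun e => xiVersion (shift [b] e)) (expMeasure 1) (clockLaw Word) :=
    fun b => hasLaw_xiVersion.comp (measurePreserving_shift [b]).hasLaw
  have hind : IndepFun (fun e => xiVersion (shift [false] e))
      (fun e => xiVersion (shift [true] e)) (clockLaw Word) :=
    indepFun_shift_shift.comp measurable_xiVersion measurable_xiVersion
  have hmap := (indepFun_iff_map_prod_eq_prod_map_map (hx false).aemeasurable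
    (hx true).aemeasurable).1 hind
  rw [(hx false).map_eq, (hx true).map_eq] at hmap
  refine ⟨measurable_splitUVersion.aemeasurable, ?_⟩
  have hr : Measurable fun p : ℝ × ℝ => p.1 / (p.1 + p.2) :=
    measurable_fst.div (measurable_fst.add measurable_snd)
  have hp : Measurable fun e : Word → ℝ =>
      (xiVersion (shift [false] e), xiVersion (shift [true] e)) :=
    (measurable_xiVersion.comp (measurable_shift _)).prodMk
      (measurable_xiVersion.comp (measurable_shift _))
  have hc := Measure.map_map (μ := clockLaw Word) hr hp
  rw [hmap, map_ratio_expMeasure] at hc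
  exact hc.symm

end

/-! ### Transfer to an arbitrary probability space -/

section Transfer

variable {Ω : Type*} [MeasurableSpace Ω] {μ : Measure Ω} {E : Ω → Word → ℝ}

theorem ae_of_hasLaw (hE : HasLaw E (clockLaw Word) μ) {p : (Word → ℝ) → Prop}
    (h : ∀ᵐ e ∂clockLaw Word, p e) : ∀ᵐ ω ∂μ, p (E ω) := by
  rw [← hE.map_eq] at h
  exact ae_of_ae_map hE.aemeasurable h

/-- `bst` is defined through an infimum over real times; off a null set it is a function of the
countably valued history. Null measurability is enough to push the events through `E`. -/
theorem nullMeasurableSet_bst_eq (n : ℕ) (T : Set Word) :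
    NullMeasurableSet {e : Word → ℝ | bst e n = T} (clockLaw Word) := by
  have h : MeasurableSet {e : Word → ℝ | treeAfter (history n ({[]}, e)) = T} :=
    measurable_history_root n (MeasurableSet.of_discrete (s := {l | treeAfter l = T}))
  refine h.nullMeasurableSet.congr ?_
  filter_upwards [ae_isGeneric] with e he
  apply propext
  change treeAfter (history n ({[]}, e)) = T ↔ bst e n = T
  rw [bst_eq_treeAfter he]

theorem isBSTProcess_of_hasLaw (hE : HasLaw E (clockLaw Word) μ) :
    IsBSTProcess μ fun n ω => bst (E ω) n := by
  obtain ⟨h0, h1, h2⟩ := isBSTProcess_clockLaw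
  refine ⟨ae_of_hasLaw hE h0, fun n => ae_of_hasLaw hE (h1 n), fun n t u hu => ?_⟩
  have hA : NullMeasurableSet {e : Word → ℝ | ∀ j ≤ n, bst e j = t j} (clockLaw Word) := by
    have : {e : Word → ℝ | ∀ j ≤ n, bst e j = t j} = ⋂ j, ⋂ _ : j ≤ n, {e | bst e j = t j} := by
      ext; simp
    refine (congrArg (NullMeasurableSet · (clockLaw Word)) this).mpr ?_
    exact NullMeasurableSet.iInter fun j => NullMeasurableSet.iInter fun _ =>
      nullMeasurableSet_bst_eq j _
  have hB := hA.inter (nullMeasurableSet_bst_eq (n + 1) (t n ∪ {u ++ [false], u ++ [true]}))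
  have h := h2 n t u hu
  rw [← hE.map_eq] at hA hB h
  have e1 := Measure.map_apply₀ hE.aemeasurable hA
  have e2 := Measure.map_apply₀ hE.aemeasurable hB
  change μ.map E ({e | ∀ j ≤ n, bst e j = t j} ∩
    {e | bst e (n + 1) = t n ∪ {u ++ [false], u ++ [true]}}) = _ at h
  rw [e1, e2] at h
  exact h

/-- `f` is meant to be one of the limits, taken with `limUnder`, and `g` its measurable version, for
which equality of laws is immediate. -/
theorem identDistrib_of_hasLaw {E' : Ω → Word → ℝ} (hE : HasLaw E (clockLaw Word) μ)
    (hE' : HasLaw E' (clockLaw Word) μ) {f g : (Word → ℝ) → ℝ} (hg : Measurable g)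
    (hfg : ∀ᵐ e ∂clockLaw Word, f e = g e) :
    IdentDistrib (fun ω => f (E' ω)) (fun ω => f (E ω)) μ μ := by
  have h1 : (fun ω => f (E ω)) =ᵐ[μ] fun ω => g (E ω) := ae_of_hasLaw hE hfg
  have h2 : (fun ω => f (E' ω)) =ᵐ[μ] fun ω => g (E' ω) := ae_of_hasLaw hE' hfg
  have m1 : AEMeasurable (fun ω => g (E ω)) μ := hg.comp_aemeasurable hE.aemeasurable
  have m2 : AEMeasurable (fun ω => g (E' ω)) μ := hg.comp_aemeasurable hE'.aemeasurable
  have hmap : ∀ F : Ω → Word → ℝ, HasLaw F (clockLaw Word) μ →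
      μ.map (fun ω => g (F ω)) = (clockLaw Word).map g := fun F hF => by
    rw [← hF.map_eq, AEMeasurable.map_map_of_aemeasurable hg.aemeasurable hF.aemeasurable]
    rfl
  refine ⟨m2.congr h2.symm, m1.congr h1.symm, ?_⟩
  rw [Measure.map_congr h2, Measure.map_congr h1, hmap E hE, hmap E' hE']

end Transfer

end YuleBST

/-! ### The theorem, read off from the joint law of the lifetimes -/

theorem theorem3p3 {Ω : Type*} [MeasurableSpace Ω] (μ : Measure Ω) [IsProbabilityMeasure μ]
    (E : Ω → Word → ℝ)
    (hlaw : ∀ u : Word, HasLaw (fun ω => E ω u) (expMeasure 1) μ)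
    (hindep : iIndepFun (fun (u : Word) (ω : Ω) => E ω u) μ)
    (z : ℝ) (hz : z ∈ Set.Ioo zcMinus zcPlus) :
    -- the embedded process is the binary search tree process
    IsBSTProcess μ (fun n ω => bst (E ω) n) ∧
    -- the limits exist, for the whole tree and for the subtrees, and `ξ` is exponential
    (∀ w : Word,
      (∀ᵐ ω ∂μ, Tendsto (fun t : ℝ => Real.exp (-t) * (numLeaves (shift w (E ω)) t : ℝ)) atTop
        (𝓝 (xi (shift w (E ω))))) ∧
      (∀ᵐ ω ∂μ, Tendsto (fun t : ℝ => yuleM z (shift w (E ω)) t) atTop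
        (𝓝 (yuleMInf z (shift w (E ω))))) ∧
      (∀ᵐ ω ∂μ, Tendsto (fun n : ℕ => bstM z (shift w (E ω)) n) atTop
        (𝓝 (bstMInf z (shift w (E ω)))))) ∧
    HasLaw (fun ω => xi (E ω)) (expMeasure 1) μ ∧
    -- the limit martingale connection
    (∀ᵐ ω ∂μ, yuleMInf z (E ω) =
      xi (E ω) ^ (2 * z - 1) / Real.Gamma (2 * z) * bstMInf z (E ω)) ∧
    -- the splitting formula for the Yule process
    ((∀ᵐ ω ∂μ, yuleMInf z (E ω) =
        z * Real.exp ((1 - 2 * z) * jumpTime (E ω) 1) *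
          (yuleMInf z (shift [false] (E ω)) + yuleMInf z (shift [true] (E ω)))) ∧
      iIndepFun (![fun ω => jumpTime (E ω) 1, fun ω => yuleMInf z (shift [false] (E ω)),
        fun ω => yuleMInf z (shift [true] (E ω))] : Fin 3 → Ω → ℝ) μ ∧
      ∀ b : Bool, IdentDistrib (fun ω => yuleMInf z (shift [b] (E ω)))
        (fun ω => yuleMInf z (E ω)) μ μ) ∧
    -- the splitting formula for the binary search tree
    ((∀ᵐ ω ∂μ, bstMInf z (E ω) =
        z * (splitU (E ω) ^ (2 * z - 1) * bstMInf z (shift [false] (E ω)) +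
          (1 - splitU (E ω)) ^ (2 * z - 1) * bstMInf z (shift [true] (E ω)))) ∧
      HasLaw (fun ω => splitU (E ω)) (volume.restrict (Set.Icc (0 : ℝ) 1)) μ ∧
      iIndepFun (![fun ω => splitU (E ω), fun ω => bstMInf z (shift [false] (E ω)),
        fun ω => bstMInf z (shift [true] (E ω))] : Fin 3 → Ω → ℝ) μ ∧
      ∀ b : Bool, IdentDistrib (fun ω => bstMInf z (shift [b] (E ω)))
        (fun ω => bstMInf z (E ω)) μ μ) := by
  have hz0 : 0 < z := (half_pos cLow_cHigh_spec.1).trans hz.1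
  have hEm : AEMeasurable E μ := aemeasurable_pi_iff.2 fun u => (hlaw u).aemeasurable
  have hE : HasLaw E (clockLaw Word) μ := hindep.hasLaw_infinitePi hlaw hEm
  have hshift : ∀ w, HasLaw (fun ω => shift w (E ω)) (clockLaw Word) μ := fun w =>
    (measurePreserving_shift w).hasLaw.comp hE
  have hlim : ∀ w, ∀ᵐ ω ∂μ, HasLimits z (shift w (E ω)) := fun w =>
    ae_of_hasLaw (hshift w) (ae_hasLimits hz0)
  have hlim' : ∀ᵐ ω ∂μ, HasLimits z (E ω) := ae_of_hasLaw hE (ae_hasLimits hz0)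
  -- The parameter `1` is needed alongside `z`: it carries the splitting of `ξ` used in the search
  -- tree formula.
  have hlim₁ : ∀ w, ∀ᵐ ω ∂μ, HasLimits 1 (shift w (E ω)) := fun w =>
    ae_of_hasLaw (hshift w) (ae_hasLimits one_pos)
  have hlim₁' : ∀ᵐ ω ∂μ, HasLimits 1 (E ω) := ae_of_hasLaw hE (ae_hasLimits one_pos)
  have hchild : ∀ᵐ ω ∂μ, ∀ b : Bool, HasLimits z (shift [b] (E ω)) := ae_all_iff.2 fun b => hlim [b]
  have hchild₁ : ∀ᵐ ω ∂μ, ∀ b : Bool, HasLimits 1 (shift [b] (E ω)) :=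
    ae_all_iff.2 fun b => hlim₁ [b]
  have hU : ∀ᵐ ω ∂μ, splitUVersion (E ω) = splitU (E ω) := by
    filter_upwards [hchild] with ω h
    rw [splitU, (h false).xi_eq_version, (h true).xi_eq_version, splitUVersion]
  refine ⟨isBSTProcess_of_hasLaw hE, fun w => ⟨?_, ?_, ?_⟩, ?_, ?_, ⟨?_, ?_, fun b => ?_⟩,
    ?_, ?_, ?_, fun b => ?_⟩
  · exact (hlim w).mono fun ω h => h.tendsto_xi
  · exact (hlim w).mono fun ω h => h.tendsto_yuleM
  · exact (hlim w).mono fun ω h => h.tendsto_bstM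
  · exact (hasLaw_xiVersion.comp hE).congr (hlim'.mono fun ω h => h.xi_eq_version)
  · exact hlim'.mono fun ω h => h.yuleMInf_eq
  · filter_upwards [hlim', hchild] with ω h h'
    rw [jumpTime_one h.generic]
    exact h.yuleMInf_split h'
  · refine (iIndepFun_comp_of_hasLaw hE (fun i => ?_) (iIndepFun_yuleVersion z)).congr
      fun i => ?_
    · fin_cases i
      · exact measurable_pi_apply _
      · exact (measurable_yuleVersion z).comp (measurable_shift _)
      · exact (measurable_yuleVersion z).comp (measurable_shift _)
    · fin_cases i
      · exact hlim'.mono fun ω h => (jumpTime_one h.generic).symm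
      · exact hchild.mono fun ω h => (h false).yuleMInf_eq_version.symm
      · exact hchild.mono fun ω h => (h true).yuleMInf_eq_version.symm
  · exact identDistrib_of_hasLaw hE (hshift [b]) (measurable_yuleVersion z)
      ((ae_hasLimits hz0).mono fun e h => h.yuleMInf_eq_version)
  · filter_upwards [hlim', hchild, hlim₁', hchild₁] with ω h h' h₁ h₁'
    exact h.bstMInf_split hz0 h' h₁ h₁'
  · exact (hasLaw_splitUVersion.comp hE).congr (hU.mono fun ω h => h.symm)
  · refine (iIndepFun_comp_of_hasLaw hE (fun i => ?_) (iIndepFun_splitUVersion z)).congr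
      fun i => ?_
    · fin_cases i
      · exact measurable_splitUVersion
      · exact (measurable_bstVersion z).comp (measurable_shift _)
      · exact (measurable_bstVersion z).comp (measurable_shift _)
    · fin_cases i
      · exact hU
      · exact hchild.mono fun ω h => (h false).bstMInf_eq_version.symm
      · exact hchild.mono fun ω h => (h true).bstMInf_eq_version.symm
  · exact identDistrib_of_hasLaw hE (hshift [b]) (measurable_bstVersion z)
      ((ae_hasLimits hz0).mono fun e h => h.bstMInf_eq_version)
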